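/- \textbf{Setting.} Let $\Omega\subset\mathbb{R}^p$ be a bounded domain, $r\ge 2$ an integer, $\alpha\in(0,1]$, and let $X_0,X_1,\dots,X_n$ be vector fields on $\Omega$. Put $p_0=2$ and $p_i=1$ for $i=1,\dots,n$. For a multiindex $I=(i_1,\dots,i_k)$ put $|I|=\sum_j p_{i_j}$ and $X_{[I]}=[X_{i_1},[X_{i_2},\dots[X_{i_{k-1}},X_{i_k}]\dots]]$, and let $A_{IJ}$ be the universal constants with $X_{[I]}=\sum_J A_{IJ}X_{i'_1}\cdots X_{i'_m}$ (sum over $J=(i'_1,\dots,i'_m)$), i.e. the coefficients of the formal iterated commutator in noncommuting variables. Assume: (a) the coefficients of $X_i$ belong to $C^{r-p_i,\alpha}(\Omega)$ for $i=0,1,\dots,n$; (b) $\{(X_{[I]})_x\}_{|I|\le r}$ spans $\mathbb{R}^p$ for every $x\in\Omega$; (c) $X_0,\dots,X_n$ are free up to weight $r$ at every $x\in\Omega$: if $\sum_{|I|\le r}a_I(X_{[I]})_x=0$ with constants $a_I$, then $\sum_{|I|\le r}a_IA_{IJ}=0$ for all $J$. \textbf{Control distance.} For $x,y\in\Omega$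 let $d(x,y)$ be the infimum of all $\delta>0$ for which there is an absolutely continuous $\varphi:[0,1]\to\Omega$ with $\varphi(0)=x$, $\varphi(1)=y$ and, for almost every $t$, $\varphi'(t)=\sum_{|I|\le r}a_I(t)(X_{[I]})_{\varphi(t)}$ with $|a_I(t)|\le\delta^{|I|}$ (and $d(x,y)=\infty$ if there is no such $\delta$). \textbf{The map $\Theta$.} Fix $\overline{x}\in\Omega$ and a set $B$ of multiindices $I$ with $|I|\le r$ such that $\{(X_{[I]})_{\overline{x}}\}_{I\in B}$ is a basis of $\mathbb{R}^p$. For $y\in\Omega$ let $S_i^{y}$ be the polynomial vector field whose coefficients are the Taylor polynomials of center $y$ and order $r-p_i$ of the coefficients of $X_i$, and let $$E(u,y)=\exp\Big(\sum_{I\in B}u_I S^{y}_{[I]}\Big)(y),\qquad u=(u_I)_{I\in B}$$ be the value at time $1$ of the integral curve that starts at $y$. Let $U$ be an open neighborhood of $0$ in $\mathbb{R}^B$ and $W_0\subset\Omega$ a neighborhood of $\overline{x}$ such that, for every $y\in W_0$, the map $E(\cdot,y)$ is defined on $U$ and is a smooth diffeomorphism of $U$ onto an open set containing $W_0$; $\Theta_y$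 denotes its inverse. Put $\|u\|=\sum_{J\in B}|u_J|^{1/|J|}$ and $\rho(x,y)=\|\Theta_y(x)\|$ for $x,y\in W_0$. \textbf{Proposition.} For every $\overline{x}\in\Omega$ and every such $B$, sets $U$ and $W_0$ as above exist. For every such $U$ and $W_0$ there are a neighborhood $W\subset W_0$ of $\overline{x}$ and constants $C_1,C_2>0$ such that, for all $x,y\in W$, $$C_1\,d(x,y)\le\rho(x,y)\le C_2\,d(x,y).$$ -/

import Mathlib

open Set Filter Topology MeasureTheory
open scoped ENNReal ContDiff

noncomputable section

namespace WeightedFields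

/-- The weight of the index `i`: `p₀ = 2` and `pᵢ = 1` for `i = 1, …, n`. -/
def fieldWeight {n : ℕ} (i : Fin (n + 1)) : ℕ := if i = 0 then 2 else 1

/-- The weight `|I| = p_{i₁} + ⋯ + p_{iₖ}` of the multiindex `I = (i₁, …, iₖ)`. -/
def weight {n : ℕ} (I : List (Fin (n + 1))) : ℕ := (I.map fieldWeight).sum

theorem length_le_weight {n : ℕ} (I : List (Fin (n + 1))) : I.length ≤ weight I := by
  induction I with
  | nil => simp
  | cons i I ih =>
    have h : 1 ≤ fieldWeight i := by unfold fieldWeight; split_ifs <;> omega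
    have h' : weight (i :: I) = fieldWeight i + weight I := by simp [weight]
    rw [h', List.length_cons]
    omega

theorem finite_weight_le (n r : ℕ) :
    {I : List (Fin (n + 1)) | I ≠ [] ∧ weight I ≤ r}.Finite :=
  (List.finite_length_le (Fin (n + 1)) r).subset
    fun I hI => (length_le_weight I).trans hI.2

/-- The finite set of all (nonempty) multiindices `I` with `|I| ≤ r`. -/
def multiindices (n r : ℕ) : Finset (List (Fin (n + 1))) := (finite_weight_le n r).toFinset

theorem mem_multiindices {n r : ℕ} {I : List (Fin (n + 1))} :
    I ∈ multiindices n r ↔ I ≠ [] ∧ weight I ≤ r := by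
  simp [multiindices]

/-- The iterated commutator `X_[I] = [X_{i₁}, [X_{i₂}, …, [X_{iₖ₋₁}, X_{iₖ}] … ]]`, where
`[V, W] = (DW) V - (DV) W`. (The empty multiindex is never used.) -/
def bracket {n p : ℕ} (X : Fin (n + 1) → EuclideanSpace ℝ (Fin p) → EuclideanSpace ℝ (Fin p)) :
    List (Fin (n + 1)) → EuclideanSpace ℝ (Fin p) → EuclideanSpace ℝ (Fin p)
  | [] => 0
  | [i] => X i
  | i :: j :: I => VectorField.lieBracket ℝ (X i) (bracket X (j :: I))

/-- The formal iterated commutator `ξ_[I]` of the noncommuting variables `ξ₀, …, ξₙ`, a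
noncommutative polynomial. -/
def formalBracket {n : ℕ} :
    List (Fin (n + 1)) → MonoidAlgebra ℝ (FreeMonoid (Fin (n + 1)))
  | [] => 0
  | [i] => MonoidAlgebra.of ℝ _ (FreeMonoid.of i)
  | i :: j :: I =>
      MonoidAlgebra.of ℝ _ (FreeMonoid.of i) * formalBracket (j :: I) -
        formalBracket (j :: I) * MonoidAlgebra.of ℝ _ (FreeMonoid.of i)

/-- The universal constants `A_{IJ}` with `X_[I] = ∑_J A_{IJ} X_J`: the coefficient of the
monomial `ξ_J` in `ξ_[I]`. -/
def commutatorCoeff {n : ℕ} (I J : List (Fin (n + 1))) : ℝ :=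
  (formalBracket I).coeff (FreeMonoid.ofList J)

/-- `X₀, …, Xₙ` are free up to weight `s` at the point `x`: the only linear relations among the
vectors `(X_[I])_x`, `|I| ≤ s`, are the universal ones. -/
def FreeUpToWeightAt {n p : ℕ}
    (X : Fin (n + 1) → EuclideanSpace ℝ (Fin p) → EuclideanSpace ℝ (Fin p))
    (s : ℕ) (x : EuclideanSpace ℝ (Fin p)) : Prop :=
  ∀ a : List (Fin (n + 1)) → ℝ,
    ∑ I ∈ multiindices n s, a I • bracket X I x = 0 →
      ∀ J : List (Fin (n + 1)), ∑ I ∈ multiindices n s, a I * commutatorCoeff I J = 0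

/-- The class `C^{k,α}(Ω)`, `Ω` open: `k` times continuously differentiable, the derivatives of
order at most `k` being bounded and those of order `k` Hölder continuous of exponent `α`. -/
def IsHolderClass {F G : Type*} [NormedAddCommGroup F] [NormedSpace ℝ F]
    [NormedAddCommGroup G] [NormedSpace ℝ G] (k : ℕ) (α : ℝ) (Ω : Set F) (f : F → G) : Prop :=
  ContDiffOn ℝ k f Ω ∧
  (∀ m ≤ k, ∃ C : ℝ, ∀ x ∈ Ω, ‖iteratedFDeriv ℝ m f x‖ ≤ C) ∧
  ∃ C : ℝ, ∀ x ∈ Ω, ∀ y ∈ Ω,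
    ‖iteratedFDeriv ℝ k f x - iteratedFDeriv ℝ k f y‖ ≤ C * ‖x - y‖ ^ α

/-- Admissible curves from `x` to `y`: absolutely continuous `φ : [0,1] → Ω` with
`φ' = ∑_{|I| ≤ r} a_I(t) (X_[I])_{φ(t)}` and `|a_I(t)| ≤ δ^{|I|}` almost everywhere. -/
def IsAdmissible {n p : ℕ}
    (X : Fin (n + 1) → EuclideanSpace ℝ (Fin p) → EuclideanSpace ℝ (Fin p)) (r : ℕ)
    (Ω : Set (EuclideanSpace ℝ (Fin p))) (δ : ℝ) (x y : EuclideanSpace ℝ (Fin p))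
    (φ : ℝ → EuclideanSpace ℝ (Fin p)) : Prop :=
  AbsolutelyContinuousOnInterval φ 0 1 ∧ (∀ t ∈ Icc (0 : ℝ) 1, φ t ∈ Ω) ∧ φ 0 = x ∧ φ 1 = y ∧
  ∃ a : List (Fin (n + 1)) → ℝ → ℝ, ∀ᵐ t ∂(volume.restrict (Icc (0 : ℝ) 1)),
    (∀ I ∈ multiindices n r, |a I t| ≤ δ ^ weight I) ∧
    HasDerivAt φ (∑ I ∈ multiindices n r, a I t • bracket X I (φ t)) t

/-- The control distance `d(x, y)` induced on `Ω` by the vector fields: the infimum of all `δ > 0`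
for which `x` and `y` are joined by an admissible curve (`∞` if there is none). -/
def controlDist {n p : ℕ}
    (X : Fin (n + 1) → EuclideanSpace ℝ (Fin p) → EuclideanSpace ℝ (Fin p)) (r : ℕ)
    (Ω : Set (EuclideanSpace ℝ (Fin p))) (x y : EuclideanSpace ℝ (Fin p)) : ℝ≥0∞ :=
  sInf {D : ℝ≥0∞ | ∃ δ : ℝ, 0 < δ ∧ (∃ φ, IsAdmissible X r Ω δ x y φ) ∧ D = ENNReal.ofReal δ}

/-- The smooth approximating vector field `S_i^y`: every coefficient of `X_i` is replaced by its
Taylor polynomial of center `y` and order `r - p_i`. -/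
def taylorField {n p : ℕ}
    (X : Fin (n + 1) → EuclideanSpace ℝ (Fin p) → EuclideanSpace ℝ (Fin p)) (r : ℕ)
    (y : EuclideanSpace ℝ (Fin p)) (i : Fin (n + 1)) (x : EuclideanSpace ℝ (Fin p)) :
    EuclideanSpace ℝ (Fin p) :=
  ∑ k ∈ Finset.range (r - fieldWeight i + 1),
    ((k.factorial : ℝ)⁻¹) • iteratedFDeriv ℝ k (X i) y (fun _ => x - y)

/-- `exp(V)(y) = x`: the integral curve of `V` that starts at `y` exists up to time `1`, when it
is at `x`. -/
def ExpEq {p : ℕ} (V : EuclideanSpace ℝ (Fin p) → EuclideanSpace ℝ (Fin p))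
    (y x : EuclideanSpace ℝ (Fin p)) : Prop :=
  ∃ γ : ℝ → EuclideanSpace ℝ (Fin p), γ 0 = y ∧ γ 1 = x ∧
    IsIntegralCurveOn γ (fun _ => V) (Icc 0 1)

/-- `E(u, y) = x`, where `E(u, y) = exp(∑_{I ∈ B} u_I S_[I]^y)(y)`. -/
def RegExpEq {n p : ℕ}
    (X : Fin (n + 1) → EuclideanSpace ℝ (Fin p) → EuclideanSpace ℝ (Fin p)) (r : ℕ)
    (B : Finset (List (Fin (n + 1)))) (u : B → ℝ) (y x : EuclideanSpace ℝ (Fin p)) : Prop :=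
  ExpEq (fun z => ∑ I : B, u I • bracket (taylorField X r y) I z) y x

/-- `Θ_y` (`y ∈ W`) is the map of regularized canonical coordinates, with coordinates ranging
over the fixed open neighborhood `U` of `0`: `u ↦ E(u, y)` is defined on `U`, it is a smooth
diffeomorphism of `U` onto an open set that contains `W`, and `Θ_y` is its inverse. -/
def IsThetaMap {n p : ℕ}
    (X : Fin (n + 1) → EuclideanSpace ℝ (Fin p) → EuclideanSpace ℝ (Fin p)) (r : ℕ)
    (B : Finset (List (Fin (n + 1)))) (U : Set (B → ℝ)) (W : Set (EuclideanSpace ℝ (Fin p)))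
    (Θ : EuclideanSpace ℝ (Fin p) → OpenPartialHomeomorph (EuclideanSpace ℝ (Fin p)) (B → ℝ)) :
    Prop :=
  (0 : B → ℝ) ∈ U ∧ ∀ y ∈ W,
    (Θ y).target = U ∧ W ⊆ (Θ y).source ∧
    ContDiffOn ℝ ∞ (Θ y) (Θ y).source ∧ ContDiffOn ℝ ∞ (Θ y).symm U ∧
    ∀ u ∈ U, RegExpEq X r B u y ((Θ y).symm u)

/-- The homogeneous norm `‖u‖ = ∑_{J ∈ B} |u_J|^{1/|J|}`. -/
def homNorm {n : ℕ} {B : Finset (List (Fin (n + 1)))} (u : B → ℝ) : ℝ :=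
  ∑ J : B, |u J| ^ (1 / (weight (J : List (Fin (n + 1))) : ℝ))

/-- The quasidistance `ρ(x, y) = ‖Θ_y(x)‖`. -/
def quasiDist {n p : ℕ} {B : Finset (List (Fin (n + 1)))}
    (Θ : EuclideanSpace ℝ (Fin p) → OpenPartialHomeomorph (EuclideanSpace ℝ (Fin p)) (B → ℝ))
    (x y : EuclideanSpace ℝ (Fin p)) : ℝ :=
  homNorm (Θ y x)

end WeightedFields

end

open WeightedFields

/-! Write `S` for the Taylor fields with center `y`. Everything rests on two facts: `X_[I] - S_[I] =
O(‖z - y‖ ^ (r - |I|))` uniformly in `y`, and the coordinate of index `J` behaves at `y` like a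
function of weight `|J|` with respect to the `S_[I]`.

Upper bound for `d` (`IsCanonicalChart.controlDist_le`). The curve defining `E(u, y) = x`, reversed
in time, joins `x` to `y`. Along it `‖z - y‖ ≤ K ‖u‖`, so for small `u`, replacing `S_[I]` by
`X_[I]` in `∑ u_I S_[I]` costs an error `O(δ ^ r)` when `δ ≥ homNorm u`. Expanded in the local basis
`X_[I]`, `I ∈ B`, this error has coefficients `O(δ ^ r)`, hence `O(δ ^ |I|)`, and the curve is
admissible for a multiple of `δ`.

Lower bound for `d` (`IsCanonicalChart.homNorm_le`). Let `f_J` be the coordinate of index `J`. Along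
the curve of `∑ u_I S_[I]` it equals `s u_J`, so at `y` the operator `(∑ u_I S_[I]) ^ k` gives `u_J`
for `k = 1` and `0` for `k ≥ 2`. Freeness makes every formal commutator a combination of those of
the same weight in `B`; hence a single commutator of weight less than `|J|` kills `f_J` at `y`.
Polarization, together with reordering modulo commutators, extends this to all products of total
weight less than `|J|` (`operatorRep_canonicalCoordinate_eq_zero`). Along an admissible curve ending
at `y`, these vanishing conditions are integrated one after another, each factor of weight `w`
accounting for a factor `δ ^ w`: the result is `|u_J| ≤ A δ ^ |J|`
(`IsCanonicalChart.exists_coordDeriv_le`).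

Uniformity in `y` comes from treating the jet of `X` at `y` as a finite-dimensional parameter. The
Taylor fields are slices of fixed smooth fields on jets times space, and one chart of the
exponential map, smooth in jet and `u`, serves all `y` near the base point since the jet is
continuous in `y`. Its smoothness comes from the inverse function theorem in `C([0,1], E)`.
Uniqueness of integral curves identifies any given `Θ` with this chart near the base point. -/

section ParametricFlow

/-! ### Smooth dependence of integral curves on parameters. -/

variable {K : Type*} [TopologicalSpace K] [CompactSpace K]

/-- Pointwise application of a continuous family of continuous linear maps to a continuous map. -/
noncomputable def ContinuousMap.pointwiseApply (K : Type*) [TopologicalSpace K] [CompactSpace K]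
    (E F : Type*) [NormedAddCommGroup E] [NormedSpace ℝ E]
    [NormedAddCommGroup F] [NormedSpace ℝ F] :
    C(K, E →L[ℝ] F) →L[ℝ] C(K, E) →L[ℝ] C(K, F) :=
  LinearMap.mkContinuous₂
    (LinearMap.mk₂ ℝ (fun (a : C(K, E →L[ℝ] F)) (h : C(K, E)) =>
        (⟨fun t => a t (h t), by fun_prop⟩ : C(K, F)))
      (by intros; ext; simp) (by intros; ext; simp) (by intros; ext; simp) (by intros; ext; simp))
    1 (by
      intro a h
      rw [one_mul, ContinuousMap.norm_le _ (by positivity)]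
      intro t
      exact ((a t).le_opNorm _).trans (by gcongr <;> exact ContinuousMap.norm_coe_le_norm _ t))

@[simp] theorem ContinuousMap.pointwiseApply_apply {E F : Type*} [NormedAddCommGroup E]
    [NormedSpace ℝ E] [NormedAddCommGroup F] [NormedSpace ℝ F]
    (a : C(K, E →L[ℝ] F)) (h : C(K, E)) (t : K) :
    ContinuousMap.pointwiseApply K E F a h t = a t (h t) := rfl

/-- The range of `γ` is compact, so `f'` is uniformly continuous at its points; the mean value
inequality on balls around `γ t` then gives an error estimate uniform in `t`. -/
theorem ContinuousMap.hasFDerivAt_postcomp {E F : Type*} [NormedAddCommGroup E]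
    [NormedSpace ℝ E] [NormedAddCommGroup F] [NormedSpace ℝ F] (f : C(E, F))
    (f' : C(E, E →L[ℝ] F)) (hf : ∀ x, HasFDerivAt f (f' x) x) (γ : C(K, E)) :
    HasFDerivAt (fun γ : C(K, E) => f.comp γ)
      (ContinuousMap.pointwiseApply K E F (f'.comp γ)) γ := by
  rw [hasFDerivAt_iff_isLittleO_nhds_zero, Asymptotics.isLittleO_iff]
  intro ε hε
  have hc : IsCompact (range γ) := isCompact_range γ.continuous
  have hu := hc.uniformContinuousAt_of_continuousAt f' (fun a _ => f'.continuous.continuousAt)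
    (Metric.dist_mem_uniformity hε)
  obtain ⟨δ, hδ, hδ'⟩ := Metric.mem_uniformity_dist.1 hu
  filter_upwards [Metric.ball_mem_nhds (0 : C(K, E)) hδ] with h hh
  rw [ContinuousMap.norm_le _ (by positivity)]
  intro t
  have h1 : ‖h t‖ ≤ ‖h‖ := ContinuousMap.norm_coe_le_norm _ t
  have h2 : ‖h‖ < δ := by simpa using hh
  have := (convex_ball (γ t) δ).norm_image_sub_le_of_norm_hasFDerivWithin_le' (f := f)
    (f' := f') (φ := f' (γ t)) (C := ε) (x := γ t) (y := γ t + h t)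
    (fun x _ => (hf x).hasFDerivWithinAt)
    (fun x hx => by
      have h3 := @hδ' (γ t) x (by rw [dist_comm]; exact hx) (mem_range_self t)
      rw [← dist_eq_norm, dist_comm]
      exact le_of_lt h3)
    (Metric.mem_ball_self hδ) (by rw [Metric.mem_ball, dist_eq_norm]; simpa using h1.trans_lt h2)
  simp only [ContinuousMap.sub_apply, ContinuousMap.comp_apply, ContinuousMap.add_apply,
    ContinuousMap.pointwiseApply_apply]
  rw [add_sub_cancel_left] at this
  exact this.trans (by gcongr)

universe u in
-- The derivative is again a postcomposition, by `f'`, followed by a continuous linear map; this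
-- drives the induction, in which `F` is replaced by `E →L[ℝ] F`.
theorem ContinuousMap.contDiff_postcomp_nat {E : Type u} [NormedAddCommGroup E]
    [NormedSpace ℝ E] (n : ℕ) : ∀ {F : Type u} [NormedAddCommGroup F]
    [NormedSpace ℝ F] (f : C(E, F)), ContDiff ℝ n f →
    ContDiff ℝ n (fun γ : C(K, E) => f.comp γ) := by
  induction n with
  | zero =>
    intro F _ _ f _
    exact contDiff_zero.2 (ContinuousMap.continuous_postcomp f)
  | succ n ih =>
    intro F _ _ f hf
    obtain ⟨f', hf', hd⟩ := contDiff_succ_iff_hasFDerivAt.1 hf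
    let g : C(E, E →L[ℝ] F) := ⟨f', hf'.continuous⟩
    have hL : ContDiff ℝ n (ContinuousMap.pointwiseApply K E F) := ContinuousLinearMap.contDiff _
    exact contDiff_succ_iff_hasFDerivAt.2
      ⟨fun γ => ContinuousMap.pointwiseApply K E F (g.comp γ),
        hL.comp (ih g hf'),
        fun γ => ContinuousMap.hasFDerivAt_postcomp f g hd γ⟩

universe u in
theorem ContinuousMap.contDiff_postcomp {E F : Type u} [NormedAddCommGroup E]
    [NormedSpace ℝ E] [NormedAddCommGroup F] [NormedSpace ℝ F] (f : C(E, F))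
    (hf : ContDiff ℝ ∞ f) : ContDiff ℝ ∞ (fun γ : C(K, E) => f.comp γ) :=
  contDiff_infty.2 fun n =>
    ContinuousMap.contDiff_postcomp_nat n f (contDiff_infty.1 hf n)

/-- The primitive on `[0, 1]` that vanishes at `0`, as an operator on continuous functions. -/
noncomputable def ContinuousMap.primitive (E : Type*) [NormedAddCommGroup E] [NormedSpace ℝ E] :
    C(Icc (0 : ℝ) 1, E) →L[ℝ] C(Icc (0 : ℝ) 1, E) :=
  LinearMap.mkContinuous
    { toFun := fun η =>
        ⟨fun t => ∫ s in (0 : ℝ)..t, η (projIcc 0 1 zero_le_one s), by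
          have h : Continuous fun s : ℝ => η (projIcc 0 1 zero_le_one s) := by fun_prop
          exact (intervalIntegral.continuous_primitive (μ := volume)
            (fun a b => h.intervalIntegrable a b) 0).comp continuous_subtype_val⟩
      map_add' := fun η ζ => by
        ext t
        have h : ∀ η : C(Icc (0 : ℝ) 1, E), Continuous fun s : ℝ =>
          η (projIcc 0 1 zero_le_one s) := fun η => by fun_prop
        simp only [ContinuousMap.coe_mk, ContinuousMap.add_apply]
        exact intervalIntegral.integral_add ((h η).intervalIntegrable _ _)
          ((h ζ).intervalIntegrable _ _)
      map_smul' := fun c η => by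
        ext t
        simp [intervalIntegral.integral_smul] }
    1 (by
      intro η
      rw [one_mul, ContinuousMap.norm_le _ (by positivity)]
      intro t
      have := intervalIntegral.norm_integral_le_of_norm_le_const (a := 0) (b := (t : ℝ))
        (f := fun s => η (projIcc 0 1 zero_le_one s)) (C := ‖η‖)
        (fun s _ => ContinuousMap.norm_coe_le_norm _ _)
      refine this.trans ?_
      have h1 : |(t : ℝ) - 0| ≤ 1 := by
        rw [sub_zero, abs_of_nonneg t.2.1]; exact t.2.2
      exact mul_le_of_le_one_right (norm_nonneg _) h1)

theorem ContinuousMap.primitive_apply {E : Type*} [NormedAddCommGroup E] [NormedSpace ℝ E]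
    (η : C(Icc (0 : ℝ) 1, E)) (t : Icc (0 : ℝ) 1) :
    ContinuousMap.primitive E η t = ∫ s in (0 : ℝ)..t, η (projIcc 0 1 zero_le_one s) := rfl

theorem ContinuousMap.hasDerivWithinAt_primitive {E : Type*} [NormedAddCommGroup E]
    [NormedSpace ℝ E] [CompleteSpace E] (η : C(Icc (0 : ℝ) 1, E)) (t : ℝ)
    (ht : t ∈ Icc (0 : ℝ) 1) :
    HasDerivWithinAt (fun s => ContinuousMap.primitive E η (projIcc 0 1 zero_le_one s))
      (η ⟨t, ht⟩) (Icc 0 1) t := by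
  have h : Continuous fun s : ℝ => η (projIcc 0 1 zero_le_one s) := by fun_prop
  have := (intervalIntegral.integral_hasDerivAt_right (h.intervalIntegrable 0 t)
    (h.stronglyMeasurableAtFilter _ _) h.continuousAt).hasDerivWithinAt (s := Icc (0 : ℝ) 1)
  rw [projIcc_of_mem _ ht] at this
  refine this.congr (fun s hs => ?_) ?_
  · rw [ContinuousMap.primitive_apply, projIcc_of_mem _ hs]
  · rw [ContinuousMap.primitive_apply, projIcc_of_mem _ ht]

/-- The inverse function theorem for a smooth map on an open set: a local inverse which is smooth
on its whole domain. -/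
theorem exists_openPartialHomeomorph_of_contDiffOn {E F : Type*} [NormedAddCommGroup E]
    [NormedSpace ℝ E] [CompleteSpace E] [NormedAddCommGroup F] [NormedSpace ℝ F]
    {f : E → F} {O : Set E} (hO : IsOpen O) (hf : ContDiffOn ℝ ∞ f O) {a : E} (ha : a ∈ O)
    {f' : E ≃L[ℝ] F} (hf' : HasFDerivAt f (f' : E →L[ℝ] F) a) :
    ∃ e : OpenPartialHomeomorph E F, a ∈ e.source ∧ e.source ⊆ O ∧ (∀ x, e x = f x) ∧
      ContDiffOn ℝ ∞ e.symm e.target := by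
  have hfa : ∀ x ∈ O, ContDiffAt ℝ ∞ f x := fun x hx => hf.contDiffAt (hO.mem_nhds hx)
  have hfc : ContinuousOn (fderiv ℝ f) O :=
    hf.continuousOn_fderiv_of_isOpen hO (by simp)
  let e₀ := (hfa a ha).toOpenPartialHomeomorph f hf' (by simp)
  -- Restricting to the points where the derivative is invertible makes the inverse smooth on the
  -- whole target, and not only at the image of `a`.
  let V : Set E := O ∩ fderiv ℝ f ⁻¹' (range ((↑) : (E ≃L[ℝ] F) → E →L[ℝ] F))
  have hV : IsOpen V := hfc.isOpen_inter_preimage hO ContinuousLinearEquiv.isOpen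
  have haV : a ∈ V := ⟨ha, f', hf'.fderiv.symm⟩
  refine ⟨e₀.restrOpen V hV, ⟨(hfa a ha).mem_toOpenPartialHomeomorph_source hf' (by simp), haV⟩,
    fun x hx => hx.2.1, fun x => rfl, ?_⟩
  intro y hy
  set e := e₀.restrOpen V hV
  have hx : e.symm y ∈ e.source := e.map_target hy
  obtain ⟨hxO, φ, hφ⟩ := hx.2
  refine (e.contDiffAt_symm (f₀' := φ) hy ?_ (hfa _ hxO)).contDiffWithinAt
  rw [hφ]
  exact ((hfa _ hxO).differentiableAt (by simp)).hasFDerivAt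

universe u in
/-- Smooth dependence on parameters for the integral curves on `[0, 1]` of a family of vector
fields that vanishes for one value of the parameter. -/
theorem exists_contDiffOn_endpoint {Λ E : Type u} [NormedAddCommGroup Λ] [NormedSpace ℝ Λ]
    [CompleteSpace Λ] [NormedAddCommGroup E] [NormedSpace ℝ E] [CompleteSpace E]
    {f : Λ × E → E} (hf : ContDiff ℝ ∞ f) {l₀ : Λ} (hf₀ : ∀ w, f (l₀, w) = 0) :
    ∃ (N : Set Λ) (g : Λ → E), IsOpen N ∧ l₀ ∈ N ∧ ContDiffOn ℝ ∞ g N ∧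
      ∀ l ∈ N, ∃ γ : ℝ → E, γ 0 = 0 ∧ γ 1 = g l ∧
        IsIntegralCurveOn γ (fun _ w => f (l, w)) (Icc 0 1) := by
  let I := Icc (0 : ℝ) 1
  let fc : C(Λ × E, E) := ⟨f, hf.continuous⟩
  let fc' : C(Λ × E, (Λ × E) →L[ℝ] E) := ⟨fderiv ℝ f, hf.continuous_fderiv (by simp)⟩
  have hfd : ∀ x, HasFDerivAt fc (fc' x) x := fun x =>
    (hf.differentiable (by simp) x).hasFDerivAt
  let A : (Λ × C(I, E)) →L[ℝ] C(I, Λ × E) :=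
    ((ContinuousLinearMap.inl ℝ Λ E).compLeftContinuous ℝ I ∘L ContinuousLinearMap.const ℝ I) ∘L
        ContinuousLinearMap.fst ℝ Λ C(I, E) +
      (ContinuousLinearMap.inr ℝ Λ E).compLeftContinuous ℝ I ∘L ContinuousLinearMap.snd ℝ Λ C(I, E)
  have hA : ∀ q t, A q t = (q.1, q.2 t) := by
    intro q t
    simp [A]
  -- The integral equation: `Φ (l, η) = (l, 0)` says that `η` is the integral curve from `0` of the
  -- field with parameter `l`.
  let Φ : Λ × C(I, E) → Λ × C(I, E) :=
    fun q => (q.1, q.2 - ContinuousMap.primitive E (fc.comp (A q)))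
  have hΦ : ContDiff ℝ ∞ Φ := by
    refine contDiff_fst.prodMk (contDiff_snd.sub ?_)
    exact (ContinuousLinearMap.contDiff (ContinuousMap.primitive E)).comp
      ((ContinuousMap.contDiff_postcomp fc hf).comp (ContinuousLinearMap.contDiff A))
  let q₀ : Λ × C(I, E) := (l₀, 0)
  let M : (Λ × C(I, E)) →L[ℝ] C(I, E) := ContinuousMap.primitive E ∘L
    (ContinuousMap.pointwiseApply I (Λ × E) E (fc'.comp (A q₀))) ∘L A
  -- Since `f (l₀, ·)` vanishes identically, so does its derivative in `w`. Hence `M` depends on `l`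
  -- only, and changing the sign of `M` inverts the derivative of `Φ`.
  have hM : ∀ l η, M (l, η) = M (l, 0) := by
    intro l η
    have hz : M (0, η) = 0 := by
      have : ContinuousMap.pointwiseApply I (Λ × E) E (fc'.comp (A q₀)) (A (0, η)) = 0 := by
        ext t
        rw [ContinuousMap.pointwiseApply_apply, hA, ContinuousMap.comp_apply, hA]
        have h1 : HasFDerivAt (fun w : E => f (l₀, w))
            ((fderiv ℝ f (l₀, 0)) ∘L ContinuousLinearMap.inr ℝ Λ E) 0 :=
          (hfd (l₀, 0)).comp (0 : E) (hasFDerivAt_prodMk_right l₀ 0)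
        have h2 : HasFDerivAt (fun w : E => f (l₀, w)) (0 : E →L[ℝ] E) 0 := by
          simp_rw [hf₀]; exact hasFDerivAt_const _ _
        have h3 := DFunLike.congr_fun (h1.unique h2) (η t)
        simpa [q₀, fc'] using h3
      simp only [M, ContinuousLinearMap.comp_apply, this, map_zero]
    have : ((l, η) : Λ × C(I, E)) = (l, 0) + (0, η) := by simp
    rw [this, map_add, hz, add_zero]
  let D : (Λ × C(I, E)) ≃L[ℝ] (Λ × C(I, E)) := ContinuousLinearEquiv.equivOfInverse
    ((ContinuousLinearMap.fst ℝ Λ C(I, E)).prod (ContinuousLinearMap.snd ℝ Λ C(I, E) - M))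
    ((ContinuousLinearMap.fst ℝ Λ C(I, E)).prod (ContinuousLinearMap.snd ℝ Λ C(I, E) + M))
    (by
      rintro ⟨l, η⟩
      have h1 : M (l, η - M (l, η)) = M (l, η) := by rw [hM, hM l η]
      simp [h1])
    (by
      rintro ⟨l, η⟩
      have h1 : M (l, η + M (l, η)) = M (l, η) := by rw [hM, hM l η]
      simp [h1])
  have hD : HasFDerivAt Φ (D : (Λ × C(I, E)) →L[ℝ] (Λ × C(I, E))) q₀ := by
    have h1 : HasFDerivAt (fun q => ContinuousMap.primitive E (fc.comp (A q))) M q₀ := by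
      have h2 := (ContinuousMap.hasFDerivAt_postcomp fc fc' hfd (A q₀)).comp q₀ A.hasFDerivAt
      exact (ContinuousMap.primitive E).hasFDerivAt.comp q₀ h2
    exact hasFDerivAt_fst.prodMk (hasFDerivAt_snd.sub h1)
  obtain ⟨e, he₀, -, heΦ, hes⟩ := exists_openPartialHomeomorph_of_contDiffOn isOpen_univ
    hΦ.contDiffOn (mem_univ q₀) hD
  have hΦ₀ : Φ q₀ = q₀ := by
    have : fc.comp (A q₀) = 0 := by
      ext t
      rw [ContinuousMap.comp_apply, hA]
      exact hf₀ _
    simp [Φ, this, q₀]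
  have hpair : ContDiff ℝ ∞ (fun l : Λ => ((l, 0) : Λ × C(I, E))) := contDiff_prodMk_left 0
  refine ⟨{l | ((l, 0) : Λ × C(I, E)) ∈ e.target},
    fun l => (e.symm (l, 0)).2 ⟨1, right_mem_Icc.2 zero_le_one⟩,
    e.open_target.preimage hpair.continuous, ?_, ?_, ?_⟩
  · have := e.map_source he₀
    rwa [heΦ, hΦ₀] at this
  · have h1 : ContDiffOn ℝ ∞ (fun l : Λ => e.symm (l, 0)) {l | ((l, 0) : Λ × C(I, E)) ∈ e.target} :=
      hes.comp hpair.contDiffOn (fun l hl => hl)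
    exact ((ContinuousMap.evalCLM ℝ (⟨1, right_mem_Icc.2 zero_le_one⟩ : I)).contDiff).comp_contDiffOn
      (contDiff_snd.comp_contDiffOn h1)
  · intro l hl
    set q := e.symm (l, 0) with hq
    have h1 : Φ q = (l, 0) := by rw [← heΦ]; exact e.right_inv hl
    have hq1 : q.1 = l := congrArg Prod.fst h1
    have hq2 : q.2 = ContinuousMap.primitive E (fc.comp (A q)) :=
      sub_eq_zero.1 (congrArg Prod.snd h1)
    refine ⟨fun s => q.2 (projIcc 0 1 zero_le_one s), ?_, ?_, ?_⟩
    · rw [hq2]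
      beta_reduce
      rw [ContinuousMap.primitive_apply, projIcc_left]
      simp
    · beta_reduce
      rw [projIcc_right]
    · intro t ht
      have h2 := ContinuousMap.hasDerivWithinAt_primitive (fc.comp (A q)) t ht
      rw [← hq2] at h2
      convert h2 using 1
      beta_reduce
      rw [ContinuousMap.comp_apply, hA, hq1, projIcc_of_mem _ ht]
      rfl

/-- Integral curves of a `C¹` vector field on `[0, 1]` are determined by their initial value. -/
theorem IsIntegralCurveOn.eqOn_of_contDiff {E : Type*} [NormedAddCommGroup E] [NormedSpace ℝ E]
    [FiniteDimensional ℝ E] {V : E → E} (hV : ContDiff ℝ 1 V) {γ γ' : ℝ → E} {b : ℝ}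
    (h : IsIntegralCurveOn γ (fun _ => V) (Icc 0 b))
    (h' : IsIntegralCurveOn γ' (fun _ => V) (Icc 0 b)) (h₀ : γ 0 = γ' 0) :
    EqOn γ γ' (Icc 0 b) := by
  have hc : IsCompact (γ '' Icc 0 b ∪ γ' '' Icc 0 b) :=
    (isCompact_Icc.image_of_continuousOn h.continuousOn).union
      (isCompact_Icc.image_of_continuousOn h'.continuousOn)
  obtain ⟨R, hR⟩ := hc.isBounded.subset_closedBall (0 : E)
  have := FiniteDimensional.proper ℝ E
  obtain ⟨L, hL⟩ := hV.contDiffOn.exists_lipschitzOnWith (s := Metric.closedBall (0 : E) R)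
    (by simp) (convex_closedBall _ _) (isCompact_closedBall _ _)
  have key : ∀ {γ : ℝ → E}, IsIntegralCurveOn γ (fun _ => V) (Icc 0 b) → ∀ t ∈ Ico 0 b,
      HasDerivWithinAt γ (V (γ t)) (Ici t) t := by
    intro γ h t ht
    exact (h t (Ico_subset_Icc_self ht)).mono_of_mem_nhdsWithin
      (mem_of_superset (Icc_mem_nhdsGE ht.2) (Icc_subset_Icc_left ht.1))
  exact ODE_solution_unique_of_mem_Icc_right (v := fun _ => V)
    (s := fun _ => Metric.closedBall 0 R) (fun t _ => hL) h.continuousOn (key h)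
    (fun t ht => hR (Or.inl ⟨t, Ico_subset_Icc_self ht, rfl⟩)) h'.continuousOn (key h')
    (fun t ht => hR (Or.inr ⟨t, Ico_subset_Icc_self ht, rfl⟩)) h₀

end ParametricFlow

/-! ### Symmetry of iterated derivatives, Taylor polynomials, and orders of vanishing uniform in the
center. -/

section TaylorPolynomials

universe u

variable {E : Type u} [NormedAddCommGroup E] [NormedSpace ℝ E]

/-- Adjacent transpositions generate the permutations. The last one is the symmetry of the second
derivative, differentiated further; the others act on the iterated derivative of `fderiv ℝ f` and
are covered by induction. -/
theorem ContDiffAt.iteratedFDeriv_perm (n : ℕ) : ∀ {F : Type u} [NormedAddCommGroup F]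
    [NormedSpace ℝ F] {f : E → F} {x : E}, ContDiffAt ℝ n f x → ∀ (σ : Equiv.Perm (Fin n))
    (v : Fin n → E), iteratedFDeriv ℝ n f x (v ∘ σ) = iteratedFDeriv ℝ n f x v := by
  induction n with
  | zero =>
    intro F _ _ f x _ σ v
    congr 1
    exact Subsingleton.elim _ _
  | succ n ih =>
    intro F _ _ f x hf σ
    have hσ : σ ∈ Submonoid.closure
        (range fun i : Fin n ↦ Equiv.swap i.castSucc i.succ) := by
      rw [Equiv.Perm.mclosure_swap_castSucc_succ]; trivial
    induction hσ using Submonoid.closure_induction with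
    | one => intro v; rfl
    | mul σ τ _ _ hσ hτ => intro v; exact (hτ (v ∘ σ)).trans (hσ v)
    | mem σ hσ =>
      obtain ⟨i, rfl⟩ := hσ
      intro v
      cases n with
      | zero => exact i.elim0
      | succ n =>
        have hf' : ContDiffAt ℝ (n + 1 : ℕ) (fderiv ℝ f) x :=
          hf.fderiv_right (by norm_cast)
        refine Fin.lastCases ?_ (fun i => ?_) i
        · have hf'' : ContDiffAt ℝ n (fderiv ℝ (fderiv ℝ f)) x :=
            hf'.fderiv_right (by norm_cast)
          have key : ∀ v : Fin (n + 2) → E, iteratedFDeriv ℝ (n + 2) f x v =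
              iteratedFDeriv ℝ n (fderiv ℝ (fderiv ℝ f)) x (Fin.init (Fin.init v))
                (v (Fin.last n).castSucc) (v (Fin.last (n + 1))) := by
            intro v
            rw [iteratedFDeriv_succ_apply_right, iteratedFDeriv_succ_apply_right]
            rfl
          let L : (E →L[ℝ] E →L[ℝ] F) →L[ℝ] (E →L[ℝ] E →L[ℝ] F) :=
            (ContinuousLinearMap.flipₗᵢ ℝ E E F).toContinuousLinearEquiv
          -- The symmetry is stated on a neighbourhood of `x`, as an identity of functions, so that
          -- it can be differentiated `n` more times.
          have hsym : L ∘
              (fderiv ℝ (fderiv ℝ f)) =ᶠ[𝓝 x] fderiv ℝ (fderiv ℝ f) := by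
            filter_upwards [hf.eventually (by simp)] with z hz
            ext a b
            have h2 : (2 : ℕ∞ω) ≤ ((n + 1 + 1 : ℕ) : ℕ∞ω) := by
              exact_mod_cast (by omega : 2 ≤ n + 1 + 1)
            exact (hz.isSymmSndFDerivAt (by simpa using h2)).eq b a
          have hfl : ∀ (w : Fin n → E) (a b : E),
              iteratedFDeriv ℝ n (fderiv ℝ (fderiv ℝ f)) x w a b =
              iteratedFDeriv ℝ n (fderiv ℝ (fderiv ℝ f)) x w b a := by
            intro w a b
            conv_lhs => rw [← (hsym.iteratedFDeriv ℝ n).eq_of_nhds]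
            have hL := ContinuousLinearMap.iteratedFDeriv_comp_left (F := E →L[ℝ] E →L[ℝ] F)
              (G := E →L[ℝ] E →L[ℝ] F) L hf'' le_rfl
            exact congrArg (fun M => M w a b) hL
          rw [key, key, hfl]
          have h1 : (v ∘ Equiv.swap (Fin.last n).castSucc (Fin.last n).succ) (Fin.last n).castSucc
              = v (Fin.last (n + 1)) := by simp
          have h2 : (v ∘ Equiv.swap (Fin.last n).castSucc (Fin.last n).succ) (Fin.last (n + 1))
              = v (Fin.last n).castSucc := by
            rw [← Fin.succ_last]; simp
          rw [h1, h2]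
          congr 3
          ext k
          simp only [Fin.init, Function.comp_apply]
          rw [Equiv.swap_apply_of_ne_of_ne]
          · intro h
            have := congrArg Fin.val h
            simp at this
            omega
          · intro h
            have := congrArg Fin.val h
            simp at this
            omega
        · have key : ∀ v : Fin (n + 1 + 1) → E, iteratedFDeriv ℝ (n + 1 + 1) f x v =
              iteratedFDeriv ℝ (n + 1) (fderiv ℝ f) x (Fin.init v) (v (Fin.last (n + 1))) :=
            fun v => iteratedFDeriv_succ_apply_right v
          have h1 : Fin.init (v ∘ Equiv.swap i.castSucc.castSucc i.castSucc.succ) =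
              Fin.init v ∘ Equiv.swap i.castSucc i.succ := by
            ext k
            simp only [Fin.init, Function.comp_apply]
            congr 1
            rw [← Fin.castSucc_succ]
            simp only [Equiv.swap_apply_def, Fin.castSucc_inj]
            split_ifs <;> rfl
          have h2 : (v ∘ Equiv.swap i.castSucc.castSucc i.castSucc.succ) (Fin.last (n + 1)) =
              v (Fin.last (n + 1)) := by
            simp only [Function.comp_apply]
            rw [Equiv.swap_apply_of_ne_of_ne]
            · intro h
              have := congrArg Fin.val h
              simp at this
              omega
            · intro h
              have := congrArg Fin.val h
              simp at this
              omega
          rw [key, key, h1, h2, ih hf']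

/-- A function and its Taylor polynomial of order `m` have the same derivatives of order at most
`m` at the center. -/
theorem iteratedFDeriv_taylorPolynomial [CompleteSpace E] {F : Type u} [NormedAddCommGroup F]
    [NormedSpace ℝ F] [CompleteSpace F] {f : E → F} {y : E} {m : ℕ} (hf : ContDiffAt ℝ m f y)
    {k : ℕ} (hk : k ≤ m) :
    iteratedFDeriv ℝ k (fun z => ∑ l ∈ Finset.range (m + 1),
      ((l.factorial : ℝ)⁻¹) • iteratedFDeriv ℝ l f y (fun _ => z - y)) y =
      iteratedFDeriv ℝ k f y := by
  let q : FormalMultilinearSeries ℝ E F := fun l =>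
    if l < m + 1 then ((l.factorial : ℝ)⁻¹) • iteratedFDeriv ℝ l f y else 0
  have hq : HasFiniteFPowerSeriesOnBall (fun z => ∑ l ∈ Finset.range (m + 1),
      ((l.factorial : ℝ)⁻¹) • iteratedFDeriv ℝ l f y (fun _ => z - y)) q y (m + 1) ⊤ := by
    refine HasFiniteFPowerSeriesOnBall.mk' (fun l hl => ?_) ENNReal.zero_lt_top (fun z _ => ?_)
    · simp only [q]
      rw [if_neg (by omega)]
    · refine Finset.sum_congr rfl fun l hl => ?_
      simp only [q]
      rw [if_pos (Finset.mem_range.1 hl)]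
      simp
  ext v
  -- The derivative of a power series is a sum over permutations; by symmetry its `k!` terms
  -- coincide and cancel the factorial.
  rw [hq.toHasFPowerSeriesOnBall.iteratedFDeriv_eq_sum_of_completeSpace]
  have : ∀ σ : Equiv.Perm (Fin k), q k (fun i => v (σ i)) =
      ((k.factorial : ℝ)⁻¹) • iteratedFDeriv ℝ k f y v := by
    intro σ
    simp only [q]
    rw [if_pos (by omega), smul_apply]
    congr 1
    exact ContDiffAt.iteratedFDeriv_perm k (hf.of_le (by exact_mod_cast hk)) σ v
  simp only [this, Finset.sum_const, Finset.card_univ, Fintype.card_perm, Fintype.card_fin]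
  rw [← Nat.cast_smul_eq_nsmul ℝ, smul_smul, mul_inv_cancel₀ (by positivity), one_smul]

/-- `f y z` is `m` times differentiable in `z`, its derivative of order `k ≤ m` being bounded by a
multiple of `‖z - y‖ ^ (s - k)`, for `y` and `z` in `D`. -/
def DerivBd (D : Set E) : ℕ → ℕ → ∀ {G : Type u} [NormedAddCommGroup G] [NormedSpace ℝ G],
    (E → E → G) → Prop
  | 0, s, _, _, _, f => ∃ C : ℝ, ∀ y ∈ D, ∀ z ∈ D, ‖f y z‖ ≤ C * ‖z - y‖ ^ s
  | m + 1, s, _, _, _, f => (∃ C : ℝ, ∀ y ∈ D, ∀ z ∈ D, ‖f y z‖ ≤ C * ‖z - y‖ ^ s) ∧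
      (∀ y ∈ D, ∀ z ∈ D, DifferentiableAt ℝ (f y) z) ∧
      DerivBd D m (s - 1) (fun y z => fderiv ℝ (f y) z)

variable {D : Set E} {F G H : Type u} [NormedAddCommGroup F] [NormedSpace ℝ F]
  [NormedAddCommGroup G] [NormedSpace ℝ G] [NormedAddCommGroup H] [NormedSpace ℝ H]

theorem DerivBd.bound {m s : ℕ} {f : E → E → G} (h : DerivBd D m s f) :
    ∃ C : ℝ, 0 ≤ C ∧ ∀ y ∈ D, ∀ z ∈ D, ‖f y z‖ ≤ C * ‖z - y‖ ^ s := by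
  have : ∃ C : ℝ, ∀ y ∈ D, ∀ z ∈ D, ‖f y z‖ ≤ C * ‖z - y‖ ^ s := by
    cases m with
    | zero => exact h
    | succ m => exact h.1
  obtain ⟨C, hC⟩ := this
  exact ⟨max C 0, le_max_right _ _, fun y hy z hz => (hC y hy z hz).trans
    (by gcongr; exact le_max_left _ _)⟩

theorem DerivBd.of_succ {m : ℕ} : ∀ {G : Type u} [NormedAddCommGroup G] [NormedSpace ℝ G] {s : ℕ}
    {f : E → E → G}, DerivBd D (m + 1) s f → DerivBd D m s f := by
  induction m with
  | zero => intro G _ _ s f h; exact h.1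
  | succ m ih => intro G _ _ s f h; exact ⟨h.1, h.2.1, ih h.2.2⟩

theorem DerivBd.mono_left {m m' s : ℕ} {f : E → E → G} (h : DerivBd D m s f) (hm : m' ≤ m) :
    DerivBd D m' s f := by
  induction hm with
  | refl => exact h
  | step _ ih => exact ih h.of_succ

theorem DerivBd.mono_right (hD : Bornology.IsBounded D) {m : ℕ} : ∀ {G : Type u}
    [NormedAddCommGroup G] [NormedSpace ℝ G] {s s' : ℕ} {f : E → E → G},
    DerivBd D m s f → s' ≤ s → DerivBd D m s' f := by
  have hb : ∀ {G : Type u} [NormedAddCommGroup G] [NormedSpace ℝ G] {m s s' : ℕ} {f : E → E → G},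
      DerivBd D m s f → s' ≤ s → ∃ C : ℝ, ∀ y ∈ D, ∀ z ∈ D, ‖f y z‖ ≤ C * ‖z - y‖ ^ s' := by
    intro G _ _ m s s' f h hs
    obtain ⟨C, hC0, hC⟩ := h.bound
    obtain ⟨R, hR⟩ := Metric.isBounded_iff.1 hD
    refine ⟨C * R ^ (s - s'), fun y hy z hz => (hC y hy z hz).trans ?_⟩
    have h1 : ‖z - y‖ ≤ R := by rw [← dist_eq_norm]; exact hR hz hy
    calc C * ‖z - y‖ ^ s = C * (‖z - y‖ ^ (s - s') * ‖z - y‖ ^ s') := by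
          rw [← pow_add, Nat.sub_add_cancel hs]
      _ ≤ C * (R ^ (s - s') * ‖z - y‖ ^ s') := by gcongr
      _ = _ := by ring
  induction m with
  | zero => intro G _ _ s s' f h hs; exact hb h hs
  | succ m ih =>
    intro G _ _ s s' f h hs
    exact ⟨hb h hs, h.2.1, ih h.2.2 (by omega)⟩

theorem DerivBd.congr (hD : IsOpen D) {m : ℕ} : ∀ {G : Type u}
    [NormedAddCommGroup G] [NormedSpace ℝ G] {s : ℕ} {f g : E → E → G},
    DerivBd D m s f → (∀ y ∈ D, ∀ z ∈ D, g y z = f y z) → DerivBd D m s g := by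
  induction m with
  | zero =>
    rintro G _ _ s f g ⟨C, hC⟩ h
    exact ⟨C, fun y hy z hz => by rw [h y hy z hz]; exact hC y hy z hz⟩
  | succ m ih =>
    rintro G _ _ s f g ⟨⟨C, hC⟩, hd, hf⟩ h
    have he : ∀ y ∈ D, ∀ z ∈ D, g y =ᶠ[𝓝 z] f y := fun y hy z hz => by
      filter_upwards [hD.mem_nhds hz] with w hw using h y hy w hw
    refine ⟨⟨C, fun y hy z hz => by rw [h y hy z hz]; exact hC y hy z hz⟩,
      fun y hy z hz => (hd y hy z hz).congr_of_eventuallyEq (he y hy z hz),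
      ih hf fun y hy z hz => (he y hy z hz).fderiv_eq⟩

theorem DerivBd.add (hD : IsOpen D) {m : ℕ} : ∀ {G : Type u}
    [NormedAddCommGroup G] [NormedSpace ℝ G] {s : ℕ} {f g : E → E → G},
    DerivBd D m s f → DerivBd D m s g → DerivBd D m s (fun y z => f y z + g y z) := by
  have hb : ∀ {G : Type u} [NormedAddCommGroup G] [NormedSpace ℝ G] {m s : ℕ} {f g : E → E → G},
      DerivBd D m s f → DerivBd D m s g →
      ∃ C : ℝ, ∀ y ∈ D, ∀ z ∈ D, ‖f y z + g y z‖ ≤ C * ‖z - y‖ ^ s := by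
    intro G _ _ m s f g hf hg
    obtain ⟨C, -, hC⟩ := hf.bound
    obtain ⟨C', -, hC'⟩ := hg.bound
    refine ⟨C + C', fun y hy z hz => (norm_add_le _ _).trans ?_⟩
    rw [add_mul]
    exact add_le_add (hC y hy z hz) (hC' y hy z hz)
  induction m with
  | zero => intro G _ _ s f g hf hg; exact hb hf hg
  | succ m ih =>
    intro G _ _ s f g hf hg
    exact ⟨hb hf hg, fun y hy z hz => (hf.2.1 y hy z hz).add (hg.2.1 y hy z hz),
      (ih hf.2.2 hg.2.2).congr hD fun y hy z hz =>
        fderiv_fun_add (hf.2.1 y hy z hz) (hg.2.1 y hy z hz)⟩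

/-- Leibniz rule: only `f` needs to vanish. In the derivative, the term with `f` undifferentiated
vanishes to order `s`, better than the required `s - 1`; boundedness of `D` permits lowering the
exponent. -/
theorem DerivBd.bilin (hDo : IsOpen D) (hDb : Bornology.IsBounded D) {m : ℕ} :
    ∀ {F G H : Type u} [NormedAddCommGroup F] [NormedSpace ℝ F]
    [NormedAddCommGroup G] [NormedSpace ℝ G] [NormedAddCommGroup H] [NormedSpace ℝ H]
    (B : F →L[ℝ] G →L[ℝ] H) {s : ℕ} {f : E → E → F} {g : E → E → G},
    DerivBd D m s f → DerivBd D m 0 g → DerivBd D m s (fun y z => B (f y z) (g y z)) := by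
  have hb : ∀ {F G H : Type u} [NormedAddCommGroup F] [NormedSpace ℝ F]
      [NormedAddCommGroup G] [NormedSpace ℝ G] [NormedAddCommGroup H] [NormedSpace ℝ H]
      (B : F →L[ℝ] G →L[ℝ] H) {m s : ℕ} {f : E → E → F} {g : E → E → G},
      DerivBd D m s f → DerivBd D m 0 g →
      ∃ C : ℝ, ∀ y ∈ D, ∀ z ∈ D, ‖B (f y z) (g y z)‖ ≤ C * ‖z - y‖ ^ s := by
    intro F G H _ _ _ _ _ _ B m s f g hf hg
    obtain ⟨C, hC0, hC⟩ := hf.bound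
    obtain ⟨C', hC0', hC'⟩ := hg.bound
    refine ⟨‖B‖ * C * C', fun y hy z hz => (B.le_opNorm₂ _ _).trans ?_⟩
    have h1 := hC y hy z hz
    have h2 := hC' y hy z hz
    rw [pow_zero, mul_one] at h2
    calc ‖B‖ * ‖f y z‖ * ‖g y z‖ ≤ ‖B‖ * (C * ‖z - y‖ ^ s) * C' := by gcongr
      _ = _ := by ring
  induction m with
  | zero => intro F G H _ _ _ _ _ _ B s f g hf hg; exact hb B hf hg
  | succ m ih =>
    intro F G H _ _ _ _ _ _ B s f g hf hg
    refine ⟨hb B hf hg, fun y hy z hz => ?_, ?_⟩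
    · exact (B.hasFDerivAt_of_bilinear (hf.2.1 y hy z hz).hasFDerivAt
        (hg.2.1 y hy z hz).hasFDerivAt).differentiableAt
    · refine ((ih (B.precompR E) (hf.of_succ.mono_right hDb (Nat.sub_le s 1)) hg.2.2).add hDo
        (ih (B.precompL E) hf.2.2 hg.of_succ)).congr hDo fun y hy z hz => ?_
      exact (B.hasFDerivAt_of_bilinear (hf.2.1 y hy z hz).hasFDerivAt
        (hg.2.1 y hy z hz).hasFDerivAt).fderiv

theorem DerivBd.neg (hD : IsOpen D) {m : ℕ} : ∀ {G : Type u}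
    [NormedAddCommGroup G] [NormedSpace ℝ G] {s : ℕ} {f : E → E → G},
    DerivBd D m s f → DerivBd D m s (fun y z => -f y z) := by
  induction m with
  | zero =>
    rintro G _ _ s f ⟨C, hC⟩
    exact ⟨C, fun y hy z hz => by rw [norm_neg]; exact hC y hy z hz⟩
  | succ m ih =>
    rintro G _ _ s f ⟨⟨C, hC⟩, hd, hf⟩
    exact ⟨⟨C, fun y hy z hz => by rw [norm_neg]; exact hC y hy z hz⟩,
      fun y hy z hz => (hd y hy z hz).neg, (ih hf).congr hD fun y hy z hz => fderiv_fun_neg⟩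

theorem DerivBd.sub (hD : IsOpen D) {m s : ℕ} {f g : E → E → G}
    (hf : DerivBd D m s f) (hg : DerivBd D m s g) : DerivBd D m s (fun y z => f y z - g y z) := by
  simp_rw [sub_eq_add_neg]
  exact hf.add hD (hg.neg hD)

theorem DerivBd.of_contDiffOn (hD : IsOpen D) {m : ℕ} : ∀ {G : Type u}
    [NormedAddCommGroup G] [NormedSpace ℝ G] {f : E → G}, ContDiffOn ℝ m f D →
    (∀ k ≤ m, ∃ C : ℝ, ∀ z ∈ D, ‖iteratedFDeriv ℝ k f z‖ ≤ C) →
    DerivBd D m 0 (fun _ => f) := by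
  have hb : ∀ {G : Type u} [NormedAddCommGroup G] [NormedSpace ℝ G] {m : ℕ} {f : E → G},
      (∀ k ≤ m, ∃ C : ℝ, ∀ z ∈ D, ‖iteratedFDeriv ℝ k f z‖ ≤ C) →
      ∃ C : ℝ, ∀ y ∈ D, ∀ z ∈ D, ‖f z‖ ≤ C * ‖z - y‖ ^ 0 := by
    intro G _ _ m f hf
    obtain ⟨C, hC⟩ := hf 0 (by omega)
    exact ⟨C, fun y _ z hz => by simpa using hC z hz⟩
  induction m with
  | zero => intro G _ _ f _ h; exact hb h
  | succ m ih =>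
    intro G _ _ f hf h
    refine ⟨hb h, fun y _ z hz => ?_, ih ?_ fun k hk => ?_⟩
    · exact (hf.contDiffAt (hD.mem_nhds hz)).differentiableAt (by simp)
    · exact ((contDiffOn_succ_iff_fderiv_of_isOpen hD).1 (by exact_mod_cast hf)).2.2
    · simp_rw [norm_iteratedFDeriv_fderiv]
      exact h (k + 1) (by omega)

/-- Differentiating in `z` produces another smooth function of `(j y, z - y)`, and such functions
are bounded because the arguments stay in the compact set `Q`. It is applied with `j` the jet, to
the commutators of Taylor fields. -/
theorem DerivBd.of_comp {P : Type u} [NormedAddCommGroup P] [NormedSpace ℝ P] {j : E → P}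
    {Q : Set (P × E)} (hQ : IsCompact Q) (hj : ∀ y ∈ D, ∀ z ∈ D, (j y, z - y) ∈ Q) {m : ℕ} :
    ∀ {G : Type u} [NormedAddCommGroup G] [NormedSpace ℝ G] {g : P × E → G}, ContDiff ℝ ∞ g →
    DerivBd D m 0 (fun y z => g (j y, z - y)) := by
  have hb : ∀ {G : Type u} [NormedAddCommGroup G] [NormedSpace ℝ G] {g : P × E → G},
      ContDiff ℝ ∞ g → ∃ C : ℝ, ∀ y ∈ D, ∀ z ∈ D, ‖g (j y, z - y)‖ ≤ C * ‖z - y‖ ^ 0 := by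
    intro G _ _ g hg
    obtain ⟨C, hC⟩ := hQ.exists_bound_of_continuousOn hg.continuous.continuousOn
    exact ⟨C, fun y hy z hz => by simpa using hC _ (hj y hy z hz)⟩
  induction m with
  | zero => intro G _ _ g hg; exact hb hg
  | succ m ih =>
    intro G _ _ g hg
    have hd : ∀ y z, HasFDerivAt (fun z => g (j y, z - y))
        ((fderiv ℝ g (j y, z - y)) ∘L ContinuousLinearMap.inr ℝ P E) z := by
      intro y z
      have h1 : HasFDerivAt (fun z : E => (j y, z - y)) (ContinuousLinearMap.inr ℝ P E) z :=
        (hasFDerivAt_const (j y) z).prodMk ((hasFDerivAt_id z).sub_const y)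
      exact (hg.differentiable (by simp) _).hasFDerivAt.comp z h1
    refine ⟨hb hg, fun y _ z _ => (hd y z).differentiableAt, ?_⟩
    simp_rw [(hd _ _).fderiv]
    refine ih (g := fun q => (fderiv ℝ g q) ∘L ContinuousLinearMap.inr ℝ P E) ?_
    exact (hg.fderiv_right (by simp)).clm_comp contDiff_const

/-- Taylor's estimate, uniform in `y`: the bound for the derivative is integrated along the segment
from `y` to `z`, which gains one power of `‖z - y‖` at each stage. -/
theorem DerivBd.of_iteratedFDeriv_eq_zero (hDc : Convex ℝ D) {m : ℕ} :
    ∀ {G : Type u} [NormedAddCommGroup G] [NormedSpace ℝ G] {f : E → E → G},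
    DerivBd D m 0 f → (∀ y ∈ D, ∀ k < m, iteratedFDeriv ℝ k (f y) y = 0) →
    DerivBd D m m f := by
  induction m with
  | zero => intro G _ _ f hf _; exact hf
  | succ m ih =>
    intro G _ _ f hf h
    have h1 : DerivBd D m m (fun y z => fderiv ℝ (f y) z) := by
      refine ih hf.2.2 fun y hy k hk => ?_
      have := h y hy (k + 1) (by omega)
      rw [← norm_eq_zero] at this ⊢
      rw [← this, ← norm_iteratedFDeriv_fderiv]
    refine ⟨?_, hf.2.1, h1⟩
    obtain ⟨C, hC0, hC⟩ := h1.bound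
    refine ⟨C, fun y hy z hz => ?_⟩
    have hfy : f y y = 0 := by
      have := h y hy 0 (by omega)
      rwa [← norm_eq_zero, norm_iteratedFDeriv_zero, norm_eq_zero] at this
    have hs : segment ℝ y z ⊆ D := hDc.segment_subset hy hz
    have := (convex_segment y z).norm_image_sub_le_of_norm_fderiv_le (𝕜 := ℝ) (f := f y)
      (C := C * ‖z - y‖ ^ m) (fun w hw => hf.2.1 y hy w (hs hw)) (fun w hw => by
        refine (hC y hy w (hs hw)).trans ?_
        gcongr
        exact norm_sub_le_of_mem_segment hw)
      (left_mem_segment ℝ y z) (right_mem_segment ℝ y z)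
    rw [hfy, sub_zero] at this
    calc _ ≤ _ := this
      _ = _ := by ring

end TaylorPolynomials

/-! ### Polarization, and linear forms that vanish on powers. -/

section Polarization

/-- The polarization identity in a noncommutative algebra. -/
theorem sum_prod_ofFn_perm_eq {A : Type*} [Ring A] [Algebra ℝ A] {k : ℕ} (x : Fin k → A) :
    ∑ σ : Equiv.Perm (Fin k), (List.ofFn (x ∘ σ)).prod =
      ∑ S : Finset (Fin k), ((-1 : ℝ) ^ Sᶜ.card) • (∑ i ∈ S, x i) ^ k := by
  classical
  have h1 : ∀ S : Finset (Fin k), (∑ i ∈ S, x i) ^ k =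
      ∑ c : Fin k → Fin k, if ∀ i, c i ∈ S then (List.ofFn (x ∘ c)).prod else 0 := by
    intro S
    have h := (MultilinearMap.mkPiAlgebraFin ℝ k A).map_sum_finset (fun _ => x) (fun _ => S)
    simp only [MultilinearMap.mkPiAlgebraFin_apply, List.ofFn_const, List.prod_replicate] at h
    rw [h, ← Finset.sum_filter]
    refine Finset.sum_congr ?_ fun c _ => rfl
    ext c
    simp [Fintype.mem_piFinset]
  -- Inclusion-exclusion: the sum expands `∏ i, (1 + tᵢ)` with `tᵢ = 0` for `i` in the range of `c`
  -- and `tᵢ = -1` otherwise, so it vanishes unless `c` is onto.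
  have h2 : ∀ c : Fin k → Fin k,
      ∑ S : Finset (Fin k), (if ∀ i, c i ∈ S then (-1 : ℝ) ^ Sᶜ.card else 0) =
        if Function.Bijective c then 1 else 0 := by
    intro c
    have h := Finset.prod_add (fun _ : Fin k => (1 : ℝ))
      (fun i => if i ∈ range c then 0 else (-1 : ℝ)) Finset.univ
    have h3 : ∀ S : Finset (Fin k), (if ∀ i, c i ∈ S then (-1 : ℝ) ^ Sᶜ.card else 0) =
        (∏ i ∈ S, (1 : ℝ)) * ∏ i ∈ Finset.univ \ S, if i ∈ range c then 0 else (-1 : ℝ) := by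
      intro S
      rw [Finset.prod_const_one, one_mul, ← Finset.compl_eq_univ_sdiff]
      split_ifs with hS
      · rw [Finset.prod_congr rfl (g := fun _ => (-1 : ℝ)), Finset.prod_const]
        intro i hi
        rw [if_neg]
        rintro ⟨j, rfl⟩
        exact (Finset.mem_compl.1 hi) (hS j)
      · push Not at hS
        obtain ⟨j, hj⟩ := hS
        exact (Finset.prod_eq_zero (s := Sᶜ) (f := fun i => if i ∈ range c then 0 else (-1 : ℝ))
          (Finset.mem_compl.2 hj) (if_pos (mem_range_self j))).symm
    rw [Finset.sum_congr rfl fun S _ => h3 S, ← Finset.powerset_univ, ← h]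
    by_cases hc : Function.Bijective c
    · rw [if_pos hc]
      exact Finset.prod_eq_one fun i _ => by rw [if_pos (show i ∈ range c from hc.surjective i), add_zero]
    · rw [if_neg hc]
      rw [← Finite.surjective_iff_bijective] at hc
      have : ∃ i, i ∉ range c := by
        by_contra hcon
        push Not at hcon
        exact hc hcon
      obtain ⟨i, hi⟩ := this
      exact Finset.prod_eq_zero (Finset.mem_univ i) (by rw [if_neg hi]; norm_num)
  simp_rw [h1, Finset.smul_sum]
  rw [Finset.sum_comm]
  have h4 : ∀ c : Fin k → Fin k, ∑ S : Finset (Fin k), ((-1 : ℝ) ^ Sᶜ.card) •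
      (if ∀ i, c i ∈ S then (List.ofFn (x ∘ c)).prod else 0) =
      if Function.Bijective c then (List.ofFn (x ∘ c)).prod else 0 := by
    intro c
    have : ∀ S : Finset (Fin k), ((-1 : ℝ) ^ Sᶜ.card) •
        (if ∀ i, c i ∈ S then (List.ofFn (x ∘ c)).prod else 0) =
        (if ∀ i, c i ∈ S then (-1 : ℝ) ^ Sᶜ.card else 0) • (List.ofFn (x ∘ c)).prod := by
      intro S; split_ifs <;> simp
    simp_rw [this]
    rw [← Finset.sum_smul, h2]
    split_ifs <;> simp
  simp_rw [h4]
  rw [← Finset.sum_filter]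
  refine Finset.sum_bij (fun σ _ => (σ : Fin k → Fin k)) 
    (fun σ _ => Finset.mem_filter.2 ⟨Finset.mem_univ _, σ.bijective⟩)
    (fun σ _ τ _ h => DFunLike.coe_injective h) (fun c hc => ?_) fun σ _ => rfl
  exact ⟨Equiv.ofBijective c (Finset.mem_filter.1 hc).2, Finset.mem_univ _, rfl⟩

/-- Let `g w` be a weight filtration of subspaces of an algebra, compatible with commutators. A
linear form that vanishes on `g w` for `w < N`, and on all powers of order at least two of the
elements of a subspace containing these, vanishes on all products of total weight less than `N`. -/
theorem LinearMap.map_prod_eq_zero_of_map_pow_eq_zero {A : Type*} [Ring A] [Algebra ℝ A]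
    (g : ℕ → Submodule ℝ A)
    (hg : ∀ a b, ∀ x ∈ g a, ∀ y ∈ g b, x * y - y * x ∈ g (a + b)) (L : A →ₗ[ℝ] ℝ) (N : ℕ)
    (V : Submodule ℝ A) (hV : ∀ w < N, g w ≤ V) (h₁ : ∀ w < N, ∀ x ∈ g w, L x = 0)
    (h₂ : ∀ v ∈ V, ∀ k, 2 ≤ k → L (v ^ k) = 0) :
    ∀ l : List (ℕ × A), l ≠ [] → (∀ q ∈ l, q.2 ∈ g q.1) → (l.map Prod.fst).sum < N →
      L (l.map Prod.snd).prod = 0 := by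
  suffices H : ∀ k, ∀ l : List (ℕ × A), l.length = k + 1 → (∀ q ∈ l, q.2 ∈ g q.1) →
      (l.map Prod.fst).sum < N → L (l.map Prod.snd).prod = 0 by
    intro l hl
    exact H (l.length - 1) l (by have := List.length_pos_iff.2 hl; omega)
  intro k
  induction k with
  | zero =>
    intro l hl hm hs
    obtain ⟨q, rfl⟩ := List.length_eq_one_iff.1 hl
    simpa using h₁ q.1 (by simpa using hs) q.2 (hm q (by simp))
  | succ k ih =>
    -- Exchanging two neighbours changes the product by one with their commutator as a single
    -- factor: it is shorter, has the same total weight, and is killed by the induction hypothesis.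
    -- So `L` does not see the order of the factors.
    have hperm : ∀ l l' : List (ℕ × A), l.Perm l' → ∀ pre : List (ℕ × A),
        (pre ++ l).length = k + 2 → (∀ q ∈ pre ++ l, q.2 ∈ g q.1) →
        ((pre ++ l).map Prod.fst).sum < N →
        L ((pre ++ l).map Prod.snd).prod = L ((pre ++ l').map Prod.snd).prod := by
      intro l l' h
      induction h with
      | nil => intros; rfl
      | cons q h ih' =>
        intro pre hl hm hs
        have := ih' (pre ++ [q]) (by simpa using hl) (by simpa using hm) (by simpa using hs)
        simpa using this
      | swap q q' l =>
        intro pre hl hm hs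
        have hc := hg q'.1 q.1 q'.2 (hm q' (by simp)) q.2 (hm q (by simp))
        have := ih (pre ++ (q'.1 + q.1, q'.2 * q.2 - q.2 * q'.2) :: l)
          (by simp at hl ⊢; omega)
          (by
            intro a ha
            rcases List.mem_append.1 ha with ha | ha
            · exact hm a (by simp [ha])
            · rcases List.mem_cons.1 ha with rfl | ha
              · exact hc
              · exact hm a (by simp [ha]))
          (by simp at hs ⊢; omega)
        rw [← sub_eq_zero, ← map_sub, ← this]
        congr 1
        simp only [List.map_append, List.map_cons, List.prod_append, List.prod_cons]
        noncomm_ring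
      | trans h h' ih₁ ih₂ =>
        intro pre hl hm hs
        have hp := (List.Perm.append_left pre h)
        refine (ih₁ pre hl hm hs).trans (ih₂ pre ?_ ?_ ?_)
        · rw [← hp.length_eq]; exact hl
        · intro a ha; exact hm a (hp.mem_iff.2 ha)
        · rw [← (hp.map Prod.fst).sum_eq]; exact hs
    intro l hl hm hs
    obtain ⟨f, rfl⟩ : ∃ f : Fin (k + 2) → ℕ × A, l = List.ofFn f :=
      ⟨fun i => l.get (i.cast hl.symm), 
        List.ext_get (by rw [List.length_ofFn, hl]) fun n h1 h2 => by rw [List.get_ofFn]; rfl⟩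
    -- By the independence of the order, one side is `(k + 2)!` times the required value; the other
    -- consists of powers of elements of `V` and vanishes.
    have h3 := congrArg L (sum_prod_ofFn_perm_eq fun i => (f i).2)
    have h4 : ∀ σ : Equiv.Perm (Fin (k + 2)), L (List.ofFn ((fun i => (f i).2) ∘ σ)).prod =
        L ((List.ofFn f).map Prod.snd).prod := by
      intro σ
      have h5 := hperm (List.ofFn f) (List.ofFn (f ∘ σ)) (Equiv.Perm.ofFn_comp_perm σ f).symm []
        (by simp) (by simpa using hm) (by simpa using hs)
      rw [List.nil_append, List.nil_append] at h5
      rw [h5, List.map_ofFn]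
      rfl
    have hw : ∀ i, (f i).1 < N := fun i => by
      refine lt_of_le_of_lt (List.single_le_sum (fun _ _ => Nat.zero_le _) _ ?_) hs
      exact List.mem_map.2 ⟨f i, List.mem_ofFn.2 ⟨i, rfl⟩, rfl⟩
    have h6 : ∀ S : Finset (Fin (k + 2)),
        L (((-1 : ℝ) ^ Sᶜ.card) • (∑ i ∈ S, (f i).2) ^ (k + 2)) = 0 := by
      intro S
      rw [map_smul, h₂ _ (V.sum_mem fun i _ => hV _ (hw i) (hm (f i) (List.mem_ofFn.2 ⟨i, rfl⟩)))
        (k + 2) (by omega), smul_zero]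
    simp only [map_sum, h4, h6] at h3
    simp only [Finset.sum_const, Finset.card_univ, Fintype.card_perm, Fintype.card_fin,
      smul_zero, nsmul_eq_mul, mul_eq_zero] at h3
    exact h3.resolve_left (by exact_mod_cast Nat.factorial_ne_zero _)

end Polarization

/-! ### Formal commutators: weights, homogeneity and the meaning of freeness. -/

namespace WeightedFields

variable {n : ℕ}

theorem weight_cons (i : Fin (n + 1)) (I : List (Fin (n + 1))) :
    weight (i :: I) = fieldWeight i + weight I := by simp [weight]

theorem fieldWeight_pos (i : Fin (n + 1)) : 1 ≤ fieldWeight i := by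
  unfold fieldWeight; split_ifs <;> omega

theorem formalBracket_cons (i : Fin (n + 1)) {I : List (Fin (n + 1))} (hI : I ≠ []) :
    formalBracket (i :: I) = MonoidAlgebra.of ℝ _ (FreeMonoid.of i) * formalBracket I -
      formalBracket I * MonoidAlgebra.of ℝ _ (FreeMonoid.of i) := by
  cases I with
  | nil => exact absurd rfl hI
  | cons j I => rfl

/-- The span of the formal iterated commutators of weight `w`. -/
noncomputable def formalSpan (n w : ℕ) :
    Submodule ℝ (MonoidAlgebra ℝ (FreeMonoid (Fin (n + 1)))) :=
  Submodule.span ℝ (formalBracket '' {I | I ≠ [] ∧ weight I = w})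

theorem formalBracket_mem_formalSpan {I : List (Fin (n + 1))} (hI : I ≠ []) :
    formalBracket I ∈ formalSpan n (weight I) :=
  Submodule.subset_span ⟨I, ⟨hI, rfl⟩, rfl⟩

theorem commutator_of_mem_formalSpan (i : Fin (n + 1)) {b : ℕ}
    {y : MonoidAlgebra ℝ (FreeMonoid (Fin (n + 1)))} (hy : y ∈ formalSpan n b) :
    MonoidAlgebra.of ℝ _ (FreeMonoid.of i) * y - y * MonoidAlgebra.of ℝ _ (FreeMonoid.of i) ∈
      formalSpan n (fieldWeight i + b) := by
  induction hy using Submodule.span_induction with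
  | mem y hy =>
    obtain ⟨I, ⟨hI, rfl⟩, rfl⟩ := hy
    rw [← formalBracket_cons i hI, ← weight_cons]
    exact formalBracket_mem_formalSpan (by simp)
  | zero => simp
  | add y z _ _ hy hz =>
    rw [mul_add, add_mul, add_sub_add_comm]
    exact add_mem hy hz
  | smul c y _ hy =>
    rw [mul_smul_comm, smul_mul_assoc, ← smul_sub]
    exact Submodule.smul_mem _ _ hy

/-- The Jacobi identity `[[ξ, a], y] = [ξ, [a, y]] - [a, [ξ, y]]` moves the nesting to the right, by
induction on the left factor, so right-nested commutators suffice. -/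
theorem commutator_mem_formalSpan (a b : ℕ) (x : MonoidAlgebra ℝ (FreeMonoid (Fin (n + 1))))
    (hx : x ∈ formalSpan n a) (y : MonoidAlgebra ℝ (FreeMonoid (Fin (n + 1))))
    (hy : y ∈ formalSpan n b) : x * y - y * x ∈ formalSpan n (a + b) := by
  induction hx using Submodule.span_induction with
  | mem x hx =>
    obtain ⟨I, ⟨hI, rfl⟩, rfl⟩ := hx
    induction I generalizing b y with
    | nil => exact absurd rfl hI
    | cons i I ih =>
      by_cases h : I = []
      · subst h
        have := commutator_of_mem_formalSpan i hy
        rw [weight_cons]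
        rwa [show weight ([] : List (Fin (n + 1))) = 0 from rfl, add_zero]
      · have h1 := commutator_of_mem_formalSpan i (ih b y hy h)
        have h2 := ih _ _ (commutator_of_mem_formalSpan i hy) h
        have h3 : formalBracket (i :: I) * y - y * formalBracket (i :: I) =
            (MonoidAlgebra.of ℝ _ (FreeMonoid.of i) * (formalBracket I * y - y * formalBracket I) -
              (formalBracket I * y - y * formalBracket I) *
                MonoidAlgebra.of ℝ _ (FreeMonoid.of i)) -
            (formalBracket I * (MonoidAlgebra.of ℝ _ (FreeMonoid.of i) * y -
                y * MonoidAlgebra.of ℝ _ (FreeMonoid.of i)) -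
              (MonoidAlgebra.of ℝ _ (FreeMonoid.of i) * y -
                y * MonoidAlgebra.of ℝ _ (FreeMonoid.of i)) * formalBracket I) := by
          rw [formalBracket_cons i h]
          noncomm_ring
        rw [h3, weight_cons]
        refine sub_mem ?_ ?_
        · rwa [add_assoc]
        · rwa [add_comm (fieldWeight i), add_assoc]
  | zero => simp
  | add x z _ _ hx hz =>
    rw [mul_add, add_mul, add_sub_add_comm]
    exact add_mem hx hz
  | smul c x _ hx =>
    rw [mul_smul_comm, smul_mul_assoc, ← smul_sub]
    exact Submodule.smul_mem _ _ hx

theorem formalBracket_mem_span_of (I : List (Fin (n + 1))) :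
    formalBracket I ∈ Submodule.span ℝ ((fun J => MonoidAlgebra.of ℝ _ (FreeMonoid.ofList J)) ''
      {J : List (Fin (n + 1)) | weight J = weight I}) := by
  induction I with
  | nil => exact zero_mem _
  | cons i I ih =>
    by_cases h : I = []
    · subst h
      exact Submodule.subset_span ⟨[i], rfl, rfl⟩
    · rw [formalBracket_cons i h]
      have key : ∀ y ∈ Submodule.span ℝ ((fun J => MonoidAlgebra.of ℝ _ (FreeMonoid.ofList J)) ''
          {J : List (Fin (n + 1)) | weight J = weight I}),
          MonoidAlgebra.of ℝ _ (FreeMonoid.of i) * y -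
            y * MonoidAlgebra.of ℝ _ (FreeMonoid.of i) ∈
          Submodule.span ℝ ((fun J => MonoidAlgebra.of ℝ _ (FreeMonoid.ofList J)) ''
          {J : List (Fin (n + 1)) | weight J = weight (i :: I)}) := by
        intro y hy
        induction hy using Submodule.span_induction with
        | mem y hy =>
          obtain ⟨J, hJ, rfl⟩ := hy
          have hJ' : weight J = weight I := hJ
          beta_reduce
          rw [← map_mul, ← map_mul]
          refine sub_mem (Submodule.subset_span ⟨i :: J, ?_, rfl⟩)
            (Submodule.subset_span ⟨J ++ [i], ?_, rfl⟩)
          · simp [weight_cons, hJ']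
          · change weight (J ++ [i]) = _
            rw [weight_cons, ← hJ']
            simp [weight, add_comm]
        | zero => simp
        | add y z _ _ hy hz =>
          rw [mul_add, add_mul, add_sub_add_comm]
          exact add_mem hy hz
        | smul c y _ hy =>
          rw [mul_smul_comm, smul_mul_assoc, ← smul_sub]
          exact Submodule.smul_mem _ _ hy
      exact key _ ih

/-- The formal iterated commutators are homogeneous. -/
theorem commutatorCoeff_eq_zero {I J : List (Fin (n + 1))} (h : weight J ≠ weight I) :
    commutatorCoeff I J = 0 := by
  unfold commutatorCoeff
  have := formalBracket_mem_span_of I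
  generalize formalBracket I = x at this ⊢
  induction this using Submodule.span_induction with
  | mem y hy =>
    obtain ⟨K, hK, rfl⟩ := hy
    have hne : FreeMonoid.ofList K ≠ FreeMonoid.ofList J := fun he =>
      h (by rw [← hK, FreeMonoid.ofList.injective he])
    simp [MonoidAlgebra.of_apply, MonoidAlgebra.coeff_single, hne]
  | zero => simp
  | add y z _ _ hy hz => simp [hy, hz]
  | smul c y _ hy => simp [hy]

/-- If the fields are free at `x` and those indexed by `B` span, then every formal commutator is a
combination of those of the same weight that are indexed by `B`. -/
theorem formalBracket_mem_span_of_free {p r : ℕ}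
    {X : Fin (n + 1) → EuclideanSpace ℝ (Fin p) → EuclideanSpace ℝ (Fin p)}
    {x : EuclideanSpace ℝ (Fin p)} (hfree : FreeUpToWeightAt X r x)
    {B : Finset (List (Fin (n + 1)))} (hB : B ⊆ multiindices n r)
    (hspan : Submodule.span ℝ (range fun I : B => bracket X I x) = ⊤)
    {I : List (Fin (n + 1))} (hI : I ∈ multiindices n r) :
    formalBracket I ∈ Submodule.span ℝ
      (formalBracket '' {K : List (Fin (n + 1)) | K ∈ B ∧ weight K = weight I}) := by
  classical
  have h1 : bracket X I x ∈ Submodule.span ℝ (range fun I : B => bracket X I x) := by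
    rw [hspan]; trivial
  obtain ⟨c, hc⟩ := (Submodule.mem_span_range_iff_exists_fun ℝ).1 h1
  let c' : List (Fin (n + 1)) → ℝ := fun K => if h : K ∈ B then c ⟨K, h⟩ else 0
  have hsum : ∀ {M : Type} [AddCommGroup M] [Module ℝ M] (f : List (Fin (n + 1)) → M),
      ∑ K ∈ multiindices n r, c' K • f K = ∑ K ∈ B, c' K • f K := by
    intro M _ _ f
    refine (Finset.sum_subset hB fun K _ hK => ?_).symm
    simp [c', hK]
  have hB' : ∑ K ∈ B, c' K • bracket X K x = bracket X I x := by
    rw [← hc, ← Finset.sum_coe_sort B]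
    exact Finset.sum_congr rfl fun K _ => by simp [c']
  -- Freeness turns the expansion of the vector `bracket X I x` in the basis into an identity
  -- between the coefficients of the formal commutators.
  have h2 := hfree (fun K => (if K = I then 1 else 0) - c' K) (by
    simp only [sub_smul, Finset.sum_sub_distrib, ite_smul, one_smul, zero_smul,
      Finset.sum_ite_eq', hI, if_true]
    rw [hsum, hB', sub_self])
  have h3 : ∀ J, commutatorCoeff I J = ∑ K ∈ B, c' K * commutatorCoeff K J := by
    intro J
    have := h2 J
    simp only [sub_mul, Finset.sum_sub_distrib, ite_mul, one_mul, zero_mul,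
      Finset.sum_ite_eq', hI, if_true] at this
    rw [sub_eq_zero] at this
    rw [this]
    exact hsum (fun K => commutatorCoeff K J)
  -- Formal commutators are homogeneous, so comparing coefficients weight by weight allows the terms
  -- of other weights to be dropped.
  have h4 : formalBracket I = ∑ K ∈ B with weight K = weight I, c' K • formalBracket K := by
    refine MonoidAlgebra.ext (Finsupp.ext fun m => ?_)
    obtain ⟨J, rfl⟩ := FreeMonoid.ofList.surjective m
    rw [MonoidAlgebra.coeff_sum, Finsupp.finsetSum_apply]
    simp only [MonoidAlgebra.coeff_smul, Finsupp.smul_apply, smul_eq_mul]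
    change commutatorCoeff I J = ∑ K ∈ B with weight K = weight I, c' K * commutatorCoeff K J
    by_cases hJ : weight J = weight I
    · rw [h3 J, Finset.sum_filter]
      refine Finset.sum_congr rfl fun K _ => ?_
      split_ifs with hK
      · rfl
      · rw [commutatorCoeff_eq_zero (by rw [hJ]; exact Ne.symm hK), mul_zero]
    · rw [commutatorCoeff_eq_zero hJ]
      refine (Finset.sum_eq_zero fun K hK => ?_).symm
      rw [commutatorCoeff_eq_zero (by rw [(Finset.mem_filter.1 hK).2]; exact hJ), mul_zero]
  rw [h4]
  refine Submodule.sum_mem _ fun K hK => Submodule.smul_mem _ _ (Submodule.subset_span ⟨K, ?_, rfl⟩)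
  exact Finset.mem_filter.1 hK


/-! ### Commutators as differential operators; derivatives of canonical coordinates. -/

section SmoothFields

variable {n : ℕ} {T : Type} [NormedAddCommGroup T] [NormedSpace ℝ T]

/-- The iterated commutators of a family of vector fields on a normed space. -/
noncomputable def fieldBracket (V : Fin (n + 1) → T → T) : List (Fin (n + 1)) → T → T
  | [] => 0
  | [i] => V i
  | i :: j :: I => VectorField.lieBracket ℝ (V i) (fieldBracket V (j :: I))

theorem fieldBracket_cons (V : Fin (n + 1) → T → T) (i : Fin (n + 1)) {I : List (Fin (n + 1))}
    (hI : I ≠ []) : fieldBracket V (i :: I) = VectorField.lieBracket ℝ (V i) (fieldBracket V I) := by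
  cases I with
  | nil => exact absurd rfl hI
  | cons j I => rfl

theorem bracket_eq_fieldBracket {p : ℕ}
    (X : Fin (n + 1) → EuclideanSpace ℝ (Fin p) → EuclideanSpace ℝ (Fin p)) :
    ∀ I, bracket X I = fieldBracket X I
  | [] => rfl
  | [_] => rfl
  | i :: j :: I => by
    unfold bracket fieldBracket
    rw [bracket_eq_fieldBracket X (j :: I)]

theorem contDiff_fieldBracket {V : Fin (n + 1) → T → T} (hV : ∀ i, ContDiff ℝ ∞ (V i))
    (I : List (Fin (n + 1))) : ContDiff ℝ ∞ (fieldBracket V I) := by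
  induction I with
  | nil => exact contDiff_const
  | cons i I ih =>
    by_cases h : I = []
    · subst h; exact hV i
    · rw [fieldBracket_cons V i h]
      exact (hV i).lieBracket_vectorField ih (by simp)

variable (T) in
/-- The space of smooth real functions on `T`. -/
def smoothFunctions : Submodule ℝ (T → ℝ) where
  carrier := {f | ContDiff ℝ ∞ f}
  add_mem' {f g} hf hg := by
    have hf' : ContDiff ℝ ∞ f := hf
    have hg' : ContDiff ℝ ∞ g := hg
    exact hf'.add hg'
  zero_mem' := by
    have h : ContDiff ℝ ∞ (fun _ : T => (0 : ℝ)) := contDiff_const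
    exact h
  smul_mem' c f hf := by
    have hf' : ContDiff ℝ ∞ f := hf
    exact hf'.const_smul c

theorem contDiff_coe (f : smoothFunctions T) : ContDiff ℝ ∞ (f : T → ℝ) := f.2

theorem differentiableAt_coe (f : smoothFunctions T) (x : T) :
    DifferentiableAt ℝ (f : T → ℝ) x := (contDiff_coe f).differentiable (by simp) x

/-- The differential operator defined by a smooth vector field. -/
noncomputable def fieldDerivation (V : T → T) (hV : ContDiff ℝ ∞ V) :
    Module.End ℝ (smoothFunctions T) where
  toFun f := ⟨fun x => fderiv ℝ (f : T → ℝ) x (V x),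
    show ContDiff ℝ ∞ _ from ((contDiff_coe f).fderiv_right (by simp)).clm_apply hV⟩
  map_add' f g := by
    ext x
    change fderiv ℝ ((f : T → ℝ) + (g : T → ℝ)) x (V x) = _
    rw [fderiv_add (differentiableAt_coe f x) (differentiableAt_coe g x)]
    rfl
  map_smul' c f := by
    ext x
    change fderiv ℝ (c • (f : T → ℝ)) x (V x) = _
    rw [fderiv_const_smul (differentiableAt_coe f x)]
    rfl

/-- The representation of noncommutative polynomials by differential operators. -/
noncomputable def operatorRep (V : Fin (n + 1) → T → T) (hV : ∀ i, ContDiff ℝ ∞ (V i)) :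
    MonoidAlgebra ℝ (FreeMonoid (Fin (n + 1))) →ₐ[ℝ] Module.End ℝ (smoothFunctions T) :=
  MonoidAlgebra.lift ℝ _ _ (FreeMonoid.lift fun i => fieldDerivation (V i) (hV i))

theorem operatorRep_of (V : Fin (n + 1) → T → T) (hV : ∀ i, ContDiff ℝ ∞ (V i))
    (i : Fin (n + 1)) : operatorRep V hV (MonoidAlgebra.of ℝ _ (FreeMonoid.of i)) =
      fieldDerivation (V i) (hV i) := by
  simp [operatorRep]

/-- On smooth functions the Lie bracket acts as the commutator of the two derivations. Thus
identities between formal commutators hold for every family of smooth fields. -/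
theorem operatorRep_formalBracket {V : Fin (n + 1) → T → T} (hV : ∀ i, ContDiff ℝ ∞ (V i))
    (I : List (Fin (n + 1))) :
    operatorRep V hV (formalBracket I) =
      fieldDerivation (fieldBracket V I) (contDiff_fieldBracket hV I) := by
  induction I with
  | nil =>
    ext f x
    change (0 : ℝ) = _
    exact (map_zero (fderiv ℝ (f : T → ℝ) x)).symm
  | cons i I ih =>
    by_cases h : I = []
    · subst h; exact operatorRep_of V hV i
    · rw [formalBracket_cons i h, map_sub, map_mul, map_mul, operatorRep_of, ih]
      ext f x
      have := VectorField.fderiv_apply_lieBracket (𝕜 := ℝ) (x := x) (V := V i)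
        (W := fieldBracket V I) (n := ∞) ((contDiff_coe f).contDiffAt (x := x))
        (by rw [minSmoothness_of_isRCLikeNormedField]; exact WithTop.coe_le_coe.2 (le_top (a := (2 : ℕ∞))))
        ((contDiff_fieldBracket hV I).differentiable (by simp) x)
        ((hV i).differentiable (by simp) x)
      change _ = fderiv ℝ (f : T → ℝ) x (fieldBracket V (i :: I) x)
      rw [fieldBracket_cons V i h, this]
      rfl

theorem operatorRep_formalBracket_apply {V : Fin (n + 1) → T → T} (hV : ∀ i, ContDiff ℝ ∞ (V i))
    (I : List (Fin (n + 1))) (f : smoothFunctions T) (x : T) :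
    (operatorRep V hV (formalBracket I) f : T → ℝ) x = fderiv ℝ f x (fieldBracket V I x) := by
  rw [operatorRep_formalBracket]; rfl

/-- The iterated derivatives of canonical coordinates of the first kind: the coordinate of index
`J` is annihilated at the center by the products of commutators of total weight less than `|J|`. -/
theorem operatorRep_canonicalCoordinate_eq_zero {V : Fin (n + 1) → T → T}
    (hV : ∀ i, ContDiff ℝ ∞ (V i)) {r : ℕ} {B : Finset (List (Fin (n + 1)))}
    (hB : ∀ I ∈ multiindices n r, formalBracket I ∈ Submodule.span ℝ
      (formalBracket '' {K : List (Fin (n + 1)) | K ∈ B ∧ weight K = weight I}))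
    (J : B) (hJ : weight (J : List (Fin (n + 1))) ≤ r) (f : smoothFunctions T) (x : T) {ε : ℝ}
    (hε : 0 < ε)
    (hf : ∀ u ∈ Metric.ball (0 : B → ℝ) ε, ∃ γ : ℝ → T, γ 0 = x ∧
      IsIntegralCurveOn γ (fun _ z => ∑ I : B, u I • fieldBracket V I z) (Icc 0 1) ∧
      ∀ s ∈ Icc (0 : ℝ) 1, (f : T → ℝ) (γ s) = s * u J)
    (l : List (List (Fin (n + 1)))) (hl : ∀ I ∈ l, I ≠ [])
    (hw : (l.map weight).sum < weight (J : List (Fin (n + 1)))) :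
    (operatorRep V hV (l.map formalBracket).prod f : T → ℝ) x = 0 := by
  classical
  let A := MonoidAlgebra ℝ (FreeMonoid (Fin (n + 1)))
  let L : A →ₗ[ℝ] ℝ :=
    { toFun := fun a => (operatorRep V hV a f : T → ℝ) x
      map_add' := fun a b => by simp
      map_smul' := fun c a => by simp }
  have hL : ∀ a, L a = (operatorRep V hV a f : T → ℝ) x := fun _ => rfl
  let v : (B → ℝ) → A := fun u => ∑ I : B, u I • formalBracket (I : List (Fin (n + 1)))
  have hv : ∀ u (g : smoothFunctions T) (z : T), (operatorRep V hV (v u) g : T → ℝ) z =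
      fderiv ℝ g z (∑ I : B, u I • fieldBracket V I z) := by
    intro u g z
    simp only [v, map_sum, map_smul, LinearMap.sum_apply, LinearMap.smul_apply]
    rw [Submodule.coe_sum, Finset.sum_apply]
    refine Finset.sum_congr rfl fun I _ => ?_
    rw [Submodule.coe_smul, Pi.smul_apply, operatorRep_formalBracket_apply]
  -- Applying `v u` means differentiating in time along `γ`, where `f` is the linear function `s * u
  -- J`: one derivative gives the constant `u J`, any further one gives zero.
  have hder : ∀ u ∈ Metric.ball (0 : B → ℝ) ε, L (v u) = u J ∧ ∀ k, 2 ≤ k → L (v u ^ k) = 0 := by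
    intro u hu
    obtain ⟨γ, hγ0, hγ, hfγ⟩ := hf u hu
    have hd : ∀ (g : smoothFunctions T), ∀ s ∈ Icc (0 : ℝ) 1,
        HasDerivWithinAt (fun s => (g : T → ℝ) (γ s))
          ((operatorRep V hV (v u) g : T → ℝ) (γ s)) (Icc 0 1) s := by
      intro g s hs
      rw [hv]
      exact (differentiableAt_coe g (γ s)).hasFDerivAt.comp_hasDerivWithinAt s (hγ s hs)
    have huniq : ∀ (g : smoothFunctions T) (a b : ℝ),
        (∀ s ∈ Icc (0 : ℝ) 1, (g : T → ℝ) (γ s) = s * a + b) →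
        ∀ s ∈ Icc (0 : ℝ) 1, (operatorRep V hV (v u) g : T → ℝ) (γ s) = a := by
      intro g a b hg s hs
      have h1 : HasDerivWithinAt (fun s => s * a + b) a (Icc (0 : ℝ) 1) s := by
        simpa using (((hasDerivAt_id s).mul_const a).add_const b).hasDerivWithinAt
      exact (uniqueDiffOn_Icc zero_lt_one s hs).eq_deriv _ (hd g s hs)
        (h1.congr (fun t ht => hg t ht) (hg s hs))
    have h1 := huniq f (u J) 0 (by simpa using hfγ)
    have h2 : ∀ k, ∀ s ∈ Icc (0 : ℝ) 1,
        (operatorRep V hV (v u ^ (k + 2)) f : T → ℝ) (γ s) = 0 := by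
      intro k
      induction k with
      | zero =>
        rw [zero_add, pow_two, map_mul]
        exact huniq _ 0 (u J) (by simpa using h1)
      | succ k ih =>
        rw [pow_succ', map_mul]
        exact huniq _ 0 0 (by simpa using ih)
    have h0 : (0 : ℝ) ∈ Icc (0 : ℝ) 1 := ⟨le_rfl, zero_le_one⟩
    refine ⟨by rw [hL]; simpa only [hγ0] using h1 0 h0, fun k hk => ?_⟩
    obtain ⟨k, rfl⟩ := Nat.exists_eq_add_of_le' hk
    rw [hL]
    simpa only [hγ0] using h2 k 0 h0
  have hv_smul : ∀ (c : ℝ) u, v (c • u) = c • v u := by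
    intro c u
    simp [v, Finset.smul_sum, smul_smul]
  -- The identities are homogeneous in `u`, so the restriction to small `u` is removed by scaling.
  have hsmall : ∀ u : B → ℝ, ∃ c : ℝ, c ≠ 0 ∧ c • u ∈ Metric.ball (0 : B → ℝ) ε := by
    intro u
    refine ⟨ε / (2 * (‖u‖ + 1)), by positivity, ?_⟩
    rw [mem_ball_zero_iff, norm_smul, Real.norm_of_nonneg (by positivity)]
    rw [div_mul_eq_mul_div, div_lt_iff₀ (by positivity)]
    nlinarith [norm_nonneg u]
  have hlin : ∀ u, L (v u) = u J := by
    intro u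
    obtain ⟨c, hc, hcu⟩ := hsmall u
    have := (hder _ hcu).1
    rw [hv_smul, map_smul, Pi.smul_apply, smul_eq_mul, smul_eq_mul] at this
    exact mul_left_cancel₀ hc this
  have hpow : ∀ u k, 2 ≤ k → L (v u ^ k) = 0 := by
    intro u k hk
    obtain ⟨c, hc, hcu⟩ := hsmall u
    have := (hder _ hcu).2 k hk
    rw [hv_smul, smul_pow, map_smul, smul_eq_mul] at this
    exact (mul_eq_zero.1 this).resolve_left (pow_ne_zero _ hc)
  have hfx : (f : T → ℝ) x = 0 := by
    obtain ⟨γ, hγ0, -, hfγ⟩ := hf 0 (Metric.mem_ball_self hε)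
    have := hfγ 0 ⟨le_rfl, zero_le_one⟩
    rwa [hγ0, zero_mul] at this
  by_cases hln : l = []
  · subst hln
    simpa using hfx
  let VB : Submodule ℝ A := Submodule.span ℝ (range fun I : B => formalBracket (I : List (Fin (n + 1))))
  have hsub : ∀ w < weight (J : List (Fin (n + 1))), formalSpan n w ≤ Submodule.span ℝ
      (formalBracket '' {K : List (Fin (n + 1)) | K ∈ B ∧ weight K = w}) := by
    intro w hw
    refine Submodule.span_le.2 ?_
    rintro _ ⟨I, ⟨hI, rfl⟩, rfl⟩
    exact hB I (mem_multiindices.2 ⟨hI, by omega⟩)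
  have hVB : ∀ a ∈ VB, ∃ u, a = v u := by
    intro a ha
    obtain ⟨c, hc⟩ := (Submodule.mem_span_range_iff_exists_fun ℝ).1 ha
    exact ⟨c, hc.symm⟩
  have := LinearMap.map_prod_eq_zero_of_map_pow_eq_zero (formalSpan n) commutator_mem_formalSpan L
    (weight (J : List (Fin (n + 1)))) VB
    (fun w hw => (hsub w hw).trans (Submodule.span_mono (by
      rintro _ ⟨K, ⟨hK, -⟩, rfl⟩
      exact ⟨⟨K, hK⟩, rfl⟩)))
    -- An element of weight `w < |J|` is a combination of commutators indexed by `K ∈ B` of weight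
    -- `w`; such `K` differ from `J`, so their coordinate of index `J` is zero.
    (fun w hw a ha => by
      have ha' := hsub w hw ha
      clear ha
      induction ha' using Submodule.span_induction with
      | mem a ha =>
        obtain ⟨K, ⟨hK, hKw⟩, rfl⟩ := ha
        have h1 := hlin (Pi.single ⟨K, hK⟩ 1)
        have h2 : v (Pi.single ⟨K, hK⟩ 1) = formalBracket K := by
          simp [v, Pi.single_apply, ite_smul]
        rw [h2] at h1
        rw [h1, Pi.single_eq_of_ne]
        rintro rfl
        exact absurd hKw (Nat.ne_of_gt hw)
      | zero => simp
      | add a b _ _ ha hb => rw [map_add, ha, hb, add_zero]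
      | smul c a _ ha => rw [map_smul, ha, smul_zero])
    (fun a ha k hk => by
      obtain ⟨u, rfl⟩ := hVB a ha
      exact hpow u k hk)
    (l.map fun I => (weight I, formalBracket I)) (by simpa using hln)
    (by
      intro q hq
      obtain ⟨I, hI, rfl⟩ := List.mem_map.1 hq
      exact formalBracket_mem_formalSpan (hl I hI))
    (by simpa [List.map_map, Function.comp_def] using hw)
  rw [hL] at this
  simpa [List.map_map, Function.comp_def] using this

end SmoothFields

/-! ### Taylor fields as smooth fields with the jet as a parameter. -/

section Jets

variable {n p : ℕ}

/-- The space of jets: for every field the derivatives of order at most `r - pᵢ`. -/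
abbrev JetSpace (n p r : ℕ) : Type :=
  ∀ i : Fin (n + 1), ∀ k : Fin (r - fieldWeight i + 1),
    ContinuousMultilinearMap ℝ (fun _ : Fin k => EuclideanSpace ℝ (Fin p))
      (EuclideanSpace ℝ (Fin p))

instance finiteDimensional_continuousMultilinearMap {k : ℕ} {E F : Type*}
    [NormedAddCommGroup E] [NormedSpace ℝ E] [NormedAddCommGroup F] [NormedSpace ℝ F]
    [FiniteDimensional ℝ E] [FiniteDimensional ℝ F] :
    FiniteDimensional ℝ (ContinuousMultilinearMap ℝ (fun _ : Fin k => E) F) :=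
  Module.Finite.of_injective
    (_root_.ContinuousMultilinearMap.toMultilinearMapLinear :
      ContinuousMultilinearMap ℝ (fun _ : Fin k => E) F →ₗ[ℝ] _)
    _root_.ContinuousMultilinearMap.toMultilinearMap_injective

/-- The jet of the fields at a point. -/
noncomputable def jet (X : Fin (n + 1) → EuclideanSpace ℝ (Fin p) → EuclideanSpace ℝ (Fin p))
    (r : ℕ) (y : EuclideanSpace ℝ (Fin p)) : JetSpace n p r :=
  fun i k => iteratedFDeriv ℝ k (X i) y

/-- The Taylor polynomials, as vector fields on the product of the space of jets and the space. -/
noncomputable def jetField (n p r : ℕ) (i : Fin (n + 1))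
    (q : JetSpace n p r × EuclideanSpace ℝ (Fin p)) :
    JetSpace n p r × EuclideanSpace ℝ (Fin p) :=
  (0, ∑ k : Fin (r - fieldWeight i + 1), (((k : ℕ).factorial : ℝ)⁻¹) • q.1 i k (fun _ => q.2))

/-- Induction on `k`, currying the first variable. -/
theorem contDiff_multilinear_diag {k : ℕ} : ∀ {Q E F : Type*}
    [NormedAddCommGroup Q] [NormedSpace ℝ Q]
    [NormedAddCommGroup E] [NormedSpace ℝ E] [NormedAddCommGroup F] [NormedSpace ℝ F]
    {a : Q → ContinuousMultilinearMap ℝ (fun _ : Fin k => E) F} {b : Q → E},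
    ContDiff ℝ ∞ a → ContDiff ℝ ∞ b → ContDiff ℝ ∞ (fun q => a q (fun _ => b q)) := by
  induction k with
  | zero =>
    intro Q E F _ _ _ _ _ _ a b ha hb
    have : (fun q => a q (fun _ => b q)) =
        fun q => continuousMultilinearCurryFin0 ℝ E F (a q) := by
      ext q
      rw [continuousMultilinearCurryFin0_apply]
      congr 1
      exact Subsingleton.elim _ _
    rw [this]
    exact (continuousMultilinearCurryFin0 ℝ E F).contDiff.comp ha
  | succ k ih =>
    intro Q E F _ _ _ _ _ _ a b ha hb
    have h1 : ContDiff ℝ ∞ fun q =>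
        continuousMultilinearCurryLeftEquiv ℝ (fun _ : Fin (k + 1) => E) F (a q) := by
      have h : ContDiff ℝ ∞ (continuousMultilinearCurryLeftEquiv ℝ (fun _ : Fin (k + 1) => E) F) :=
        LinearIsometryEquiv.contDiff _
      exact h.comp ha
    have h2 := ih (h1.clm_apply hb) hb
    convert h2 using 2 with q
    rw [continuousMultilinearCurryLeftEquiv_apply]
    congr 1
    ext i
    refine Fin.cases ?_ (fun i => ?_) i <;> simp

theorem contDiff_jetField (r : ℕ) (i : Fin (n + 1)) : ContDiff ℝ ∞ (jetField n p r i) := by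
  refine contDiff_const.prodMk (ContDiff.sum fun k _ => ContDiff.const_smul _ ?_)
  exact contDiff_multilinear_diag
    (contDiff_pi.1 (contDiff_pi.1 contDiff_fst i) k) contDiff_snd

theorem fieldBracket_jetField_fst (r : ℕ) (I : List (Fin (n + 1)))
    (q : JetSpace n p r × EuclideanSpace ℝ (Fin p)) :
    (fieldBracket (jetField n p r) I q).1 = 0 := by
  have key : ∀ {W : JetSpace n p r × EuclideanSpace ℝ (Fin p) →
      JetSpace n p r × EuclideanSpace ℝ (Fin p)}, ContDiff ℝ ∞ W → (∀ q, (W q).1 = 0) →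
      ∀ q v, (fderiv ℝ W q v).1 = 0 := by
    intro W hW h q v
    have h1 : HasFDerivAt (fun q => (W q).1)
        ((ContinuousLinearMap.fst ℝ _ _) ∘L (fderiv ℝ W q)) q :=
      hasFDerivAt_fst.comp q (hW.differentiable (by simp) q).hasFDerivAt
    simp_rw [h] at h1
    exact DFunLike.congr_fun (h1.unique (hasFDerivAt_const _ _)) v
  induction I generalizing q with
  | nil => rfl
  | cons i I ih =>
    by_cases h : I = []
    · subst h; rfl
    · rw [fieldBracket_cons _ _ h, VectorField.lieBracket_eq, Prod.fst_sub,
        key (contDiff_fieldBracket (contDiff_jetField r) I) ih,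
        key (contDiff_jetField r i) (fun _ => rfl), sub_zero]

theorem taylorField_eq_jetField
    (X : Fin (n + 1) → EuclideanSpace ℝ (Fin p) → EuclideanSpace ℝ (Fin p)) (r : ℕ)
    (i : Fin (n + 1)) (y z : EuclideanSpace ℝ (Fin p)) :
    taylorField X r y i z = (jetField n p r i (jet X r y, z - y)).2 := by
  unfold taylorField jetField jet
  rw [Finset.sum_range]

/-- The fields on the product have no component along the jets, so their commutators differentiate
in the space direction only; freezing the jet and translating by `y` therefore commutes with taking
brackets. -/
theorem bracket_taylorField
    (X : Fin (n + 1) → EuclideanSpace ℝ (Fin p) → EuclideanSpace ℝ (Fin p)) (r : ℕ)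
    (I : List (Fin (n + 1))) (y z : EuclideanSpace ℝ (Fin p)) :
    bracket (taylorField X r y) I z = (fieldBracket (jetField n p r) I (jet X r y, z - y)).2 := by
  rw [bracket_eq_fieldBracket]
  have key : ∀ {W : JetSpace n p r × EuclideanSpace ℝ (Fin p) →
      JetSpace n p r × EuclideanSpace ℝ (Fin p)}, ContDiff ℝ ∞ W → ∀ z v,
      fderiv ℝ (fun z => (W (jet X r y, z - y)).2) z v =
        (fderiv ℝ W (jet X r y, z - y) (0, v)).2 := by
    intro W hW z v
    have h1 : HasFDerivAt (fun z => (jet X r y, z - y))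
        (ContinuousLinearMap.inr ℝ (JetSpace n p r) (EuclideanSpace ℝ (Fin p))) z :=
      (hasFDerivAt_const _ z).prodMk ((hasFDerivAt_id z).sub_const y)
    have h2 : HasFDerivAt (fun z => (W (jet X r y, z - y)).2)
        ((ContinuousLinearMap.snd ℝ _ _) ∘L (fderiv ℝ W (jet X r y, z - y)) ∘L
          ContinuousLinearMap.inr ℝ (JetSpace n p r) (EuclideanSpace ℝ (Fin p))) z :=
      hasFDerivAt_snd.comp z ((hW.differentiable (by simp) _).hasFDerivAt.comp z h1)
    rw [h2.fderiv]
    rfl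
  induction I generalizing z with
  | nil => rfl
  | cons i I ih =>
    by_cases h : I = []
    · subst h; exact taylorField_eq_jetField X r i y z
    · have e1 : fieldBracket (taylorField X r y) I =
          fun z => (fieldBracket (jetField n p r) I (jet X r y, z - y)).2 := funext ih
      have e2 : taylorField X r y i = fun z => (jetField n p r i (jet X r y, z - y)).2 :=
        funext (taylorField_eq_jetField X r i y)
      rw [fieldBracket_cons _ _ h, fieldBracket_cons _ _ h, VectorField.lieBracket_eq,
        VectorField.lieBracket_eq, e1, e2, Prod.snd_sub]
      beta_reduce
      rw [key (contDiff_fieldBracket (contDiff_jetField r) I), key (contDiff_jetField r i)]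
      congr 3
      rw [← fieldBracket_jetField_fst r I (jet X r y, z - y)]

end Jets

end WeightedFields

/-! ### The exponential map as a chart depending smoothly on a parameter. -/

section CanonicalChart

/-- A function that is smooth near a point agrees near this point with a globally smooth one. -/
theorem exists_contDiff_eventuallyEq {T F : Type*} [NormedAddCommGroup T] [NormedSpace ℝ T]
    [FiniteDimensional ℝ T] [NormedAddCommGroup F] [NormedSpace ℝ F] {f : T → F} {O : Set T}
    (hO : IsOpen O) (hf : ContDiffOn ℝ ∞ f O) {x : T} (hx : x ∈ O) :
    ∃ g : T → F, ContDiff ℝ ∞ g ∧ g =ᶠ[𝓝 x] f := by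
  obtain ⟨R, hR, hRO⟩ := Metric.nhds_basis_closedBall.mem_iff.1 (hO.mem_nhds hx)
  let φ : ContDiffBump x := ⟨R / 2, R, by positivity, by linarith⟩
  refine ⟨fun y => φ y • f y, contDiff_iff_contDiffAt.2 fun y => ?_, ?_⟩
  · by_cases hy : y ∈ Metric.closedBall x R
    · exact φ.contDiff.contDiffAt.smul (hf.contDiffAt (hO.mem_nhds (hRO hy)))
    · rw [← φ.tsupport_eq, notMem_tsupport_iff_eventuallyEq] at hy
      refine (contDiffAt_const (c := (0 : F))).congr_of_eventuallyEq ?_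
      filter_upwards [hy] with z hz
      rw [hz, Pi.zero_apply, zero_smul]
  · filter_upwards [φ.eventuallyEq_one] with y hy
    rw [hy, Pi.one_apply, one_smul]

variable {P E ι : Type} [NormedAddCommGroup P] [NormedSpace ℝ P] [FiniteDimensional ℝ P]
  [NormedAddCommGroup E] [NormedSpace ℝ E] [FiniteDimensional ℝ E] [Fintype ι]

/-- Rescaling the coefficients of a combination of fields amounts to rescaling time. -/
theorem IsIntegralCurveOn.comp_mul_of_mem_Icc {V : ι → E → E} {u : ι → ℝ} {γ : ℝ → E}
    (h : IsIntegralCurveOn γ (fun _ w => ∑ I, u I • V I w) (Icc 0 1)) {s : ℝ}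
    (hs : s ∈ Icc (0 : ℝ) 1) :
    IsIntegralCurveOn (fun t => γ (t * s)) (fun _ w => ∑ I, (s • u) I • V I w) (Icc 0 1) := by
  intro t ht
  have hm : MapsTo (fun t => t * s) (Icc (0 : ℝ) 1) (Icc (0 : ℝ) 1) := fun t ht =>
    ⟨mul_nonneg ht.1 hs.1, mul_le_one₀ ht.2 hs.1 hs.2⟩
  have h1 := (h (t * s) (hm ht)).scomp t ((hasDerivAt_id t).mul_const s).hasDerivWithinAt hm
  convert h1 using 1
  · ext t; simp
  · simp [Finset.smul_sum, smul_smul]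

/-- Canonical coordinates of the first kind for a family of smooth vector fields depending
smoothly on a parameter. -/
theorem exists_canonicalChart {V : ι → P × E → E} (hV : ∀ I, ContDiff ℝ ∞ (V I)) (p₀ : P)
    (A : (ι → ℝ) ≃L[ℝ] E) (hA : ∀ u, A u = ∑ I, u I • V I (p₀, 0)) :
    ∃ (ε K : ℝ) (e : OpenPartialHomeomorph (P × (ι → ℝ)) (P × E)) (f : ι → P × E → ℝ),
      0 < ε ∧ 0 ≤ K ∧ Metric.ball p₀ ε ×ˢ Metric.ball 0 ε ⊆ e.source ∧
      (∀ q, (e q).1 = q.1) ∧ e (p₀, 0) = (p₀, 0) ∧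
      ContDiffOn ℝ ∞ e e.source ∧ ContDiffOn ℝ ∞ e.symm e.target ∧ (∀ J, ContDiff ℝ ∞ (f J)) ∧
      ∀ p ∈ Metric.ball p₀ ε, ∀ u ∈ Metric.ball (0 : ι → ℝ) ε, ∃ γ : ℝ → E, γ 0 = 0 ∧
        IsIntegralCurveOn γ (fun _ w => ∑ I, u I • V I (p, w)) (Icc 0 1) ∧
        ∀ s ∈ Icc (0 : ℝ) 1, e (p, s • u) = (p, γ s) ∧ ‖γ s‖ ≤ K * ‖u‖ ∧
          ∀ J, f J (p, γ s) = s * u J := by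
  have : CompleteSpace P := FiniteDimensional.complete ℝ P
  have : CompleteSpace E := FiniteDimensional.complete ℝ E
  let F : (P × (ι → ℝ)) × E → E := fun q => ∑ I, q.1.2 I • V I (q.1.1, q.2)
  have hF : ContDiff ℝ ∞ F := by
    refine ContDiff.sum fun I _ => ContDiff.smul ?_ ?_
    · exact contDiff_pi.1 (contDiff_snd.comp contDiff_fst) I
    · exact (hV I).comp ((contDiff_fst.comp contDiff_fst).prodMk contDiff_snd)
  obtain ⟨N, g, hN, hmem, hg, hγ⟩ := exists_contDiffOn_endpoint hF (l₀ := ((p₀, 0) : P × (ι → ℝ)))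
    (by intro w; simp [F])
  -- a neighbourhood which is a product of balls
  have hball : ∀ S ∈ 𝓝 ((p₀, 0) : P × (ι → ℝ)), ∃ δ > 0,
      Metric.ball p₀ δ ×ˢ Metric.ball (0 : ι → ℝ) δ ⊆ S := by
    intro S hS
    obtain ⟨δ, hδ, h⟩ := Metric.mem_nhds_iff.1 hS
    refine ⟨δ, hδ, ?_⟩
    rwa [ball_prod_same]
  have hstar : ∀ {δ : ℝ} {u : ι → ℝ} {s : ℝ}, u ∈ Metric.ball (0 : ι → ℝ) δ →
      s ∈ Icc (0 : ℝ) 1 → s • u ∈ Metric.ball (0 : ι → ℝ) δ := by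
    intro δ u s hu hs
    rw [mem_ball_zero_iff] at hu ⊢
    rw [norm_smul, Real.norm_of_nonneg hs.1]
    exact (mul_le_of_le_one_left (norm_nonneg _) hs.2).trans_lt hu
  obtain ⟨δ, hδ, hδN⟩ := hball N (hN.mem_nhds hmem)
  have hVp : ∀ (p : P) (u : ι → ℝ), ContDiff ℝ 1 fun w => ∑ I, u I • V I (p, w) := fun p u =>
    ContDiff.sum fun I _ => ContDiff.const_smul _
      (((hV I).of_le (by simp)).comp (contDiff_prodMk_right p))
  -- By rescaling time and uniqueness, the endpoint for `s • u` is the point at time `s` of the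
  -- curve for `u`.
  have hcurve : ∀ p ∈ Metric.ball p₀ δ, ∀ u ∈ Metric.ball (0 : ι → ℝ) δ, ∃ γ : ℝ → E, γ 0 = 0 ∧
      IsIntegralCurveOn γ (fun _ w => ∑ I, u I • V I (p, w)) (Icc 0 1) ∧
      ∀ s ∈ Icc (0 : ℝ) 1, g (p, s • u) = γ s := by
    intro p hp u hu
    obtain ⟨γ, h0, -, hI⟩ := hγ (p, u) (hδN ⟨hp, hu⟩)
    refine ⟨γ, h0, hI, fun s hs => ?_⟩
    obtain ⟨γ', h0', h1', hI'⟩ := hγ (p, s • u) (hδN ⟨hp, hstar hu hs⟩)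
    have h2 := IsIntegralCurveOn.comp_mul_of_mem_Icc hI hs
    have h3 := IsIntegralCurveOn.eqOn_of_contDiff (hVp p (s • u)) hI' h2 (by simp [h0, h0'])
      (right_mem_Icc.2 zero_le_one)
    rw [← h1', h3]
    beta_reduce
    rw [one_mul]
  have hg0 : ∀ p ∈ Metric.ball p₀ δ, g (p, 0) = 0 := by
    intro p hp
    obtain ⟨γ, h0, -, h⟩ := hcurve p hp 0 (Metric.mem_ball_self hδ)
    rw [← h0, ← h 0 ⟨le_rfl, zero_le_one⟩, smul_zero]
  have hgd : HasFDerivAt g (fderiv ℝ g (p₀, 0)) (p₀, 0) :=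
    ((hg.contDiffAt (hN.mem_nhds hmem)).differentiableAt (by simp)).hasFDerivAt
  -- There is no contribution of `μ` because `g (p, 0) = 0` for all `p` near `p₀`; in the direction
  -- of `u` the derivative is the initial velocity of the curve.
  have hD : ∀ μ u, fderiv ℝ g (p₀, 0) (μ, u) = A u := by
    have h1 : ∀ μ, fderiv ℝ g (p₀, 0) (μ, 0) = 0 := by
      intro μ
      have h2 : HasFDerivAt (fun p => g (p, 0)) (fderiv ℝ g (p₀, 0) ∘L
          ContinuousLinearMap.inl ℝ P (ι → ℝ)) p₀ := hgd.comp p₀ (hasFDerivAt_prodMk_left p₀ 0)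
      have h3 : HasFDerivAt (fun p => g (p, 0)) (0 : P →L[ℝ] E) p₀ :=
        (hasFDerivAt_const 0 p₀).congr_of_eventuallyEq (by
          filter_upwards [Metric.ball_mem_nhds p₀ hδ] with p hp using hg0 p hp)
      exact DFunLike.congr_fun (h2.unique h3) μ
    have h2 : ∀ u ∈ Metric.ball (0 : ι → ℝ) δ, fderiv ℝ g (p₀, 0) (0, u) = A u := by
      intro u hu
      obtain ⟨γ, h0, hI, h⟩ := hcurve p₀ (Metric.mem_ball_self hδ) u hu
      have hz : (0 : ℝ) ∈ Icc (0 : ℝ) 1 := ⟨le_rfl, zero_le_one⟩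
      have h3 := hI 0 hz
      beta_reduce at h3
      rw [h0, ← hA] at h3
      have h5 : HasDerivAt (fun s : ℝ => ((p₀, s • u) : P × (ι → ℝ))) (0, u) 0 := by
        refine (hasDerivAt_const 0 p₀).prodMk ?_
        simpa using (hasDerivAt_id (0 : ℝ)).smul_const u
      have h4 : HasDerivAt (fun s : ℝ => g (p₀, s • u)) (fderiv ℝ g (p₀, 0) (0, u)) 0 := by
        have h6 : HasFDerivAt g (fderiv ℝ g (p₀, 0)) ((p₀, (0 : ℝ) • u) : P × (ι → ℝ)) := by
          rw [zero_smul]; exact hgd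
        exact h6.comp_hasDerivAt (0 : ℝ) h5
      exact (uniqueDiffOn_Icc zero_lt_one 0 hz).eq_deriv _ h4.hasDerivWithinAt
        (h3.congr (fun s hs => h s hs) (h 0 hz))
    intro μ u
    have h3 : fderiv ℝ g (p₀, 0) (0, u) = A u := by
      have hc : 0 < δ / (2 * (‖u‖ + 1)) := by positivity
      have h4 := h2 ((δ / (2 * (‖u‖ + 1))) • u) (by
        rw [mem_ball_zero_iff, norm_smul, Real.norm_of_nonneg hc.le, div_mul_eq_mul_div,
          div_lt_iff₀ (by positivity)]
        nlinarith [norm_nonneg u])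
      have h5 : ((0, (δ / (2 * (‖u‖ + 1))) • u) : P × (ι → ℝ)) =
        (δ / (2 * (‖u‖ + 1))) • (0, u) := by simp
      rw [h5, map_smul, map_smul] at h4
      exact smul_right_injective _ hc.ne' h4
    have h6 : ((μ, u) : P × (ι → ℝ)) = (μ, 0) + (0, u) := by simp
    rw [h6, map_add, h1, h3, zero_add]
  let Φ : P × (ι → ℝ) → P × E := fun q => (q.1, g q)
  have hΦ : ContDiffOn ℝ ∞ Φ N := contDiffOn_fst.prodMk hg
  have hΦd : HasFDerivAt Φ (((ContinuousLinearEquiv.refl ℝ P).prodCongr A :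
      (P × (ι → ℝ)) ≃L[ℝ] (P × E)) : (P × (ι → ℝ)) →L[ℝ] (P × E)) (p₀, 0) := by
    have h1 : HasFDerivAt Φ ((ContinuousLinearMap.fst ℝ P (ι → ℝ)).prod (fderiv ℝ g (p₀, 0)))
        (p₀, 0) := hasFDerivAt_fst.prodMk hgd
    convert h1 using 1
    refine ContinuousLinearMap.ext fun q => ?_
    obtain ⟨μ, u⟩ := q
    simp [hD]
  obtain ⟨e, he0, heN, he, hes⟩ := exists_openPartialHomeomorph_of_contDiffOn hN hΦ hmem hΦd
  have he00 : e (p₀, 0) = (p₀, 0) := by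
    rw [he]; simp [Φ, hg0 p₀ (Metric.mem_ball_self hδ)]
  have hmt : ((p₀, 0) : P × E) ∈ e.target := by rw [← he00]; exact e.map_source he0
  -- The coordinates are replaced by globally smooth functions equal to them near the center, on
  -- which the differential operators can act.
  have hf : ∀ J : ι, ∃ f : P × E → ℝ, ContDiff ℝ ∞ f ∧
      f =ᶠ[𝓝 (p₀, 0)] fun q => (e.symm q).2 J := fun J =>
    exists_contDiff_eventuallyEq e.open_target
      (contDiffOn_pi.1 (contDiff_snd.comp_contDiffOn hes) J) hmt
  choose f hfs hfe using hf
  -- The local Lipschitz constant of `g` serves as `K`, because `g (p, 0) = 0`.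
  obtain ⟨L, S, hS, hL⟩ := (hg.contDiffAt (hN.mem_nhds hmem) |>.of_le
    (show (1 : ℕ∞ω) ≤ (∞ : ℕ∞ω) by simp)).exists_lipschitzOnWith
  have hfe' : ∀ᶠ q in 𝓝 ((p₀, 0) : P × (ι → ℝ)), ∀ J, f J (e q) = (e.symm (e q)).2 J := by
    have hc : Tendsto e (𝓝 (p₀, 0)) (𝓝 (p₀, 0)) := by
      have := e.continuousAt he0
      rwa [ContinuousAt, he00] at this
    exact eventually_all.2 fun J => hc.eventually (hfe J)
  obtain ⟨ε, hε, hεS⟩ := hball _ (inter_mem (inter_mem (inter_mem (e.open_source.mem_nhds he0) hS)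
    hfe') (prod_mem_nhds (Metric.ball_mem_nhds p₀ hδ) (Metric.ball_mem_nhds (0 : ι → ℝ) hδ)))
  refine ⟨ε, L, e, f, hε, L.2, fun q hq => (hεS hq).1.1.1, fun q => by rw [he], he00, ?_, hes, hfs,
    ?_⟩
  · exact (hΦ.mono heN).congr fun q _ => he q
  · intro p hp u hu
    have hu' := hεS (mk_mem_prod hp hu)
    obtain ⟨γ, h0, hI, h⟩ := hcurve p hu'.2.1 u hu'.2.2
    refine ⟨γ, h0, hI, fun s hs => ?_⟩
    have hsu := hεS (mk_mem_prod hp (hstar hu hs))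
    have h1 : e (p, s • u) = (p, γ s) := by rw [he]; simp [Φ, h s hs]
    refine ⟨h1, ?_, fun J => ?_⟩
    · have hz := hεS (show ((p, 0) : P × (ι → ℝ)) ∈ _ from ⟨hp, Metric.mem_ball_self hε⟩)
      have h2 := hL.dist_le_mul _ hsu.1.1.2 _ hz.1.1.2
      rw [hg0 p hu'.2.1, h s hs, dist_zero_right] at h2
      refine h2.trans ?_
      have h3 : dist ((p, s • u) : P × (ι → ℝ)) (p, 0) = ‖s • u‖ := by
        rw [Prod.dist_eq, dist_self, dist_zero_right]
        exact max_eq_right (norm_nonneg _)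
      rw [h3, norm_smul, Real.norm_of_nonneg hs.1]
      gcongr
      exact mul_le_of_le_one_left (norm_nonneg _) hs.2
    · have h2 := hsu.1.2 J
      rw [e.left_inv hsu.1.1.1, h1] at h2
      simpa using h2

end CanonicalChart

/-! ### Vanishing of derivatives at one point. -/

section Vanishing

universe u

variable {E : Type u} [NormedAddCommGroup E] [NormedSpace ℝ E]

/-- The derivatives of `f` of order at most `m` vanish at `y`. -/
def DerivZero (y : E) : ℕ → ∀ {G : Type u} [NormedAddCommGroup G] [NormedSpace ℝ G],
    (E → G) → Prop
  | 0, _, _, _, f => f y = 0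
  | m + 1, _, _, _, f => f y = 0 ∧ DerivZero y m (fderiv ℝ f)

variable {y : E}

theorem DerivZero.apply {G : Type u} [NormedAddCommGroup G] [NormedSpace ℝ G] {m : ℕ} {f : E → G}
    (h : DerivZero y m f) : f y = 0 := by
  cases m with
  | zero => exact h
  | succ m => exact h.1

theorem DerivZero.mono {m m' : ℕ} (hm : m' ≤ m) {G : Type u} [NormedAddCommGroup G]
    [NormedSpace ℝ G] {f : E → G} (h : DerivZero y m f) : DerivZero y m' f := by
  induction m' generalizing m G with
  | zero => exact h.apply
  | succ k ih =>
    obtain ⟨m, rfl⟩ := Nat.exists_eq_succ_of_ne_zero (by omega : m ≠ 0)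
    exact ⟨h.1, ih (by omega) h.2⟩

theorem DerivZero.congr {m : ℕ} : ∀ {G : Type u} [NormedAddCommGroup G]
    [NormedSpace ℝ G] {f g : E → G}, DerivZero y m f → g =ᶠ[𝓝 y] f → DerivZero y m g := by
  induction m with
  | zero => intro G _ _ f g h he; exact he.eq_of_nhds.trans h
  | succ m ih =>
    intro G _ _ f g h he
    exact ⟨he.eq_of_nhds.trans h.1, ih h.2 he.fderiv⟩

theorem ContDiffAt.eventually_differentiableAt {G : Type u} [NormedAddCommGroup G]
    [NormedSpace ℝ G] {m : ℕ} {f : E → G} (hf : ContDiffAt ℝ (m + 1 : ℕ) f y) :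
    ∀ᶠ z in 𝓝 y, DifferentiableAt ℝ f z := by
  filter_upwards [hf.eventually (by simp)] with z hz
  exact hz.differentiableAt (by simp)

theorem DerivZero.add {m : ℕ} : ∀ {G : Type u} [NormedAddCommGroup G]
    [NormedSpace ℝ G] {f g : E → G}, ContDiffAt ℝ m f y → ContDiffAt ℝ m g y →
    DerivZero y m f → DerivZero y m g → DerivZero y m (fun z => f z + g z) := by
  induction m with
  | zero =>
    intro G _ _ f g _ _ hf hg
    exact (congrArg₂ (· + ·) hf.apply hg.apply).trans (add_zero 0)
  | succ m ih =>
    intro G _ _ f g cf cg hf hg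
    refine ⟨(congrArg₂ (· + ·) hf.1 hg.1).trans (add_zero 0),
      (ih (cf.fderiv_right (by norm_cast)) (cg.fderiv_right (by norm_cast)) hf.2 hg.2).congr ?_⟩
    filter_upwards [cf.eventually_differentiableAt, cg.eventually_differentiableAt] with z h1 h2
    exact fderiv_fun_add h1 h2

theorem DerivZero.bilin {m : ℕ} : ∀ {F G H : Type u} [NormedAddCommGroup F] [NormedSpace ℝ F]
    [NormedAddCommGroup G] [NormedSpace ℝ G] [NormedAddCommGroup H] [NormedSpace ℝ H]
    (B : F →L[ℝ] G →L[ℝ] H) {f : E → F} {g : E → G}, ContDiffAt ℝ m f y → ContDiffAt ℝ m g y →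
    DerivZero y m f → DerivZero y m (fun z => B (f z) (g z)) := by
  induction m with
  | zero =>
    intro F G H _ _ _ _ _ _ B f g _ _ hf
    change B (f y) (g y) = 0
    rw [hf.apply, map_zero, zero_apply]
  | succ m ih =>
    intro F G H _ _ _ _ _ _ B f g cf cg hf
    have cf' : ContDiffAt ℝ m (fderiv ℝ f) y := cf.fderiv_right (by norm_cast)
    have cg' : ContDiffAt ℝ m (fderiv ℝ g) y := cg.fderiv_right (by norm_cast)
    have cf0 : ContDiffAt ℝ m f y := cf.of_le (by norm_cast; omega)
    have cg0 : ContDiffAt ℝ m g y := cg.of_le (by norm_cast; omega)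
    refine ⟨?_, ?_⟩
    · change B (f y) (g y) = 0
      rw [hf.1, map_zero, zero_apply]
    · refine (DerivZero.add ?_ ?_ (ih (B.precompR E) cf0 cg' (hf.mono (Nat.le_succ m)))
        (ih (B.precompL E) cf' cg0 hf.2)).congr ?_
      · exact ((B.precompR E).contDiff.contDiffAt.comp y cf0).clm_apply cg'
      · exact ((B.precompL E).contDiff.contDiffAt.comp y cf').clm_apply cg0
      · filter_upwards [cf.eventually_differentiableAt, cg.eventually_differentiableAt] with z h1 h2
        exact (B.hasFDerivAt_of_bilinear h1.hasFDerivAt h2.hasFDerivAt).fderiv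

theorem DerivZero.neg {m : ℕ} : ∀ {G : Type u} [NormedAddCommGroup G]
    [NormedSpace ℝ G] {f : E → G}, DerivZero y m f → DerivZero y m (fun z => -f z) := by
  induction m with
  | zero => intro G _ _ f hf; exact (congrArg Neg.neg hf.apply).trans neg_zero
  | succ m ih =>
    intro G _ _ f hf
    exact ⟨(congrArg Neg.neg hf.1).trans neg_zero,
      (ih hf.2).congr (Eventually.of_forall fun z => fderiv_fun_neg)⟩

theorem DerivZero.of_iteratedFDeriv_eq_zero {m : ℕ} : ∀ {G : Type u} [NormedAddCommGroup G]
    [NormedSpace ℝ G] {f : E → G}, (∀ k ≤ m, iteratedFDeriv ℝ k f y = 0) → DerivZero y m f := by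
  have h0 : ∀ {G : Type u} [NormedAddCommGroup G] [NormedSpace ℝ G] {f : E → G},
      iteratedFDeriv ℝ 0 f y = 0 → f y = 0 := by
    intro G _ _ f h
    rwa [← norm_eq_zero, norm_iteratedFDeriv_zero, norm_eq_zero] at h
  induction m with
  | zero => intro G _ _ f h; exact h0 (h 0 le_rfl)
  | succ m ih =>
    intro G _ _ f h
    refine ⟨h0 (h 0 (by omega)), ih fun k hk => ?_⟩
    rw [← norm_eq_zero, norm_iteratedFDeriv_fderiv, h (k + 1) (by omega), norm_zero]

end Vanishing

namespace WeightedFields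

/-! ### Brackets of fields that agree to high order at a point. -/

section Remainder

variable {n p r : ℕ}

theorem bracket_cons {X : Fin (n + 1) → EuclideanSpace ℝ (Fin p) → EuclideanSpace ℝ (Fin p)}
    (i : Fin (n + 1)) {I : List (Fin (n + 1))} (hI : I ≠ []) :
    bracket X (i :: I) = VectorField.lieBracket ℝ (X i) (bracket X I) := by
  cases I with
  | nil => exact absurd rfl hI
  | cons j I => rfl

/-- A bracket costs one derivative, while the weights of both of its entries are at least one, so
the loss never exceeds the increase of the weight. -/
theorem contDiffAt_bracket
    {X : Fin (n + 1) → EuclideanSpace ℝ (Fin p) → EuclideanSpace ℝ (Fin p)}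
    {y : EuclideanSpace ℝ (Fin p)} (hX : ∀ i, ContDiffAt ℝ (r - fieldWeight i : ℕ) (X i) y) :
    ∀ I : List (Fin (n + 1)), I ≠ [] → weight I ≤ r →
      ContDiffAt ℝ (r - weight I : ℕ) (bracket X I) y := by
  intro I
  induction I with
  | nil => exact fun h => absurd rfl h
  | cons i I ih =>
    intro _ hw
    rw [weight_cons] at hw ⊢
    by_cases h : I = []
    · subst h; exact hX i
    · have h1 := fieldWeight_pos i
      have h2 : 1 ≤ weight I := (List.length_pos_iff.2 h).trans_le (length_le_weight I)
      rw [bracket_cons i h]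
      refine ContDiffAt.lieBracket_vectorField
        ((hX i).of_le (m := (r - (fieldWeight i + weight I) + 1 : ℕ)) ?_)
        ((ih h (by omega)).of_le ?_) ?_
      · norm_cast; omega
      · norm_cast; omega
      · norm_cast

/-- The splitting is arranged so that each term contains exactly one difference, possibly
differentiated once; this is what the inductions on the multiindex use. -/
theorem lieBracket_sub_lieBracket {E : Type*} [NormedAddCommGroup E] [NormedSpace ℝ E]
    {V W V' W' : E → E} {z : E} (hV : DifferentiableAt ℝ V z) (hV' : DifferentiableAt ℝ V' z)
    (hW : DifferentiableAt ℝ W z) (hW' : DifferentiableAt ℝ W' z) :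
    VectorField.lieBracket ℝ V W z - VectorField.lieBracket ℝ V' W' z =
      (fderiv ℝ (fun z => W z - W' z) z (V z) + fderiv ℝ W' z (V z - V' z)) +
      -(fderiv ℝ (fun z => V z - V' z) z (W z) + fderiv ℝ V' z (W z - W' z)) := by
  rw [fderiv_fun_sub hW hW', fderiv_fun_sub hV hV', VectorField.lieBracket_eq,
    VectorField.lieBracket_eq]
  simp only [sub_apply, map_sub]
  abel

/-- Induction on the multiindex: every term of the splitting contains a difference that vanishes to
order `m + 1`, or its derivative, and so vanishes to order `m`. Regularity is needed at `y` only. -/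
theorem derivZero_bracket_sub
    {X S : Fin (n + 1) → EuclideanSpace ℝ (Fin p) → EuclideanSpace ℝ (Fin p)}
    {y : EuclideanSpace ℝ (Fin p)} (hX : ∀ i, ContDiffAt ℝ (r - fieldWeight i : ℕ) (X i) y)
    (hS : ∀ i, ContDiffAt ℝ (r - fieldWeight i : ℕ) (S i) y)
    (h : ∀ i, DerivZero y (r - fieldWeight i) (fun z => X i z - S i z)) :
    ∀ I : List (Fin (n + 1)), I ≠ [] → weight I ≤ r →
      DerivZero y (r - weight I) (fun z => bracket X I z - bracket S I z) := by
  intro I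
  induction I with
  | nil => exact fun h => absurd rfl h
  | cons i I ih =>
    intro _ hw
    rw [weight_cons] at hw ⊢
    by_cases hI : I = []
    · subst hI; exact h i
    have h1 := fieldWeight_pos i
    have h2 : 1 ≤ weight I := (List.length_pos_iff.2 hI).trans_le (length_le_weight I)
    rw [bracket_cons i hI, bracket_cons i hI]
    set m := r - (fieldWeight i + weight I) with hm
    have hmi : m + 1 ≤ r - fieldWeight i := by omega
    have hmI : m + 1 ≤ r - weight I := by omega
    have cX : ContDiffAt ℝ (m + 1 : ℕ) (X i) y := (hX i).of_le (by exact_mod_cast hmi)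
    have cS : ContDiffAt ℝ (m + 1 : ℕ) (S i) y := (hS i).of_le (by exact_mod_cast hmi)
    have cXI : ContDiffAt ℝ (m + 1 : ℕ) (bracket X I) y :=
      (contDiffAt_bracket hX I hI (by omega)).of_le (by exact_mod_cast hmI)
    have cSI : ContDiffAt ℝ (m + 1 : ℕ) (bracket S I) y :=
      (contDiffAt_bracket hS I hI (by omega)).of_le (by exact_mod_cast hmI)
    have lo : ∀ {f : EuclideanSpace ℝ (Fin p) → EuclideanSpace ℝ (Fin p)},
        ContDiffAt ℝ (m + 1 : ℕ) f y → ContDiffAt ℝ m f y :=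
      fun hf => hf.of_le (by norm_cast; omega)
    have fd : ∀ {f : EuclideanSpace ℝ (Fin p) → EuclideanSpace ℝ (Fin p)},
        ContDiffAt ℝ (m + 1 : ℕ) f y → ContDiffAt ℝ m (fderiv ℝ f) y :=
      fun hf => hf.fderiv_right (by norm_cast)
    have dI : DerivZero y (m + 1) (fun z => bracket X I z - bracket S I z) :=
      (ih hI (by omega)).mono hmI
    have di : DerivZero y (m + 1) (fun z => X i z - S i z) := (h i).mono hmi
    let Ev := ContinuousLinearMap.id ℝ
      (EuclideanSpace ℝ (Fin p) →L[ℝ] EuclideanSpace ℝ (Fin p))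
    have key : ∀ {V V' W W' : EuclideanSpace ℝ (Fin p) → EuclideanSpace ℝ (Fin p)},
        ContDiffAt ℝ (m + 1 : ℕ) V y → ContDiffAt ℝ (m + 1 : ℕ) V' y →
        ContDiffAt ℝ (m + 1 : ℕ) W y → ContDiffAt ℝ (m + 1 : ℕ) W' y →
        DerivZero y (m + 1) (fun z => V z - V' z) → DerivZero y (m + 1) (fun z => W z - W' z) →
        DerivZero y m (fun z => fderiv ℝ (fun z => W z - W' z) z (V z) +
          fderiv ℝ W' z (V z - V' z)) ∧ ContDiffAt ℝ m (fun z =>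
          fderiv ℝ (fun z => W z - W' z) z (V z) + fderiv ℝ W' z (V z - V' z)) y := by
      intro V V' W W' cV cV' cW cW' dV dW
      have c1 : ContDiffAt ℝ m (fderiv ℝ (fun z => W z - W' z)) y := fd (cW.sub cW')
      have c2 : ContDiffAt ℝ m (fun z => V z - V' z) y := (lo cV).sub (lo cV')
      refine ⟨DerivZero.add (c1.clm_apply (lo cV)) ((fd cW').clm_apply c2)
        (DerivZero.bilin Ev c1 (lo cV) dW.2)
        (DerivZero.bilin Ev.flip c2 (fd cW') (dV.mono (Nat.le_succ m))),
        (c1.clm_apply (lo cV)).add ((fd cW').clm_apply c2)⟩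
    obtain ⟨z1, d1⟩ := key cX cS cXI cSI di dI
    obtain ⟨z2, d2⟩ := key cXI cSI cX cS dI di
    refine (DerivZero.add d1 d2.neg z1 z2.neg).congr ?_
    filter_upwards [cX.eventually_differentiableAt, cS.eventually_differentiableAt,
      cXI.eventually_differentiableAt, cSI.eventually_differentiableAt] with z h1 h2 h3 h4
    exact lieBracket_sub_lieBracket h1 h2 h3 h4

end Remainder


/-! ### Comparison of the fields with their Taylor polynomials. -/

section TaylorFields

variable {n p r : ℕ} {X : Fin (n + 1) → EuclideanSpace ℝ (Fin p) → EuclideanSpace ℝ (Fin p)}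
  {y : EuclideanSpace ℝ (Fin p)}

theorem continuousAt_jet (hX : ∀ i, ContDiffAt ℝ (r - fieldWeight i : ℕ) (X i) y) :
    ContinuousAt (jet X r) y := by
  refine continuousAt_pi.2 fun i => continuousAt_pi.2 fun k => ?_
  exact ((hX i).iteratedFDeriv_right (m := 0) (i := k) (by norm_cast; omega)).continuousAt

theorem contDiff_taylorField (r : ℕ) (y : EuclideanSpace ℝ (Fin p)) (i : Fin (n + 1)) :
    ContDiff ℝ ∞ (taylorField X r y i) := by
  have h : taylorField X r y i = fun z => (jetField n p r i (jet X r y, z - y)).2 :=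
    funext fun z => taylorField_eq_jetField X r i y z
  rw [h]
  exact contDiff_snd.comp ((contDiff_jetField r i).comp
    (contDiff_const.prodMk (contDiff_id.sub contDiff_const)))

theorem iteratedFDeriv_sub_taylorField {i : Fin (n + 1)}
    (hX : ContDiffAt ℝ (r - fieldWeight i : ℕ) (X i) y) {k : ℕ} (hk : k ≤ r - fieldWeight i) :
    iteratedFDeriv ℝ k (fun z => X i z - taylorField X r y i z) y = 0 := by
  have h1 : iteratedFDeriv ℝ k (taylorField X r y i) y = iteratedFDeriv ℝ k (X i) y :=
    iteratedFDeriv_taylorPolynomial hX hk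
  have h2 := iteratedFDeriv_sub_apply (f := X i) (g := taylorField X r y i) (i := k) (𝕜 := ℝ)
    (x := y) (hX.of_le (by exact_mod_cast hk))
    ((contDiff_taylorField r y i).contDiffAt.of_le (WithTop.coe_le_coe.2 le_top))
  rw [h1, sub_self] at h2
  exact h2

/-- With `y` the base point, this makes the derivative of the exponential map at `u = 0` invertible:
it sends `u` to a combination of the basis `X_[I]`, `I ∈ B`. -/
theorem bracket_taylorField_self (hX : ∀ i, ContDiffAt ℝ (r - fieldWeight i : ℕ) (X i) y)
    {I : List (Fin (n + 1))} (hI : I ∈ multiindices n r) :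
    bracket (taylorField X r y) I y = bracket X I y := by
  obtain ⟨hI, hw⟩ := mem_multiindices.1 hI
  have := (derivZero_bracket_sub hX (S := taylorField X r y)
    (fun i => (contDiff_taylorField r y i).contDiffAt.of_le (WithTop.coe_le_coe.2 le_top))
    (fun i => DerivZero.of_iteratedFDeriv_eq_zero fun k hk =>
      iteratedFDeriv_sub_taylorField (hX i) hk) I hI hw).apply
  exact (sub_eq_zero.1 this).symm

variable {D : Set (EuclideanSpace ℝ (Fin p))}

theorem exists_jet_bound (hXb : ∀ i, ∀ k ≤ r - fieldWeight i, ∃ C : ℝ, ∀ z ∈ D,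
    ‖iteratedFDeriv ℝ k (X i) z‖ ≤ C) : ∃ R : ℝ, ∀ y ∈ D, ‖jet X r y‖ ≤ R := by
  choose C hC using hXb
  have h : ∀ i, ∀ k : Fin (r - fieldWeight i + 1), ∀ y ∈ D, ‖jet X r y i k‖ ≤
      ∑ i, ∑ k : Fin (r - fieldWeight i + 1), |C i k (Nat.lt_succ_iff.1 k.2)| := by
    intro i k y hy
    calc _ ≤ |C i k (Nat.lt_succ_iff.1 k.2)| := (hC i k _ y hy).trans (le_abs_self _)
      _ ≤ ∑ k : Fin (r - fieldWeight i + 1), |C i k (Nat.lt_succ_iff.1 k.2)| :=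
        Finset.single_le_sum (f := fun k : Fin (r - fieldWeight i + 1) =>
          |C i k (Nat.lt_succ_iff.1 k.2)|) (fun _ _ => abs_nonneg _) (Finset.mem_univ k)
      _ ≤ _ := Finset.single_le_sum (f := fun i => ∑ k : Fin (r - fieldWeight i + 1),
          |C i k (Nat.lt_succ_iff.1 k.2)|) (fun _ _ => Finset.sum_nonneg fun _ _ => abs_nonneg _)
          (Finset.mem_univ i)
  have h0 : 0 ≤ ∑ i, ∑ k : Fin (r - fieldWeight i + 1), |C i k (Nat.lt_succ_iff.1 k.2)| :=
    Finset.sum_nonneg fun _ _ => Finset.sum_nonneg fun _ _ => abs_nonneg _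
  exact ⟨_, fun y hy => (pi_norm_le_iff_of_nonneg h0).2 fun i =>
    (pi_norm_le_iff_of_nonneg h0).2 fun k => h i k y hy⟩

/-- The commutators of the fields and of their Taylor polynomials: estimate of the difference. -/
theorem derivBd_bracket_sub (hDo : IsOpen D) (hDb : Bornology.IsBounded D) (hDc : Convex ℝ D)
    (hX : ∀ i, ContDiffOn ℝ (r - fieldWeight i : ℕ) (X i) D)
    (hXb : ∀ i, ∀ k ≤ r - fieldWeight i, ∃ C : ℝ, ∀ z ∈ D, ‖iteratedFDeriv ℝ k (X i) z‖ ≤ C) :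
    ∀ I : List (Fin (n + 1)), I ≠ [] → weight I ≤ r →
      DerivBd D (r - weight I) 0 (fun _ => bracket X I) ∧
      DerivBd D (r - weight I) (r - weight I)
        (fun y z => bracket X I z - bracket (taylorField X r y) I z) := by
  obtain ⟨R, hR⟩ := exists_jet_bound hXb
  obtain ⟨R', hR'⟩ := Metric.isBounded_iff.1 hDb
  have : ProperSpace (JetSpace n p r) := FiniteDimensional.proper ℝ _
  -- The jets at points of `D` are bounded and so is `z - y`; all derivatives of the commutators of
  -- Taylor fields are thus bounded uniformly in the center.
  have hS : ∀ (m : ℕ) (I : List (Fin (n + 1))),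
      DerivBd D m 0 (fun y => bracket (taylorField X r y) I) := by
    intro m I
    have hg : ContDiff ℝ ∞ fun q => (fieldBracket (jetField n p r) I q).2 :=
      contDiff_snd.comp (contDiff_fieldBracket (contDiff_jetField r) I)
    refine (DerivBd.of_comp (j := jet X r) ((isCompact_closedBall (0 : JetSpace n p r) R).prod
      (isCompact_closedBall (0 : EuclideanSpace ℝ (Fin p)) R')) (fun y hy z hz => ⟨?_, ?_⟩)
      (m := m) hg).congr hDo fun y _ z _ => bracket_taylorField X r I y z
    · exact mem_closedBall_zero_iff.2 (hR y hy)
    · rw [mem_closedBall_zero_iff, ← dist_eq_norm]; exact hR' hz hy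
  have cS : ∀ (y) (I : List (Fin (n + 1))), Differentiable ℝ (bracket (taylorField X r y) I) := by
    intro y I
    rw [bracket_eq_fieldBracket]
    exact (contDiff_fieldBracket (contDiff_taylorField r y) I).differentiable (by simp)
  intro I
  induction I with
  | nil => exact fun h => absurd rfl h
  | cons i I ih =>
    intro _ hw
    rw [weight_cons] at hw ⊢
    have b0 : DerivBd D (r - fieldWeight i) 0 (fun _ => X i) := .of_contDiffOn hDo (hX i) (hXb i)
    have b1 : DerivBd D (r - fieldWeight i) (r - fieldWeight i)
        (fun y z => X i z - taylorField X r y i z) := by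
      refine .of_iteratedFDeriv_eq_zero hDc (b0.sub hDo (hS _ [i])) fun y hy k hk => ?_
      exact iteratedFDeriv_sub_taylorField ((hX i).contDiffAt (hDo.mem_nhds hy)) hk.le
    by_cases hI : I = []
    · subst hI; exact ⟨b0, b1⟩
    have h1 := fieldWeight_pos i
    have h2 : 1 ≤ weight I := (List.length_pos_iff.2 hI).trans_le (length_le_weight I)
    obtain ⟨c0, c1⟩ := ih hI (by omega)
    simp_rw [bracket_cons i hI]
    set m := r - (fieldWeight i + weight I) with hm
    have hmi : m + 1 ≤ r - fieldWeight i := by omega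
    have hmI : m + 1 ≤ r - weight I := by omega
    let Ev := ContinuousLinearMap.id ℝ
      (EuclideanSpace ℝ (Fin p) →L[ℝ] EuclideanSpace ℝ (Fin p))
    have b0' : DerivBd D (m + 1) 0 (fun _ => X i) := b0.mono_left hmi
    have b1' : DerivBd D (m + 1) (m + 1) (fun y z => X i z - taylorField X r y i z) :=
      (b1.mono_left hmi).mono_right hDb hmi
    have c0' : DerivBd D (m + 1) 0 (fun _ => bracket X I) := c0.mono_left hmI
    have c1' : DerivBd D (m + 1) (m + 1)
        (fun y z => bracket X I z - bracket (taylorField X r y) I z) :=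
      (c1.mono_left hmI).mono_right hDb hmI
    have s1 := (hS (m + 1) I).2.2
    have s2 : DerivBd D m 0 (fun y z => fderiv ℝ (taylorField X r y i) z) := (hS (m + 1) [i]).2.2
    constructor
    · refine ((DerivBd.bilin hDo hDb Ev c0'.2.2 b0'.of_succ).sub hDo
        (DerivBd.bilin hDo hDb Ev b0'.2.2 c0'.of_succ)).congr hDo fun y _ z _ => ?_
      rw [VectorField.lieBracket_eq]; rfl
    · refine (((DerivBd.bilin hDo hDb Ev c1'.2.2 b0'.of_succ).add hDo
        (DerivBd.bilin hDo hDb Ev.flip (b1'.of_succ.mono_right hDb (Nat.le_succ m)) s1)).add hDo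
        (((DerivBd.bilin hDo hDb Ev b1'.2.2 c0'.of_succ).add hDo (DerivBd.bilin hDo hDb Ev.flip
          (c1'.of_succ.mono_right hDb (Nat.le_succ m)) s2)).neg hDo)).congr hDo
          fun y hy z hz => ?_
      exact lieBracket_sub_lieBracket (b0'.2.1 y hy z hz)
        ((contDiff_taylorField r y i).differentiable (by simp) z) (c0'.2.1 y hy z hz) (cS y I z)

theorem exists_norm_bracket_sub_le (hDo : IsOpen D) (hDb : Bornology.IsBounded D)
    (hDc : Convex ℝ D) (hX : ∀ i, ContDiffOn ℝ (r - fieldWeight i : ℕ) (X i) D)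
    (hXb : ∀ i, ∀ k ≤ r - fieldWeight i, ∃ C : ℝ, ∀ z ∈ D, ‖iteratedFDeriv ℝ k (X i) z‖ ≤ C) :
    ∃ C : ℝ, 0 ≤ C ∧ ∀ I ∈ multiindices n r, ∀ y ∈ D, ∀ z ∈ D, ‖bracket X I z‖ ≤ C ∧
      ‖bracket X I z - bracket (taylorField X r y) I z‖ ≤ C * ‖z - y‖ ^ (r - weight I) := by
  have h : ∀ I : multiindices n r, ∃ C : ℝ, 0 ≤ C ∧ ∀ y ∈ D, ∀ z ∈ D, ‖bracket X I z‖ ≤ C ∧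
      ‖bracket X I z - bracket (taylorField X r y) I z‖ ≤ C * ‖z - y‖ ^ (r - weight I.1) := by
    intro I
    obtain ⟨hI, hw⟩ := mem_multiindices.1 I.2
    obtain ⟨h1, h2⟩ := derivBd_bracket_sub hDo hDb hDc hX hXb I hI hw
    obtain ⟨C, hC, h1⟩ := h1.bound
    obtain ⟨C', hC', h2⟩ := h2.bound
    refine ⟨max C C', hC.trans (le_max_left _ _), fun y hy z hz => ⟨?_, ?_⟩⟩
    · have := h1 y hy z hz
      rw [pow_zero, mul_one] at this
      exact this.trans (le_max_left _ _)
    · exact (h2 y hy z hz).trans (by gcongr; exact le_max_right _ _)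
  choose C hC h using h
  refine ⟨∑ I, C I, Finset.sum_nonneg fun I _ => hC I, fun I hI y hy z hz => ?_⟩
  have hle : C ⟨I, hI⟩ ≤ ∑ I, C I :=
    Finset.single_le_sum (fun I _ => hC I) (Finset.mem_univ (⟨I, hI⟩ : multiindices n r))
  obtain ⟨h1, h2⟩ := h ⟨I, hI⟩ y hy z hz
  exact ⟨h1.trans hle, h2.trans (by gcongr)⟩

end TaylorFields

end WeightedFields

/-! ### Absolutely continuous curves. -/

section AbsolutelyContinuous

theorem AbsolutelyContinuousOnInterval.comp_lipschitzOnWith {S T : Type*} [PseudoMetricSpace S]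
    [PseudoMetricSpace T] {f : ℝ → S} {g : S → T} {s : Set S} {K : NNReal} {a b : ℝ}
    (hf : AbsolutelyContinuousOnInterval f a b) (hg : LipschitzOnWith K g s)
    (h : ∀ t ∈ uIcc a b, f t ∈ s) : AbsolutelyContinuousOnInterval (fun t => g (f t)) a b := by
  rw [absolutelyContinuousOnInterval_iff] at hf ⊢
  intro ε hε
  obtain ⟨δ, hδ, hE⟩ := hf (ε / (K + 1)) (by positivity)
  refine ⟨δ, hδ, fun E hEd hEs => ?_⟩
  have h1 := hE E hEd hEs
  rw [lt_div_iff₀ (by positivity)] at h1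
  have h2 : ∀ i ∈ Finset.range E.1, dist (g (f (E.2 i).1)) (g (f (E.2 i).2)) ≤
      K * dist (f (E.2 i).1) (f (E.2 i).2) := fun i hi =>
    hg.dist_le_mul _ (h _ (hEd.1 i hi).1) _ (h _ (hEd.1 i hi).2)
  refine (Finset.sum_le_sum h2).trans_lt ?_
  rw [← Finset.mul_sum]
  have h3 : 0 ≤ ∑ i ∈ Finset.range E.1, dist (f (E.2 i).1) (f (E.2 i).2) :=
    Finset.sum_nonneg fun _ _ => dist_nonneg
  linarith

/-- A linear form that norms `f b - f a` reduces the estimate to the fundamental theorem of calculus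
for real absolutely continuous functions. -/
theorem AbsolutelyContinuousOnInterval.norm_sub_le {F : Type*} [NormedAddCommGroup F]
    [NormedSpace ℝ F] {f : ℝ → F} {a b M : ℝ} (hab : a ≤ b)
    (hf : AbsolutelyContinuousOnInterval f a b)
    (hd : ∀ᵐ t, t ∈ Icc a b → ∃ f', HasDerivAt f f' t ∧ ‖f'‖ ≤ M) :
    ‖f b - f a‖ ≤ M * (b - a) := by
  obtain ⟨L, hL1, hL⟩ := exists_dual_vector'' ℝ (f b - f a)
  have hLf : AbsolutelyContinuousOnInterval (fun t => L (f t)) a b :=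
    hf.comp_lipschitzOnWith L.lipschitz.lipschitzOnWith (fun t _ => mem_univ _)
  have h1 := hLf.integral_deriv_eq_sub
  rw [← map_sub, hL] at h1
  have h2 : ‖∫ t in a..b, deriv (fun t => L (f t)) t‖ ≤ M * |b - a| := by
    refine intervalIntegral.norm_integral_le_of_norm_le_const_ae ?_
    filter_upwards [hd] with t ht hm
    rw [uIoc_of_le hab] at hm
    obtain ⟨f', h3, h4⟩ := ht (Ioc_subset_Icc_self hm)
    have h5 : HasDerivAt (fun t => L (f t)) (L f') t := L.hasFDerivAt.comp_hasDerivAt t h3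
    rw [h5.deriv]
    refine (L.le_opNorm f').trans ?_
    exact (mul_le_of_le_one_left (norm_nonneg _) hL1).trans h4
  rw [h1, abs_of_nonneg (sub_nonneg.2 hab)] at h2
  simpa using h2

end AbsolutelyContinuous

namespace WeightedFields

/-! ### Regularized canonical coordinates near the base point. -/

section Charts

variable {n p r : ℕ} {X : Fin (n + 1) → EuclideanSpace ℝ (Fin p) → EuclideanSpace ℝ (Fin p)}
  {B : Finset (List (Fin (n + 1)))} {x₀ y : EuclideanSpace ℝ (Fin p)}

/-- Canonical coordinates for the commutators of the Taylor polynomials of jets near the jet of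
`X` at `x₀`. -/
structure IsCanonicalChart
    (X : Fin (n + 1) → EuclideanSpace ℝ (Fin p) → EuclideanSpace ℝ (Fin p)) (r : ℕ)
    (B : Finset (List (Fin (n + 1)))) (x₀ : EuclideanSpace ℝ (Fin p)) (ε K : ℝ)
    (e : OpenPartialHomeomorph (JetSpace n p r × (B → ℝ))
      (JetSpace n p r × EuclideanSpace ℝ (Fin p)))
    (f : B → JetSpace n p r × EuclideanSpace ℝ (Fin p) → ℝ) : Prop where
  pos : 0 < ε
  nonneg : 0 ≤ K
  subset_source : Metric.ball (jet X r x₀) ε ×ˢ Metric.ball 0 ε ⊆ e.source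
  apply_fst : ∀ q, (e q).1 = q.1
  apply_center : e (jet X r x₀, 0) = (jet X r x₀, 0)
  contDiffOn : ContDiffOn ℝ ∞ e e.source
  contDiffOn_symm : ContDiffOn ℝ ∞ e.symm e.target
  contDiff_coord : ∀ J, ContDiff ℝ ∞ (f J)
  exists_curve : ∀ j ∈ Metric.ball (jet X r x₀) ε, ∀ u ∈ Metric.ball (0 : B → ℝ) ε,
    ∃ γ : ℝ → EuclideanSpace ℝ (Fin p), γ 0 = 0 ∧
      IsIntegralCurveOn γ (fun _ w => ∑ I : B, u I • (fieldBracket (jetField n p r) I (j, w)).2)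
        (Icc 0 1) ∧
      ∀ s ∈ Icc (0 : ℝ) 1, e (j, s • u) = (j, γ s) ∧ ‖γ s‖ ≤ K * ‖u‖ ∧
        ∀ J, f J (j, γ s) = s * u J

theorem exists_isCanonicalChart
    (hX : ∀ i, ContDiffAt ℝ (r - fieldWeight i : ℕ) (X i) x₀) (hB : B ⊆ multiindices n r)
    (hB_indep : LinearIndependent ℝ (fun I : B => bracket X I x₀))
    (hB_span : Submodule.span ℝ (Set.range (fun I : B => bracket X I x₀)) = ⊤) :
    ∃ ε K e f, IsCanonicalChart X r B x₀ ε K e f := by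
  let A : (B → ℝ) ≃L[ℝ] EuclideanSpace ℝ (Fin p) :=
    (Module.Basis.mk hB_indep hB_span.ge).equivFun.symm.toContinuousLinearEquiv
  obtain ⟨ε, K, e, f, h1, h2, h3, h4, h5, h6, h7, h8, h9⟩ := exists_canonicalChart
    (V := fun (I : B) q => (fieldBracket (jetField n p r) I q).2)
    (fun I => contDiff_snd.comp (contDiff_fieldBracket (contDiff_jetField r) _)) (jet X r x₀) A
    (by
      intro u
      have h : ∀ I : B, (fieldBracket (jetField n p r) I (jet X r x₀, 0)).2 =
          bracket X I x₀ := by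
        intro I
        rw [← bracket_taylorField_self hX (hB I.2), bracket_taylorField, sub_self]
      simp_rw [h]
      change (Module.Basis.mk hB_indep hB_span.ge).equivFun.symm u = _
      rw [Module.Basis.equivFun_symm_apply]
      simp)
  exact ⟨ε, K, e, f, h1, h2, h3, h4, h5, h6, h7, h8, h9⟩

variable {ε K : ℝ} {e : OpenPartialHomeomorph (JetSpace n p r × (B → ℝ))
      (JetSpace n p r × EuclideanSpace ℝ (Fin p))}
    {f : B → JetSpace n p r × EuclideanSpace ℝ (Fin p) → ℝ}

/-- The curve of the chart with jet parameter `jet X r y`, translated by `y`. -/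
theorem IsCanonicalChart.exists_expCurve (h : IsCanonicalChart X r B x₀ ε K e f)
    (hy : jet X r y ∈ Metric.ball (jet X r x₀) ε) {u : B → ℝ} (hu : u ∈ Metric.ball 0 ε) :
    ∃ φ : ℝ → EuclideanSpace ℝ (Fin p), φ 0 = y ∧
      IsIntegralCurveOn φ (fun _ z => ∑ I : B, u I • bracket (taylorField X r y) I z) (Icc 0 1) ∧
      e (jet X r y, u) = (jet X r y, φ 1 - y) ∧ (∀ J, f J (jet X r y, φ 1 - y) = u J) ∧
      ∀ s ∈ Icc (0 : ℝ) 1, ‖φ s - y‖ ≤ K * ‖u‖ := by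
  obtain ⟨γ, h0, hI, hγ⟩ := h.exists_curve _ hy u hu
  obtain ⟨h1, -, h2⟩ := hγ 1 ⟨zero_le_one, le_rfl⟩
  refine ⟨fun t => y + γ t, by simp [h0], fun t ht => ?_, by simpa using h1, by simpa using h2,
    fun s hs => by simpa using (hγ s hs).2.1⟩
  have h3 := (hI t ht).const_add y
  simp_rw [bracket_taylorField]
  simpa using h3

/-- When `x` and `y` tend to `x₀`, the pair `(jet X r y, x - y)` tends to the center of the chart,
the jet being continuous at `x₀`. -/
theorem IsCanonicalChart.tendsto_symm (h : IsCanonicalChart X r B x₀ ε K e f)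
    (hX : ∀ i, ContDiffAt ℝ (r - fieldWeight i : ℕ) (X i) x₀) {U : Set (B → ℝ)} (hU : U ∈ 𝓝 0) :
    ∀ᶠ q : EuclideanSpace ℝ (Fin p) × EuclideanSpace ℝ (Fin p) in 𝓝 x₀ ×ˢ 𝓝 x₀,
      jet X r q.2 ∈ Metric.ball (jet X r x₀) ε ∧ (jet X r q.2, q.1 - q.2) ∈ e.target ∧
      (e.symm (jet X r q.2, q.1 - q.2)).2 ∈ U := by
  have hs : (jet X r x₀, (0 : B → ℝ)) ∈ e.source :=
    h.subset_source ⟨Metric.mem_ball_self h.pos, Metric.mem_ball_self h.pos⟩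
  have ht : (jet X r x₀, (0 : EuclideanSpace ℝ (Fin p))) ∈ e.target := by
    rw [← h.apply_center]; exact e.map_source hs
  have h1 : Tendsto (fun q : EuclideanSpace ℝ (Fin p) × EuclideanSpace ℝ (Fin p) =>
      (jet X r q.2, q.1 - q.2)) (𝓝 x₀ ×ˢ 𝓝 x₀) (𝓝 (jet X r x₀, 0)) := by
    refine ((continuousAt_jet hX).tendsto.comp tendsto_snd).prodMk_nhds ?_
    have := (tendsto_fst (f := 𝓝 x₀) (g := 𝓝 x₀)).sub (tendsto_snd (f := 𝓝 x₀) (g := 𝓝 x₀))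
    rwa [sub_self] at this
  have h2 : Tendsto (fun q => (e.symm q).2) (𝓝 (jet X r x₀, 0)) (𝓝 0) := by
    have h3 := (continuous_snd.tendsto _).comp (e.symm.continuousAt ht)
    have h4 : e.symm (jet X r x₀, 0) = (jet X r x₀, 0) := by
      conv_lhs => rw [← h.apply_center]
      exact e.left_inv hs
    rwa [h4] at h3
  filter_upwards [((continuousAt_jet hX).tendsto.comp tendsto_snd).eventually
    (Metric.ball_mem_nhds _ h.pos), h1.eventually (e.open_target.mem_nhds ht),
    (h2.comp h1).eventually hU] with q h3 h4 h5 using ⟨h3, h4, h5⟩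

theorem IsCanonicalChart.apply_symm_snd (h : IsCanonicalChart X r B x₀ ε K e f)
    {j : JetSpace n p r} {w : EuclideanSpace ℝ (Fin p)} (hw : (j, w) ∈ e.target) :
    e (j, (e.symm (j, w)).2) = (j, w) := by
  have h1 := e.right_inv hw
  have h2 := h.apply_fst (e.symm (j, w))
  rw [h1] at h2
  have h3 : e.symm (j, w) = (j, (e.symm (j, w)).2) := Prod.ext h2.symm rfl
  rw [← h3, h1]

/-- The local inverse of the regularized exponential map with a given center. -/
theorem IsCanonicalChart.exists_inverse (h : IsCanonicalChart X r B x₀ ε K e f)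
    (hy : jet X r y ∈ Metric.ball (jet X r x₀) ε) :
    ∃ θ : OpenPartialHomeomorph (EuclideanSpace ℝ (Fin p)) (B → ℝ),
      θ.target = Metric.ball 0 ε ∧
      (∀ x, (jet X r y, x - y) ∈ e.target → (e.symm (jet X r y, x - y)).2 ∈ Metric.ball 0 ε →
        x ∈ θ.source) ∧
      ContDiffOn ℝ ∞ θ θ.source ∧ ContDiffOn ℝ ∞ θ.symm (Metric.ball 0 ε) ∧
      ∀ u, θ.symm u = y + (e (jet X r y, u)).2 := by
  have hsrc : ∀ u ∈ Metric.ball (0 : B → ℝ) ε, (jet X r y, u) ∈ e.source := fun u hu =>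
    h.subset_source ⟨hy, hu⟩
  have he : ∀ u, e (jet X r y, u) = (jet X r y, (e (jet X r y, u)).2) := fun u =>
    Prod.ext (h.apply_fst _) rfl
  have ha : ContDiff ℝ ∞ fun x : EuclideanSpace ℝ (Fin p) => (jet X r y, x - y) :=
    contDiff_const.prodMk (contDiff_id.sub contDiff_const)
  have hb : ContDiff ℝ ∞ fun u : B → ℝ => (jet X r y, u) := contDiff_const.prodMk contDiff_id
  have c1 : ContDiffOn ℝ ∞ (fun x => (e.symm (jet X r y, x - y)).2)
      {x | (jet X r y, x - y) ∈ e.target} :=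
    contDiff_snd.comp_contDiffOn (h.contDiffOn_symm.comp ha.contDiffOn fun x hx => hx)
  have c2 : ContDiffOn ℝ ∞ (fun u => y + (e (jet X r y, u)).2) (Metric.ball 0 ε) :=
    contDiffOn_const.add (contDiff_snd.comp_contDiffOn (h.contDiffOn.comp hb.contDiffOn hsrc))
  let θ : OpenPartialHomeomorph (EuclideanSpace ℝ (Fin p)) (B → ℝ) :=
    { toFun := fun x => (e.symm (jet X r y, x - y)).2
      invFun := fun u => y + (e (jet X r y, u)).2
      source := {x | (jet X r y, x - y) ∈ e.target} ∩
        (fun x => (e.symm (jet X r y, x - y)).2) ⁻¹' Metric.ball 0 ε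
      target := Metric.ball 0 ε
      map_source' := fun x hx => hx.2
      map_target' := fun u hu => by
        have h1 : (jet X r y, (e (jet X r y, u)).2) ∈ e.target := by
          rw [← he]; exact e.map_source (hsrc u hu)
        refine ⟨by simpa using h1, ?_⟩
        simp only [mem_preimage, add_sub_cancel_left]
        rw [← he, e.left_inv (hsrc u hu)]
        exact hu
      left_inv' := fun x hx => by
        rw [h.apply_symm_snd hx.1]
        simp
      right_inv' := fun u hu => by
        simp only [add_sub_cancel_left]
        rw [← he, e.left_inv (hsrc u hu)]
      open_source := c1.continuousOn.isOpen_inter_preimage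
        (e.open_target.preimage ha.continuous) Metric.isOpen_ball
      open_target := Metric.isOpen_ball
      continuousOn_toFun := c1.continuousOn.mono inter_subset_left
      continuousOn_invFun := c2.continuousOn }
  exact ⟨θ, rfl, fun x h1 h2 => ⟨h1, h2⟩, c1.mono inter_subset_left, c2, fun u => rfl⟩

theorem IsCanonicalChart.exists_thetaMap (h : IsCanonicalChart X r B x₀ ε K e f)
    (hX : ∀ i, ContDiffAt ℝ (r - fieldWeight i : ℕ) (X i) x₀) {Ω : Set (EuclideanSpace ℝ (Fin p))}
    (hΩ : Ω ∈ 𝓝 x₀) :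
    ∃ (W : Set (EuclideanSpace ℝ (Fin p))) (Θ : EuclideanSpace ℝ (Fin p) →
        OpenPartialHomeomorph (EuclideanSpace ℝ (Fin p)) (B → ℝ)),
      W ∈ 𝓝 x₀ ∧ W ⊆ Ω ∧ IsThetaMap X r B (Metric.ball 0 ε) W Θ := by
  classical
  obtain ⟨W, hW, hWe⟩ := eventually_prod_self_iff'.1
    (h.tendsto_symm hX (Metric.ball_mem_nhds 0 h.pos))
  have hx₀ := Metric.mem_ball_self (x := jet X r x₀) h.pos
  choose θ h1 h2 h3 h4 h5 using fun y (hy : jet X r y ∈ Metric.ball (jet X r x₀) ε) =>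
    h.exists_inverse hy
  -- The value for jets outside the ball is arbitrary: it is not taken at any `y ∈ W`.
  refine ⟨W ∩ Ω, fun y => if hy : jet X r y ∈ Metric.ball (jet X r x₀) ε then θ y hy else
    θ x₀ hx₀, inter_mem hW hΩ, inter_subset_right, Metric.mem_ball_self h.pos, fun y hy => ?_⟩
  have hj : jet X r y ∈ Metric.ball (jet X r x₀) ε := (hWe y hy.1 y hy.1).1
  simp only [dif_pos hj]
  refine ⟨h1 y hj, fun x hx => ?_, h3 y hj, h4 y hj, fun u hu => ?_⟩
  · obtain ⟨-, h6, h7⟩ := hWe x hx.1 y hy.1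
    exact h2 y hj x h6 h7
  · obtain ⟨φ, h6, h7, h8, -, -⟩ := h.exists_expCurve hj hu
    refine ⟨φ, h6, ?_, h7⟩
    rw [h5, h8, add_sub_cancel]

/-- Any map of regularized canonical coordinates is given by the canonical chart near `x₀`. -/
theorem IsCanonicalChart.eventually_theta_eq (h : IsCanonicalChart X r B x₀ ε K e f)
    (hX : ∀ i, ContDiffAt ℝ (r - fieldWeight i : ℕ) (X i) x₀) {U : Set (B → ℝ)}
    {W : Set (EuclideanSpace ℝ (Fin p))} {Θ : EuclideanSpace ℝ (Fin p) →
        OpenPartialHomeomorph (EuclideanSpace ℝ (Fin p)) (B → ℝ)} (hW : W ∈ 𝓝 x₀)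
    (hΘ : IsThetaMap X r B U W Θ) {η : ℝ} (hη : 0 < η) :
    ∀ᶠ q : EuclideanSpace ℝ (Fin p) × EuclideanSpace ℝ (Fin p) in 𝓝 x₀ ×ˢ 𝓝 x₀,
      jet X r q.2 ∈ Metric.ball (jet X r x₀) ε ∧ Θ q.2 q.1 ∈ Metric.ball 0 ε ∧
      Θ q.2 q.1 ∈ Metric.ball 0 η ∧
      e (jet X r q.2, Θ q.2 q.1) = (jet X r q.2, q.1 - q.2) := by
  -- `U` is open because it is the target of `Θ x₀`.
  have hU : U ∈ 𝓝 (0 : B → ℝ) := by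
    have h1 := (hΘ.2 x₀ (mem_of_mem_nhds hW)).1
    rw [← h1]
    exact (Θ x₀).open_target.mem_nhds (h1 ▸ hΘ.1)
  filter_upwards [h.tendsto_symm hX (inter_mem hU (inter_mem (Metric.ball_mem_nhds 0 h.pos)
    (Metric.ball_mem_nhds 0 hη))), tendsto_snd.eventually hW] with q h1 h2
  obtain ⟨hj, ht, hu, huε, huη⟩ := h1
  have h3 := h.apply_symm_snd ht
  set u := (e.symm (jet X r q.2, q.1 - q.2)).2
  obtain ⟨φ, h4, h5, h6, -⟩ := h.exists_expCurve hj huε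
  have h7 : φ 1 = q.1 := by
    rw [h3] at h6
    exact sub_left_injective (congrArg Prod.snd h6).symm
  obtain ⟨h8, -, -, -, h9⟩ := hΘ.2 q.2 h2
  obtain ⟨γ, h10, h11, h12⟩ := h9 u hu
  have hV : ContDiff ℝ 1 fun z => ∑ I : B, u I • bracket (taylorField X r q.2) I z := by
    refine ContDiff.sum fun I _ => ContDiff.const_smul _ ?_
    rw [bracket_eq_fieldBracket]
    exact (contDiff_fieldBracket (contDiff_taylorField r q.2) _).of_le (by simp)
  -- The curve of the chart and the one that defines `(Θ y).symm u` solve the same equation from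
  -- `y`, so both end at `x`.
  have h13 := IsIntegralCurveOn.eqOn_of_contDiff hV h5 h12 (h4.trans h10.symm)
    (right_mem_Icc.2 zero_le_one)
  have h14 : Θ q.2 q.1 = u := by
    rw [← h7, h13, h11]
    exact (Θ q.2).right_inv (h8 ▸ hu)
  rw [h14]
  exact ⟨hj, huε, huη, h3⟩

end Charts

end WeightedFields

/-- The coefficients with respect to a basis that depends continuously on a parameter are locally
bounded. -/
theorem exists_coefficients_bound {ι S F : Type*} [Fintype ι] [TopologicalSpace S]
    [NormedAddCommGroup F] [NormedSpace ℝ F] [FiniteDimensional ℝ F] {b : ι → S → F} {x₀ : S}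
    (hb : ∀ i, ContinuousAt (b i) x₀) (hli : LinearIndependent ℝ (fun i => b i x₀))
    (hsp : Submodule.span ℝ (Set.range (fun i => b i x₀)) = ⊤) :
    ∃ C : ℝ, 0 ≤ C ∧ ∀ᶠ z in 𝓝 x₀, ∀ v : F, ∃ c : ι → ℝ, ∑ i, c i • b i z = v ∧
      ∀ i, |c i| ≤ C * ‖v‖ := by
  let A : S → ((ι → ℝ) →L[ℝ] F) := fun z =>
    ∑ i, (ContinuousLinearMap.proj (R := ℝ) (φ := fun _ : ι => ℝ) i).smulRight (b i z)
  have hA : ∀ z c, A z c = ∑ i, c i • b i z := by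
    intro z c
    simp [A]
  have hAc : ContinuousAt A x₀ := by
    refine tendsto_finsetSum _ fun i _ => ?_
    exact ((ContinuousLinearMap.smulRightL ℝ (ι → ℝ) F
      (ContinuousLinearMap.proj (R := ℝ) (φ := fun _ : ι => ℝ) i)).continuous.tendsto _).comp
      (hb i)
  let e : (ι → ℝ) ≃L[ℝ] F := (Module.Basis.mk hli hsp.ge).equivFun.symm.toContinuousLinearEquiv
  have he : A x₀ = e := by
    ext c
    rw [hA]
    change _ = (Module.Basis.mk hli hsp.ge).equivFun.symm c
    rw [Module.Basis.equivFun_symm_apply]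
    simp
  -- Invertible maps form an open set on which inversion is continuous, so near `x₀` the inverse has
  -- norm below its value at `x₀` plus one.
  have h1 : ∀ᶠ z in 𝓝 x₀, A z ∈ range ((↑) : ((ι → ℝ) ≃L[ℝ] F) → ((ι → ℝ) →L[ℝ] F)) :=
    hAc.eventually (by rw [he]; exact ContinuousLinearEquiv.nhds e)
  have h2 : ContinuousAt (fun z => ‖ContinuousLinearMap.inverse (A z)‖) x₀ := by
    have h3 : ContinuousAt ContinuousLinearMap.inverse (A x₀) := by
      rw [he]; exact (contDiffAt_map_inverse (n := 0) e).continuousAt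
    exact (ContinuousAt.comp h3 hAc).norm
  refine ⟨‖ContinuousLinearMap.inverse (A x₀)‖ + 1, by positivity, ?_⟩
  filter_upwards [h1, h2.eventually (gt_mem_nhds (lt_add_one _))] with z ⟨e', he'⟩ h3 v
  refine ⟨e'.symm v, ?_, fun i => ?_⟩
  · rw [← hA, ← he']; simp
  · rw [← he', ContinuousLinearMap.inverse_equiv] at h3
    calc |e'.symm v i| ≤ ‖e'.symm v‖ := norm_le_pi_norm (e'.symm v) i
      _ ≤ ‖(e'.symm : F →L[ℝ] (ι → ℝ))‖ * ‖v‖ := (e'.symm : F →L[ℝ] (ι → ℝ)).le_opNorm v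
      _ ≤ _ := by gcongr

namespace WeightedFields

/-! ### Elementary bounds for the homogeneous norm. -/

section HomNorm

variable {n : ℕ} {B : Finset (List (Fin (n + 1)))}

theorem homNorm_nonneg (u : B → ℝ) : 0 ≤ homNorm u :=
  Finset.sum_nonneg fun _ _ => Real.rpow_nonneg (abs_nonneg _) _

theorem abs_le_homNorm_pow (u : B → ℝ) (J : B) (hJ : weight (J : List (Fin (n + 1))) ≠ 0) :
    |u J| ≤ homNorm u ^ weight (J : List (Fin (n + 1))) := by
  have h1 : |u J| ^ (1 / (weight (J : List (Fin (n + 1))) : ℝ)) ≤ homNorm u :=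
    Finset.single_le_sum (f := fun J : B => |u J| ^ (1 / (weight (J : List (Fin (n + 1))) : ℝ)))
      (fun _ _ => Real.rpow_nonneg (abs_nonneg _) _) (Finset.mem_univ J)
  rw [one_div] at h1
  rw [← Real.rpow_inv_natCast_pow (abs_nonneg (u J)) hJ]
  exact pow_le_pow_left₀ (Real.rpow_nonneg (abs_nonneg _) _) h1 _

theorem norm_le_homNorm (hB : ∀ J ∈ B, weight J ≠ 0) {u : B → ℝ} (hu : ‖u‖ ≤ 1) :
    ‖u‖ ≤ homNorm u := by
  rcases le_total 1 (homNorm u) with h | h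
  · exact hu.trans h
  · refine (pi_norm_le_iff_of_nonneg (homNorm_nonneg u)).2 fun J => ?_
    exact (abs_le_homNorm_pow u J (hB J J.2)).trans
      (pow_le_of_le_one (homNorm_nonneg u) h (hB J J.2))

theorem homNorm_le_card {u : B → ℝ} (hu : ‖u‖ ≤ 1) : homNorm u ≤ Fintype.card B := by
  have h : ∀ J ∈ Finset.univ, |u J| ^ (1 / (weight (J : List (Fin (n + 1))) : ℝ)) ≤ 1 :=
    fun J _ => Real.rpow_le_one (abs_nonneg _) ((norm_le_pi_norm u J).trans hu) (by positivity)
  exact (Finset.sum_le_sum h).trans_eq (by simp)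

theorem homNorm_le_of_abs_le (hB : ∀ J ∈ B, weight J ≠ 0) {u : B → ℝ} {t : ℝ} (ht : 0 ≤ t)
    (hu : ∀ J : B, |u J| ≤ t ^ weight (J : List (Fin (n + 1)))) :
    homNorm u ≤ Fintype.card B * t := by
  have h : ∀ J ∈ Finset.univ, |u J| ^ (1 / (weight (J : List (Fin (n + 1))) : ℝ)) ≤ t := by
    intro J _
    rw [one_div, ← Real.pow_rpow_inv_natCast ht (hB J J.2)]
    exact Real.rpow_le_rpow (abs_nonneg _) (hu J) (by positivity)
  exact (Finset.sum_le_sum h).trans_eq (by simp)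

end HomNorm

/-! ### The control distance is at most a multiple of the quasidistance. -/

section UpperBound

variable {n p r : ℕ} {X : Fin (n + 1) → EuclideanSpace ℝ (Fin p) → EuclideanSpace ℝ (Fin p)}
  {B : Finset (List (Fin (n + 1)))} {x₀ : EuclideanSpace ℝ (Fin p)}
  {ε K : ℝ} {e : OpenPartialHomeomorph (JetSpace n p r × (B → ℝ))
      (JetSpace n p r × EuclideanSpace ℝ (Fin p))}
  {f : B → JetSpace n p r × EuclideanSpace ℝ (Fin p) → ℝ}

theorem weight_ne_zero {I : List (Fin (n + 1))} (hI : I ∈ multiindices n r) : weight I ≠ 0 := by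
  have h1 := List.length_pos_iff.2 (mem_multiindices.1 hI).1
  have h2 := length_le_weight I
  omega

theorem sum_extend_smul {F : Type*} [AddCommGroup F] [Module ℝ F] (hB : B ⊆ multiindices n r)
    (c : B → ℝ) (v : List (Fin (n + 1)) → F) :
    ∑ I ∈ multiindices n r, (if h : I ∈ B then c ⟨I, h⟩ else 0) • v I = ∑ I : B, c I • v I := by
  rw [← Finset.sum_subset hB fun I _ hI => by rw [dif_neg hI, zero_smul],
    ← Finset.sum_coe_sort B]
  exact Finset.sum_congr rfl fun I _ => by rw [dif_pos I.2]

theorem absolutelyContinuousOnInterval_of_integralCurve {F : Type*} [NormedAddCommGroup F]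
    [NormedSpace ℝ F] {φ : ℝ → F} {V : F → F} (hV : Continuous V)
    (hφ : IsIntegralCurveOn φ (fun _ => V) (Icc 0 1)) :
    AbsolutelyContinuousOnInterval φ 0 1 := by
  have hc : ContinuousOn φ (Icc 0 1) := fun t ht => (hφ t ht).continuousWithinAt
  obtain ⟨C, hC⟩ := isCompact_Icc.exists_bound_of_continuousOn (hV.comp_continuousOn hc)
  have h : LipschitzOnWith C.toNNReal φ (Icc 0 1) :=
    (convex_Icc (0 : ℝ) 1).lipschitzOnWith_of_nnnorm_hasDerivWithin_le (fun t ht => hφ t ht)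
      fun t ht => by
        rw [← NNReal.coe_le_coe, coe_nnnorm]
        exact (hC t ht).trans (Real.le_coe_toNNReal C)
  rw [← uIcc_of_le zero_le_one] at h
  exact h.absolutelyContinuousOnInterval

/-- The error `∑ u_I (X_[I] - S_[I])` has terms of size `δ ^ |I| * δ ^ (r - |I|) = δ ^ r` up to
constants; its coefficients in the local basis are of the same size, and since `δ` is bounded they
are `O(δ ^ |I|)` as well. So the velocity of the exponential curve is a combination of the `X_[I]`
with admissible coefficients. -/
theorem exists_local_coefficients {Ω : Set (EuclideanSpace ℝ (Fin p))} (hΩ : IsOpen Ω)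
    (hx₀ : x₀ ∈ Ω)
    (hX : ∀ i, ContDiffOn ℝ (r - fieldWeight i : ℕ) (X i) Ω)
    (hXb : ∀ i, ∀ k ≤ r - fieldWeight i, ∃ C : ℝ, ∀ z ∈ Ω, ‖iteratedFDeriv ℝ k (X i) z‖ ≤ C)
    (hB : B ⊆ multiindices n r) (hB_indep : LinearIndependent ℝ (fun I : B => bracket X I x₀))
    (hB_span : Submodule.span ℝ (Set.range (fun I : B => bracket X I x₀)) = ⊤)
    (K : ℝ) :
    ∃ C : ℝ, 1 ≤ C ∧ ∃ R : ℝ, 0 < R ∧ Metric.ball x₀ R ⊆ Ω ∧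
      ∀ y ∈ Metric.ball x₀ R, ∀ z ∈ Metric.ball x₀ R, ∀ u : B → ℝ, ∀ δ : ℝ, ‖u‖ ≤ 1 →
        homNorm u ≤ δ → δ ≤ Fintype.card B + 1 → ‖z - y‖ ≤ K * ‖u‖ →
        ∃ c : B → ℝ, ∑ I : B, c I • bracket X I z =
            -∑ I : B, u I • bracket (taylorField X r y) I z ∧
          ∀ I : B, |c I| ≤ (C * δ) ^ weight (I : List (Fin (n + 1))) := by
  obtain ⟨R₁, hR₁, hR₁Ω⟩ := Metric.isOpen_iff.1 hΩ x₀ hx₀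
  obtain ⟨C₀, hC₀, hrem⟩ := exists_norm_bracket_sub_le Metric.isOpen_ball Metric.isBounded_ball
    (convex_ball x₀ R₁) (fun i => (hX i).mono hR₁Ω)
    (fun i k hk => (hXb i k hk).imp fun C hC z hz => hC z (hR₁Ω hz))
  have hXc : ∀ i, ContDiffAt ℝ (r - fieldWeight i : ℕ) (X i) x₀ :=
    fun i => (hX i).contDiffAt (hΩ.mem_nhds hx₀)
  obtain ⟨C₁, hC₁, hcoef⟩ := exists_coefficients_bound (b := fun I : B => bracket X I)
    (fun I => (contDiffAt_bracket hXc I (mem_multiindices.1 (hB I.2)).1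
      (mem_multiindices.1 (hB I.2)).2).continuousAt) hB_indep hB_span
  obtain ⟨R₂, hR₂, hR₂c⟩ := Metric.eventually_nhds_iff_ball.1 hcoef
  have hRR₁ : Metric.ball x₀ (min R₁ R₂) ⊆ Metric.ball x₀ R₁ :=
    Metric.ball_subset_ball (min_le_left _ _)
  set N : ℝ := (Fintype.card B : ℝ) with hN
  have hN0 : 0 ≤ N := Nat.cast_nonneg _
  -- Factors of `L`: the bound for coefficients in the basis, the Taylor error summed over `B`, and
  -- a bound for `δ ^ (r - |I|)` from `δ ≤ N + 1`.
  set L := C₁ * (N * (C₀ * max 1 K ^ r)) * (N + 1) ^ r with hL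
  have hK1 : 1 ≤ max 1 K := le_max_left _ _
  have hL0 : 0 ≤ L := by positivity
  refine ⟨1 + L, by linarith, min R₁ R₂, lt_min hR₁ hR₂, hRR₁.trans hR₁Ω, ?_⟩
  intro y hy z hz u δ hu hδ hδN hzy
  have hδ0 : 0 ≤ δ := (homNorm_nonneg u).trans hδ
  have hw : ∀ I : B, weight (I : List (Fin (n + 1))) ≤ r := fun I => (mem_multiindices.1 (hB I.2)).2
  have hw0 : ∀ J ∈ B, weight J ≠ 0 := fun J hJ => weight_ne_zero (hB hJ)
  have huI : ∀ I : B, |u I| ≤ δ ^ weight (I : List (Fin (n + 1))) := fun I =>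
    (abs_le_homNorm_pow u I (hw0 I I.2)).trans (pow_le_pow_left₀ (homNorm_nonneg u) hδ _)
  have hzy' : ‖z - y‖ ≤ max 1 K * δ := by
    refine hzy.trans (mul_le_mul (le_max_right _ _) ((norm_le_homNorm hw0 hu).trans hδ)
      (norm_nonneg _) (by positivity))
  set v := ∑ I : B, u I • (bracket X I z - bracket (taylorField X r y) I z) with hv
  have hvn : ‖v‖ ≤ N * (C₀ * max 1 K ^ r) * δ ^ r := by
    have h1 : ∀ I ∈ Finset.univ, ‖u I • (bracket X I z - bracket (taylorField X r y) I z)‖ ≤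
        C₀ * max 1 K ^ r * δ ^ r := by
      intro I _
      rw [norm_smul, Real.norm_eq_abs]
      have h2 := (hrem I (hB I.2) y (hRR₁ hy) z (hRR₁ hz)).2
      calc _ ≤ δ ^ weight (I : List (Fin (n + 1))) *
            (C₀ * (max 1 K * δ) ^ (r - weight (I : List (Fin (n + 1))))) := by
            gcongr
            · exact huI I
            · exact h2.trans (by gcongr)
        _ = C₀ * max 1 K ^ (r - weight (I : List (Fin (n + 1)))) *
            (δ ^ weight (I : List (Fin (n + 1))) * δ ^ (r - weight (I : List (Fin (n + 1))))) := by
            rw [mul_pow]; ring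
        _ = C₀ * max 1 K ^ (r - weight (I : List (Fin (n + 1)))) * δ ^ r := by
            rw [← pow_add, Nat.add_sub_cancel' (hw I)]
        _ ≤ _ := by gcongr; exact Nat.sub_le _ _
    refine (norm_sum_le _ _).trans ((Finset.sum_le_sum h1).trans ?_)
    rw [Finset.sum_const, Finset.card_univ, nsmul_eq_mul]
    exact le_of_eq (by ring)
  obtain ⟨c, hc, hcb⟩ := hR₂c z (Metric.ball_subset_ball (min_le_right _ _) hz) v
  refine ⟨fun I => c I - u I, ?_, fun I => ?_⟩
  · simp_rw [sub_smul, Finset.sum_sub_distrib]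
    rw [hc, hv]
    simp_rw [smul_sub, Finset.sum_sub_distrib]
    abel
  · have h1 : |c I| ≤ L * δ ^ weight (I : List (Fin (n + 1))) := by
      calc |c I| ≤ C₁ * (N * (C₀ * max 1 K ^ r) * δ ^ r) := (hcb I).trans (by gcongr)
        _ = C₁ * (N * (C₀ * max 1 K ^ r)) * (δ ^ (r - weight (I : List (Fin (n + 1)))) *
            δ ^ weight (I : List (Fin (n + 1)))) := by
            rw [← pow_add, Nat.sub_add_cancel (hw I)]; ring
        _ ≤ C₁ * (N * (C₀ * max 1 K ^ r)) * ((N + 1) ^ r *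
            δ ^ weight (I : List (Fin (n + 1)))) := by
            gcongr
            calc δ ^ (r - weight (I : List (Fin (n + 1)))) ≤
                  (N + 1) ^ (r - weight (I : List (Fin (n + 1)))) := by gcongr
              _ ≤ (N + 1) ^ r := pow_le_pow_right₀ (by linarith) (Nat.sub_le _ _)
        _ = _ := by rw [hL]; ring
    calc |c I - u I| ≤ |c I| + |u I| := abs_sub _ _
      _ ≤ (1 + L) * δ ^ weight (I : List (Fin (n + 1))) := by linarith [huI I]
      _ ≤ (1 + L) ^ weight (I : List (Fin (n + 1))) * δ ^ weight (I : List (Fin (n + 1))) := by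
        gcongr
        exact le_self_pow₀ (by linarith) (hw0 I I.2)
      _ = _ := (mul_pow _ _ _).symm

/-- The control distance is bounded by the homogeneous norm of the canonical coordinates. -/
theorem IsCanonicalChart.controlDist_le (h : IsCanonicalChart X r B x₀ ε K e f)
    {Ω : Set (EuclideanSpace ℝ (Fin p))} (hΩ : IsOpen Ω) (hx₀ : x₀ ∈ Ω)
    (hX : ∀ i, ContDiffOn ℝ (r - fieldWeight i : ℕ) (X i) Ω)
    (hXb : ∀ i, ∀ k ≤ r - fieldWeight i, ∃ C : ℝ, ∀ z ∈ Ω, ‖iteratedFDeriv ℝ k (X i) z‖ ≤ C)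
    (hB : B ⊆ multiindices n r) (hB_indep : LinearIndependent ℝ (fun I : B => bracket X I x₀))
    (hB_span : Submodule.span ℝ (Set.range (fun I : B => bracket X I x₀)) = ⊤) :
    ∃ C : ℝ, 0 < C ∧ ∃ η : ℝ, 0 < η ∧ ∀ x, ∀ y ∈ Metric.ball x₀ η,
      ∀ u ∈ Metric.ball (0 : B → ℝ) η, jet X r y ∈ Metric.ball (jet X r x₀) ε →
      u ∈ Metric.ball 0 ε → e (jet X r y, u) = (jet X r y, x - y) →
      controlDist X r Ω x y ≤ ENNReal.ofReal (C * homNorm u) := by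
  obtain ⟨C, hC, R, hR, hRΩ, hcoef⟩ :=
    exists_local_coefficients hΩ hx₀ hX hXb hB hB_indep hB_span K
  have hK := h.nonneg
  -- With this radius `y` is within `R / 2` of `x₀` and the curve within `R / 2` of `y`.
  refine ⟨C, by linarith, min 1 (R / (2 * (K + 1))), by positivity, ?_⟩
  intro x y hy u hu hj huε he
  rw [mem_ball_zero_iff, lt_min_iff, lt_div_iff₀ (by positivity)] at hu
  rw [Metric.mem_ball, lt_min_iff, lt_div_iff₀ (by positivity)] at hy
  have hyR : dist y x₀ < R / 2 := by nlinarith [dist_nonneg (x := y) (y := x₀), hy.2]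
  obtain ⟨ψ, hψ0, hψ, hψ1, -, hψK⟩ := h.exists_expCurve hj huε
  have hψ1 : ψ 1 = x := by
    rw [he] at hψ1
    exact sub_left_injective (congrArg Prod.snd hψ1).symm
  have hball : ∀ t ∈ Icc (0 : ℝ) 1, ψ t ∈ Metric.ball x₀ R := by
    intro t ht
    have h1 := hψK t ht
    rw [← dist_eq_norm] at h1
    rw [Metric.mem_ball]
    nlinarith [dist_triangle (ψ t) y x₀, hu.2, norm_nonneg u]
  have hV : Continuous fun z => -∑ I : B, u I • bracket (taylorField X r y) I z := by
    have hb : ∀ I : B, Continuous (bracket (taylorField X r y) I) := fun I => by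
      rw [bracket_eq_fieldBracket]
      exact (contDiff_fieldBracket (contDiff_taylorField r y) _).continuous
    fun_prop
  have hm : MapsTo (fun t : ℝ => 1 - t) (Icc 0 1) (Icc 0 1) := fun t ht =>
    ⟨by linarith [ht.2], by linarith [ht.1]⟩
  -- The exponential curve runs from `y` to `x`, an admissible curve from `x` to `y`: time is
  -- reversed, whence the minus sign.
  have hφ : IsIntegralCurveOn (fun t => ψ (1 - t))
      (fun _ z => -∑ I : B, u I • bracket (taylorField X r y) I z) (Icc 0 1) := by
    intro t ht
    have h1 := (hψ (1 - t) (hm ht)).scomp t ((hasDerivAt_id t).const_sub 1).hasDerivWithinAt hm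
    convert h1 using 1
    · ext t; simp
    · simp
  -- The homogeneous norm may be zero while admissibility is used with positive `δ`, so `δ` is taken
  -- larger and then decreases to `homNorm u`.
  have hadm : ∀ δ ∈ Ioc (homNorm u) (homNorm u + 1),
      controlDist X r Ω x y ≤ ENNReal.ofReal (C * δ) := by
    intro δ hδ
    have hδ0 : 0 < δ := (homNorm_nonneg u).trans_lt hδ.1
    refine sInf_le ⟨C * δ, by positivity, ⟨fun t => ψ (1 - t),
      absolutelyContinuousOnInterval_of_integralCurve hV hφ, fun t ht => hRΩ (hball _ (hm ht)),
      by simpa using hψ1, by simpa using hψ0, ?_⟩, rfl⟩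
    have hc : ∀ t : ℝ, ∃ c : B → ℝ, t ∈ Icc (0 : ℝ) 1 →
        ∑ I : B, c I • bracket X I (ψ (1 - t)) =
          -∑ I : B, u I • bracket (taylorField X r y) I (ψ (1 - t)) ∧
        ∀ I : B, |c I| ≤ (C * δ) ^ weight (I : List (Fin (n + 1))) := by
      intro t
      by_cases ht : t ∈ Icc (0 : ℝ) 1
      · obtain ⟨c, hc⟩ := hcoef y (by rw [Metric.mem_ball]; linarith) _ (hball _ (hm ht)) u δ hu.1.le
          hδ.1.le (hδ.2.trans (by linarith [homNorm_le_card hu.1.le])) (hψK _ (hm ht))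
        exact ⟨c, fun _ => hc⟩
      · exact ⟨0, fun h => absurd h ht⟩
    choose c hc using hc
    refine ⟨fun I t => if hI : I ∈ B then c t ⟨I, hI⟩ else 0, ?_⟩
    -- At the endpoints the integral curve has only a one-sided derivative; they form a null set.
    rw [← restrict_Ioo_eq_restrict_Icc]
    filter_upwards [ae_restrict_mem measurableSet_Ioo] with t ht
    obtain ⟨h1, h2⟩ := hc t (Ioo_subset_Icc_self ht)
    refine ⟨fun I _ => ?_, ?_⟩
    · split_ifs with hI
      · exact h2 ⟨I, hI⟩
      · rw [abs_zero]; positivity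
    · rw [sum_extend_smul hB, h1]
      exact (hφ t (Ioo_subset_Icc_self ht)).hasDerivAt (Icc_mem_nhds ht.1 ht.2)
  have hlim : Tendsto (fun δ => ENNReal.ofReal (C * δ)) (𝓝[>] (homNorm u))
      (𝓝 (ENNReal.ofReal (C * homNorm u))) :=
    ((ENNReal.continuous_ofReal.comp (continuous_const.mul continuous_id)).tendsto
      (homNorm u)).mono_left nhdsWithin_le_nhds
  refine ge_of_tendsto hlim ?_
  filter_upwards [Ioc_mem_nhdsGT (lt_add_one (homNorm u))] with δ hδ using hadm δ hδ

end UpperBound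


/-! ### The quasidistance is at most a multiple of the control distance. -/

section LowerBound

variable {n p r : ℕ} {X : Fin (n + 1) → EuclideanSpace ℝ (Fin p) → EuclideanSpace ℝ (Fin p)}
  {B : Finset (List (Fin (n + 1)))} {x₀ : EuclideanSpace ℝ (Fin p)}
  {ε K : ℝ} {e : OpenPartialHomeomorph (JetSpace n p r × (B → ℝ))
      (JetSpace n p r × EuclideanSpace ℝ (Fin p))}
  {f : B → JetSpace n p r × EuclideanSpace ℝ (Fin p) → ℝ}

theorem norm_sum_smul_le {F ι : Type*} [NormedAddCommGroup F] [NormedSpace ℝ F] {s : Finset ι}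
    {a : ι → ℝ} {v : ι → F} {w : ι → ℕ} {δ C : ℝ} (hδ : 0 ≤ δ) (hδ1 : δ ≤ 1)
    (hw : ∀ I ∈ s, w I ≠ 0) (ha : ∀ I ∈ s, |a I| ≤ δ ^ w I) (hv : ∀ I ∈ s, ‖v I‖ ≤ C) :
    ‖∑ I ∈ s, a I • v I‖ ≤ s.card * C * δ := by
  refine (norm_sum_le _ _).trans ((Finset.sum_le_sum (g := fun _ => δ * C) fun I hI => ?_).trans
    (le_of_eq (by rw [Finset.sum_const, nsmul_eq_mul]; ring)))
  rw [norm_smul, Real.norm_eq_abs]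
  exact mul_le_mul ((ha I hI).trans (pow_le_of_le_one hδ hδ1 (hw I hI))) (hv I hI)
    (norm_nonneg _) hδ

/-- One step of the integration along an admissible curve: `v` stands for the `X_[I]`, `v'` for the
`S_[I]`, and `L` for the differential of a derivative of a coordinate. Each term gains `δ ^ w I`.
The truncated exponent `k - w I` is harmless because `δ ≤ 1`, and the Taylor error `δ ^ r` is
acceptable because `k ≤ r`. -/
theorem abs_apply_sum_smul_le {F ι : Type*} [NormedAddCommGroup F] [NormedSpace ℝ F]
    {s : Finset ι} {a : ι → ℝ} {v v' : ι → F} {w : ι → ℕ} {A : s → ℝ} {δ C C' M : ℝ} {k r : ℕ}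
    (L : F →L[ℝ] ℝ) (hδ : 0 ≤ δ) (hδ1 : δ ≤ 1) (hA : ∀ I, 0 ≤ A I) (hC : 0 ≤ C) (hC' : 0 ≤ C')
    (hM : 0 ≤ M) (hk : k ≤ r) (ha : ∀ I ∈ s, |a I| ≤ δ ^ w I)
    (hL : ∀ x, |L x| ≤ C' * ‖x‖) (hLv : ∀ I : s, |L (v' I)| ≤ A I * δ ^ (k - w I))
    (hv : ∀ I ∈ s, ‖v I - v' I‖ ≤ C * (M * δ) ^ (r - w I)) :
    |L (∑ I ∈ s, a I • v I)| ≤ (∑ I : s, (A I + C' * (C * M ^ (r - w I)))) * δ ^ k := by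
  rw [map_sum, ← Finset.sum_coe_sort, Finset.sum_mul]
  refine (Finset.abs_sum_le_sum_abs _ _).trans (Finset.sum_le_sum fun I _ => ?_)
  have h1 : L (v I) = L (v' I) + L (v I - v' I) := by rw [← map_add, add_sub_cancel]
  have h2 : |L (v I - v' I)| ≤ C' * (C * (M * δ) ^ (r - w I)) :=
    (hL _).trans (mul_le_mul_of_nonneg_left (hv I I.2) hC')
  have h3 : δ ^ w I * δ ^ (k - w I) ≤ δ ^ k := by
    rw [← pow_add]
    exact pow_le_pow_of_le_one hδ hδ1 (by omega)
  have h4 : δ ^ w I * δ ^ (r - w I) ≤ δ ^ k := by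
    rw [← pow_add]
    exact pow_le_pow_of_le_one hδ hδ1 (by omega)
  have hAI := hA I
  rw [map_smul, smul_eq_mul, abs_mul, h1]
  calc _ ≤ δ ^ w I * (A I * δ ^ (k - w I) + C' * (C * (M * δ) ^ (r - w I))) :=
        mul_le_mul (ha I I.2) ((abs_add_le _ _).trans (add_le_add (hLv I) h2))
          (abs_nonneg _) (by positivity)
    _ = A I * (δ ^ w I * δ ^ (k - w I)) +
        C' * (C * M ^ (r - w I)) * (δ ^ w I * δ ^ (r - w I)) := by rw [mul_pow]; ring
    _ ≤ A I * δ ^ k + C' * (C * M ^ (r - w I)) * δ ^ k := by gcongr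
    _ = _ := by ring

theorem sum_smul_eq_of_fst_eq_zero {ι P F : Type*} [Fintype ι] [NormedAddCommGroup P]
    [NormedSpace ℝ P] [NormedAddCommGroup F] [NormedSpace ℝ F] (u : ι → ℝ) {v : ι → P × F}
    (hv : ∀ I, (v I).1 = 0) : ∑ I, u I • v I = (0, ∑ I, u I • (v I).2) := by
  refine Prod.ext ?_ ?_
  · simp [Prod.fst_sum, hv]
  · simp [Prod.snd_sum]

theorem exists_bound_fderiv_slice {P F : Type*} [NormedAddCommGroup P] [NormedSpace ℝ P]
    [ProperSpace P] [NormedAddCommGroup F] [NormedSpace ℝ F] [ProperSpace F] {g : P × F → ℝ}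
    (hg : ContDiff ℝ ∞ g) (j₀ : P) (ε : ℝ) :
    ∃ C : ℝ, 0 ≤ C ∧ ∀ j ∈ Metric.ball j₀ ε, ∀ y z : F, ‖z - y‖ ≤ 1 →
      |g (j, z - y)| ≤ C ∧ (∀ v, |fderiv ℝ g (j, z - y) (0, v)| ≤ C * ‖v‖) ∧
      HasFDerivAt (fun z => g (j, z - y))
        ((fderiv ℝ g (j, z - y)) ∘L ContinuousLinearMap.inr ℝ P F) z := by
  have hQ : IsCompact (Metric.closedBall j₀ ε ×ˢ Metric.closedBall (0 : F) 1) :=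
    (isCompact_closedBall _ _).prod (isCompact_closedBall _ _)
  obtain ⟨A, hA⟩ := hQ.exists_bound_of_continuousOn hg.continuous.continuousOn
  obtain ⟨C, hC⟩ := hQ.exists_bound_of_continuousOn
    (hg.continuous_fderiv (by simp)).continuousOn
  refine ⟨max (max A C) 0, le_max_right _ _, fun j hj y z hz => ?_⟩
  have hmem : (j, z - y) ∈ Metric.closedBall j₀ ε ×ˢ Metric.closedBall (0 : F) 1 :=
    ⟨Metric.ball_subset_closedBall hj, mem_closedBall_zero_iff.2 hz⟩
  refine ⟨(hA _ hmem).trans ((le_max_left _ _).trans (le_max_left _ _)), fun v => ?_, ?_⟩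
  · have h1 : ‖((0 : P), v)‖ = ‖v‖ := by
      rw [Prod.norm_def, norm_zero]; exact max_eq_right (norm_nonneg v)
    refine ((fderiv ℝ g (j, z - y)).le_opNorm _).trans ?_
    rw [h1]
    gcongr
    exact (hC _ hmem).trans ((le_max_right _ _).trans (le_max_left _ _))
  · have h1 : HasFDerivAt (fun z => (j, z - y)) (ContinuousLinearMap.inr ℝ P F) z :=
      (hasFDerivAt_const _ z).prodMk ((hasFDerivAt_id z).sub_const y)
    exact (hg.differentiable (by simp) _).hasFDerivAt.comp z h1

/-- Admissible curves of small length remain close to their end point. -/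
theorem IsAdmissible.norm_sub_le {Ω : Set (EuclideanSpace ℝ (Fin p))} {δ R C : ℝ}
    {x y : EuclideanSpace ℝ (Fin p)} {φ : ℝ → EuclideanSpace ℝ (Fin p)}
    (hφ : IsAdmissible X r Ω δ x y φ) (hδ : 0 ≤ δ) (hδ1 : δ ≤ 1) (hC : 0 ≤ C)
    (hXC : ∀ I ∈ multiindices n r, ∀ z ∈ Metric.ball x₀ R, ‖bracket X I z‖ ≤ C)
    (hy : y ∈ Metric.ball x₀ (R / 2)) (hδR : (multiindices n r).card * C * δ < R / 2) :
    ∀ t ∈ Icc (0 : ℝ) 1, φ t ∈ Metric.ball x₀ R ∧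
      ‖φ t - y‖ ≤ (multiindices n r).card * C * δ := by
  obtain ⟨hac, -, -, h1, a, ha⟩ := hφ
  rw [ae_restrict_iff' measurableSet_Icc] at ha
  have hcont : ContinuousOn φ (Icc 0 1) := by
    have := hac.continuousOn
    rwa [uIcc_of_le zero_le_one] at this
  set M := (multiindices n r).card * C * δ with hM
  have hM0 : 0 ≤ M := by positivity
  have hnear : ∀ z, ‖z - y‖ < R / 2 → z ∈ Metric.ball x₀ R := by
    intro z hz
    rw [← dist_eq_norm] at hz
    rw [Metric.mem_ball] at hy ⊢
    linarith [dist_triangle z y x₀]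
  -- Bootstrap backwards from `φ 1 = y`: as long as the curve stays where the fields are bounded its
  -- speed is at most `M`, hence so is its distance from `y`. The time `s` itself is a null set.
  have key : ∀ s ∈ Icc (0 : ℝ) 1, (∀ t ∈ Ioc s 1, ‖φ t - y‖ < R / 2) → ‖φ s - y‖ ≤ M := by
    intro s hs hts
    have h2 := (hac.mono (c := s) (d := 1) (by
      rw [uIcc_of_le hs.2, uIcc_of_le zero_le_one]
      exact Icc_subset_Icc_left hs.1)).norm_sub_le hs.2 (M := M) (by
        filter_upwards [ha, compl_mem_ae_iff.2 (measure_singleton s)] with t ht hne hst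
        obtain ⟨h3, h4⟩ := ht ⟨hs.1.trans hst.1, hst.2⟩
        have h5 := hnear _ (hts t ⟨lt_of_le_of_ne hst.1 (Ne.symm hne), hst.2⟩)
        exact ⟨_, h4, norm_sum_smul_le hδ hδ1 (fun I hI => weight_ne_zero hI) h3
          fun I hI => hXC I hI _ h5⟩)
    rw [h1, norm_sub_rev] at h2
    exact h2.trans (mul_le_of_le_one_right hM0 (by linarith [hs.1]))
  have hlt : ∀ t ∈ Icc (0 : ℝ) 1, ‖φ t - y‖ < R / 2 := by
    by_contra hne
    push Not at hne
    obtain ⟨t₀, ht₀, ht₀R⟩ := hne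
    have hT : IsCompact (Icc (0 : ℝ) 1 ∩ (fun t => ‖φ t - y‖) ⁻¹' Ici (R / 2)) :=
      isCompact_Icc.of_isClosed_subset
        ((hcont.sub continuousOn_const).norm.preimage_isClosed_of_isClosed isClosed_Icc
          isClosed_Ici) inter_subset_left
    -- At the last time when the curve is at distance at least `R / 2`, the bootstrap applies and
    -- contradicts `M < R / 2`.
    obtain ⟨s, ⟨hs, hsR⟩, hsup⟩ := hT.exists_isGreatest ⟨t₀, ht₀, ht₀R⟩
    have h2 := key s hs fun t ht => by
      by_contra hcon
      exact absurd (hsup ⟨⟨hs.1.trans ht.1.le, ht.2⟩, not_lt.1 hcon⟩) (not_le.2 ht.1)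
    exact absurd (h2.trans_lt hδR) (not_lt.2 hsR)
  exact fun t ht => ⟨hnear _ (hlt t ht), key t ht fun s hs =>
    hlt s ⟨ht.1.trans hs.1.le, hs.2⟩⟩

/-- A product of commutators applied to a canonical coordinate. -/
noncomputable def IsCanonicalChart.coordDeriv (h : IsCanonicalChart X r B x₀ ε K e f) (J : B)
    (l : List (List (Fin (n + 1)))) :
    smoothFunctions (JetSpace n p r × EuclideanSpace ℝ (Fin p)) :=
  operatorRep (jetField n p r) (contDiff_jetField r) (l.map formalBracket).prod
    ⟨f J, h.contDiff_coord J⟩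

theorem IsCanonicalChart.coordDeriv_nil (h : IsCanonicalChart X r B x₀ ε K e f) (J : B) :
    (h.coordDeriv J [] : JetSpace n p r × EuclideanSpace ℝ (Fin p) → ℝ) = f J := by
  simp [coordDeriv]

theorem IsCanonicalChart.coordDeriv_cons (h : IsCanonicalChart X r B x₀ ε K e f) (J : B)
    (I : List (Fin (n + 1))) (l : List (List (Fin (n + 1))))
    (y z : EuclideanSpace ℝ (Fin p)) :
    (h.coordDeriv J (I :: l) : JetSpace n p r × EuclideanSpace ℝ (Fin p) → ℝ)
      (jet X r y, z - y) =
      fderiv ℝ (h.coordDeriv J l : JetSpace n p r × EuclideanSpace ℝ (Fin p) → ℝ)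
        (jet X r y, z - y) (0, bracket (taylorField X r y) I z) := by
  have h1 : ((0 : JetSpace n p r), bracket (taylorField X r y) I z) =
      fieldBracket (jetField n p r) I (jet X r y, z - y) :=
    Prod.ext (fieldBracket_jetField_fst r I _).symm (bracket_taylorField X r I y z)
  rw [h1, ← operatorRep_formalBracket_apply (contDiff_jetField r)]
  simp [coordDeriv]

/-- Freeness of `X` at `x₀` enters only through an identity between formal commutators, which then
applies to the Taylor fields of every jet near that of `x₀`. -/
theorem IsCanonicalChart.coordDeriv_eq_zero (h : IsCanonicalChart X r B x₀ ε K e f)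
    (hfree : FreeUpToWeightAt X r x₀) (hB : B ⊆ multiindices n r)
    (hB_span : Submodule.span ℝ (Set.range (fun I : B => bracket X I x₀)) = ⊤)
    {j : JetSpace n p r} (hj : j ∈ Metric.ball (jet X r x₀) ε) (J : B)
    (l : List (List (Fin (n + 1)))) (hl : ∀ I ∈ l, I ≠ [])
    (hw : (l.map weight).sum < weight (J : List (Fin (n + 1)))) :
    (h.coordDeriv J l : JetSpace n p r × EuclideanSpace ℝ (Fin p) → ℝ) (j, 0) = 0 := by
  refine operatorRep_canonicalCoordinate_eq_zero (contDiff_jetField r)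
    (fun I hI => formalBracket_mem_span_of_free hfree hB hB_span hI) J
    (mem_multiindices.1 (hB J.2)).2 _ _ h.pos (fun u hu => ?_) l hl hw
  obtain ⟨γ, h0, hγ, hf⟩ := h.exists_curve j hj u hu
  refine ⟨fun t => (j, γ t), Prod.ext rfl h0, fun t ht => ?_, fun s hs => (hf s hs).2.2 J⟩
  have h1 := (hasDerivWithinAt_const t (Icc (0 : ℝ) 1) j).prodMk (hγ t ht)
  have h2 : ∑ I : B, u I • fieldBracket (jetField n p r) I (j, γ t) =
      (0, ∑ I : B, u I • (fieldBracket (jetField n p r) I (j, γ t)).2) := by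
    exact sum_smul_eq_of_fst_eq_zero u fun I : B =>
      fieldBracket_jetField_fst (n := n) (p := p) r I.1 (j, γ t)
  beta_reduce
  rw [h2]
  exact h1

/-- Curves ending at `y` whose velocity is a controlled combination of the commutators, the
commutators being well approximated by those of the Taylor polynomials. -/
structure IsControlledCurve
    (X : Fin (n + 1) → EuclideanSpace ℝ (Fin p) → EuclideanSpace ℝ (Fin p)) (r : ℕ)
    (C M δ : ℝ) (y : EuclideanSpace ℝ (Fin p)) (φ : ℝ → EuclideanSpace ℝ (Fin p)) : Prop where
  pos : 0 < δ
  le_one : δ ≤ 1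
  ac : AbsolutelyContinuousOnInterval φ 0 1
  apply_one : φ 1 = y
  norm_sub_le : ∀ t ∈ Icc (0 : ℝ) 1, ‖φ t - y‖ ≤ M * δ
  norm_sub_le_one : ∀ t ∈ Icc (0 : ℝ) 1, ‖φ t - y‖ ≤ 1
  norm_bracket_sub_le : ∀ t ∈ Icc (0 : ℝ) 1, ∀ I ∈ multiindices n r,
    ‖bracket X I (φ t) - bracket (taylorField X r y) I (φ t)‖ ≤ C * ‖φ t - y‖ ^ (r - weight I)
  hasDerivAt : ∀ᵐ t, t ∈ Icc (0 : ℝ) 1 → ∃ a : List (Fin (n + 1)) → ℝ,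
    (∀ I ∈ multiindices n r, |a I| ≤ δ ^ weight I) ∧
    HasDerivAt φ (∑ I ∈ multiindices n r, a I • bracket X I (φ t)) t

/-- Induction on the missing weight `s = |J| - |l|`. If `s = 0`, boundedness on a compact set is
enough. Otherwise the derivative along `φ` is `O(δ ^ s)`, by the bounds for the products with one
more factor and by Taylor's estimate, and the function vanishes at the end `φ 1 = y`; integration
backwards from there gives the bound. The empty product is the coordinate itself, with `s = |J|`. -/
theorem IsCanonicalChart.exists_coordDeriv_le (h : IsCanonicalChart X r B x₀ ε K e f)
    (hfree : FreeUpToWeightAt X r x₀) (hB : B ⊆ multiindices n r)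
    (hB_span : Submodule.span ℝ (Set.range (fun I : B => bracket X I x₀)) = ⊤)
    {C M : ℝ} (hC : 0 ≤ C) (hM : 0 ≤ M) (J : B) (m : ℕ) :
    ∀ l : List (List (Fin (n + 1))), (∀ I ∈ l, I ≠ []) →
      weight (J : List (Fin (n + 1))) - (l.map weight).sum ≤ m →
      ∃ A : ℝ, 0 ≤ A ∧ ∀ (y : EuclideanSpace ℝ (Fin p)) (δ : ℝ)
        (φ : ℝ → EuclideanSpace ℝ (Fin p)), jet X r y ∈ Metric.ball (jet X r x₀) ε →
        IsControlledCurve X r C M δ y φ → ∀ t ∈ Icc (0 : ℝ) 1,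
        |(h.coordDeriv J l : JetSpace n p r × EuclideanSpace ℝ (Fin p) → ℝ)
          (jet X r y, φ t - y)| ≤
          A * δ ^ (weight (J : List (Fin (n + 1))) - (l.map weight).sum) := by
  have : ProperSpace (JetSpace n p r) := FiniteDimensional.proper ℝ _
  have hw1 : ∀ I ∈ multiindices n r, weight I ≠ 0 := fun I hI => weight_ne_zero hI
  have htop : ∀ l : List (List (Fin (n + 1))),
      weight (J : List (Fin (n + 1))) - (l.map weight).sum = 0 → ∃ A : ℝ, 0 ≤ A ∧
      ∀ (y : EuclideanSpace ℝ (Fin p)) (δ : ℝ)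
        (φ : ℝ → EuclideanSpace ℝ (Fin p)), jet X r y ∈ Metric.ball (jet X r x₀) ε →
        IsControlledCurve X r C M δ y φ → ∀ t ∈ Icc (0 : ℝ) 1,
        |(h.coordDeriv J l : JetSpace n p r × EuclideanSpace ℝ (Fin p) → ℝ)
          (jet X r y, φ t - y)| ≤
          A * δ ^ (weight (J : List (Fin (n + 1))) - (l.map weight).sum) := by
    intro l hl
    obtain ⟨A, hA0, hA⟩ := exists_bound_fderiv_slice (contDiff_coe (h.coordDeriv J l))
      (jet X r x₀) ε
    refine ⟨A, hA0, fun y δ φ hy hφ t ht => ?_⟩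
    rw [hl, pow_zero, mul_one]
    exact (hA _ hy y (φ t) (hφ.norm_sub_le_one t ht)).1
  induction m with
  | zero => exact fun l _ hm => htop l (Nat.le_zero.1 hm)
  | succ m ih =>
    intro l hl hm
    by_cases h0 : weight (J : List (Fin (n + 1))) - (l.map weight).sum = 0
    · exact htop l h0
    have hstep : ∀ I : multiindices n r, ∃ A : ℝ, 0 ≤ A ∧ ∀ (y : EuclideanSpace ℝ (Fin p)) (δ : ℝ)
        (φ : ℝ → EuclideanSpace ℝ (Fin p)), jet X r y ∈ Metric.ball (jet X r x₀) ε →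
        IsControlledCurve X r C M δ y φ → ∀ t ∈ Icc (0 : ℝ) 1,
        |(h.coordDeriv J (I.1 :: l) : JetSpace n p r × EuclideanSpace ℝ (Fin p) → ℝ)
          (jet X r y, φ t - y)| ≤
          A * δ ^ (weight (J : List (Fin (n + 1))) - ((I.1 :: l).map weight).sum) := by
      intro I
      refine ih (I.1 :: l) ?_ ?_
      · intro I' hI'
        rcases List.mem_cons.1 hI' with rfl | hI'
        · exact (mem_multiindices.1 I.2).1
        · exact hl I' hI'
      · have := hw1 I.1 I.2
        rw [List.map_cons, List.sum_cons]
        omega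
    choose A hA0 hA using hstep
    set g : JetSpace n p r × EuclideanSpace ℝ (Fin p) → ℝ :=
      (h.coordDeriv J l : JetSpace n p r × EuclideanSpace ℝ (Fin p) → ℝ) with hg
    obtain ⟨C', hC'0, hC'⟩ := exists_bound_fderiv_slice (contDiff_coe (h.coordDeriv J l))
      (jet X r x₀) ε
    rw [← hg] at hC'
    set s := weight (J : List (Fin (n + 1))) - (l.map weight).sum with hs
    have hJr : weight (J : List (Fin (n + 1))) ≤ r := (mem_multiindices.1 (hB J.2)).2
    refine ⟨∑ I, (A I + C' * (C * M ^ (r - weight I.1))),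
      Finset.sum_nonneg fun I _ => by have := hA0 I; positivity, fun y δ φ hy hφ t ht => ?_⟩
    have hδ := hφ.pos
    have hy' := hC' _ hy y
    have hlip : LipschitzOnWith C'.toNNReal (fun z => g (jet X r y, z - y))
        (Metric.closedBall y 1) := by
      refine (convex_closedBall y 1).lipschitzOnWith_of_nnnorm_hasFDerivWithin_le
        (fun z hz => (hy' z (by rwa [← dist_eq_norm])).2.2.hasFDerivWithinAt) fun z hz => ?_
      rw [← NNReal.coe_le_coe, coe_nnnorm, Real.coe_toNNReal _ hC'0]
      refine ContinuousLinearMap.opNorm_le_bound _ hC'0 fun v => ?_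
      exact (hy' z (by rwa [← dist_eq_norm])).2.1 v
    have hac : AbsolutelyContinuousOnInterval (fun t => g (jet X r y, φ t - y)) 0 1 := by
      refine hφ.ac.comp_lipschitzOnWith (g := fun z => g (jet X r y, z - y)) hlip fun t ht => ?_
      rw [uIcc_of_le zero_le_one] at ht
      rw [Metric.mem_closedBall, dist_eq_norm]
      exact hφ.norm_sub_le_one t ht
    have h1 := (hac.mono (c := t) (d := 1) (by
      rw [uIcc_of_le ht.2, uIcc_of_le zero_le_one]
      exact Icc_subset_Icc_left ht.1)).norm_sub_le ht.2
      (M := (∑ I, (A I + C' * (C * M ^ (r - weight I.1)))) * δ ^ s) (by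
        filter_upwards [hφ.hasDerivAt] with τ hτ hτt
        have hτ01 : τ ∈ Icc (0 : ℝ) 1 := ⟨ht.1.trans hτt.1, hτt.2⟩
        obtain ⟨a, ha, hd⟩ := hτ hτ01
        have hyτ := hy' (φ τ) (hφ.norm_sub_le_one τ hτ01)
        refine ⟨_, hyτ.2.2.comp_hasDerivAt τ hd, ?_⟩
        refine abs_apply_sum_smul_le (v' := fun I => bracket (taylorField X r y) I (φ τ)) _ hδ.le
          hφ.le_one hA0 hC hC'0 hM ((Nat.sub_le _ _).trans hJr)
          ha hyτ.2.1 (fun I => ?_)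
          fun I hI => (hφ.norm_bracket_sub_le τ hτ01 I hI).trans
            (by gcongr; exact hφ.norm_sub_le τ hτ01)
        have h4 := hA I y δ φ hy hφ τ hτ01
        have h5 : weight (J : List (Fin (n + 1))) - (weight I.1 + (l.map weight).sum) =
          s - weight I.1 := by omega
        rw [List.map_cons, List.sum_cons, h5, h.coordDeriv_cons] at h4
        exact h4)
    -- The total weight of `l` is still less than `|J|`, so the product annihilates the coordinate
    -- at the center.
    have h9 : g (jet X r y, φ 1 - y) = 0 := by
      rw [hφ.apply_one, sub_self]
      exact h.coordDeriv_eq_zero hfree hB hB_span hy J l hl (by omega)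
    rw [h9, zero_sub, norm_neg, Real.norm_eq_abs] at h1
    refine h1.trans (mul_le_of_le_one_right ?_ (by linarith [ht.1]))
    refine mul_nonneg (Finset.sum_nonneg fun I _ => ?_) (by positivity)
    have := hA0 I
    positivity

/-- The homogeneous norm of the canonical coordinates is bounded by the control distance. -/
theorem IsCanonicalChart.homNorm_le (h : IsCanonicalChart X r B x₀ ε K e f)
    {Ω : Set (EuclideanSpace ℝ (Fin p))} (hΩ : IsOpen Ω) (hx₀ : x₀ ∈ Ω)
    (hX : ∀ i, ContDiffOn ℝ (r - fieldWeight i : ℕ) (X i) Ω)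
    (hXb : ∀ i, ∀ k ≤ r - fieldWeight i, ∃ C : ℝ, ∀ z ∈ Ω, ‖iteratedFDeriv ℝ k (X i) z‖ ≤ C)
    (hfree : FreeUpToWeightAt X r x₀) (hB : B ⊆ multiindices n r)
    (hB_span : Submodule.span ℝ (Set.range (fun I : B => bracket X I x₀)) = ⊤) :
    ∃ C : ℝ, 0 < C ∧ ∃ η : ℝ, 0 < η ∧ ∀ x, ∀ y ∈ Metric.ball x₀ η,
      ∀ u ∈ Metric.ball (0 : B → ℝ) 1, jet X r y ∈ Metric.ball (jet X r x₀) ε →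
      u ∈ Metric.ball 0 ε → e (jet X r y, u) = (jet X r y, x - y) →
      ENNReal.ofReal (homNorm u) ≤ ENNReal.ofReal C * controlDist X r Ω x y := by
  obtain ⟨R, hR, hRΩ⟩ := Metric.isOpen_iff.1 hΩ x₀ hx₀
  obtain ⟨C₀, hC₀, hrem⟩ := exists_norm_bracket_sub_le Metric.isOpen_ball Metric.isBounded_ball
    (convex_ball x₀ R) (fun i => (hX i).mono hRΩ)
    (fun i k hk => (hXb i k hk).imp fun C hC z hz => hC z (hRΩ hz))
  set M : ℝ := (multiindices n r).card * C₀ with hM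
  have hM0 : 0 ≤ M := by positivity
  choose A hA0 hA using fun J : B => h.exists_coordDeriv_le hfree hB hB_span hC₀ hM0 J
    (weight (J : List (Fin (n + 1)))) [] (by simp) (by simp)
  -- Being at least one, `A'` satisfies `A J ≤ A' ^ |J|`, so that the constant can be absorbed into
  -- `(A' * δ) ^ |J|`.
  set A' := 1 + ∑ J, A J with hA'
  have hA'1 : 1 ≤ A' := by
    have : 0 ≤ ∑ J, A J := Finset.sum_nonneg fun J _ => hA0 J
    linarith
  set N : ℝ := (Fintype.card B : ℝ) with hN
  have hN0 : 0 ≤ N := Nat.cast_nonneg _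
  have hw0 : ∀ J ∈ B, weight J ≠ 0 := fun J hJ => weight_ne_zero (hB hJ)
  -- Below `δ₁` admissible curves stay near `y` and the estimate along the curve applies. From `δ₁`
  -- on, `homNorm u ≤ N ≤ (N / δ₁) * δ` because `‖u‖ ≤ 1`.
  set δ₁ := min 1 (min 1 (R / 2) / (M + 1)) with hδ₁
  have hδ₁0 : 0 < δ₁ := by positivity
  have hCpos : 0 < N * A' + N / δ₁ + 1 := by positivity
  refine ⟨N * A' + N / δ₁ + 1, hCpos, R / 2, by positivity, ?_⟩
  intro x y hy u hu hj huε he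
  rw [mem_ball_zero_iff] at hu
  have hreal : ∀ δ : ℝ, 0 < δ → ∀ φ, IsAdmissible X r Ω δ x y φ →
      homNorm u ≤ (N * A' + N / δ₁ + 1) * δ := by
    intro δ hδ φ hφ
    rcases le_or_gt δ₁ δ with hle | hlt
    · have h1 : N ≤ N / δ₁ * δ := by
        rw [div_mul_eq_mul_div, le_div_iff₀ hδ₁0]
        gcongr
      have h2 : 0 ≤ (N * A' + 1) * δ := by positivity
      linarith [homNorm_le_card hu.le]
    · have hδ1 : δ ≤ 1 := (hlt.trans_le (min_le_left _ _)).le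
      have h1 : M * δ < min 1 (R / 2) := by
        have h2 := hlt.trans_le (min_le_right _ _)
        rw [lt_div_iff₀ (by positivity)] at h2
        linarith
      rw [lt_min_iff] at h1
      have h2 := hφ.norm_sub_le hδ.le hδ1 hC₀
        (fun I hI z hz => (hrem I hI z hz z hz).1) hy h1.2
      obtain ⟨hac, -, hφ0, hφ1, a, ha⟩ := hφ
      rw [ae_restrict_iff' measurableSet_Icc] at ha
      have hyR : y ∈ Metric.ball x₀ R := Metric.ball_subset_ball (by linarith) hy
      have hcc : IsControlledCurve X r C₀ M δ y φ :=
        { pos := hδ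
          le_one := hδ1
          ac := hac
          apply_one := hφ1
          norm_sub_le := fun t ht => (h2 t ht).2
          norm_sub_le_one := fun t ht => (h2 t ht).2.trans h1.1.le
          norm_bracket_sub_le := fun t ht I hI => (hrem I hI y hyR _ (h2 t ht).1).2
          hasDerivAt := by
            filter_upwards [ha] with t ht ht01
            exact ⟨fun I => a I t, ht ht01⟩ }
      obtain ⟨ψ, -, -, h3, h4, -⟩ := h.exists_expCurve hj huε
      rw [he] at h3
      have h3 : x - y = ψ 1 - y := congrArg Prod.snd h3
      have h5 : ∀ J : B, |u J| ≤ (A' * δ) ^ weight (J : List (Fin (n + 1))) := by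
        intro J
        have h6 := hA J y δ φ hj hcc 0 ⟨le_rfl, zero_le_one⟩
        rw [h.coordDeriv_nil, hφ0, h3, h4] at h6
        have h7 : A J ≤ A' := by
          have := Finset.single_le_sum (fun J _ => hA0 J) (Finset.mem_univ J)
          linarith
        calc |u J| ≤ A J * δ ^ weight (J : List (Fin (n + 1))) := by simpa using h6
          _ ≤ A' ^ weight (J : List (Fin (n + 1))) * δ ^ weight (J : List (Fin (n + 1))) := by
            gcongr
            exact h7.trans (le_self_pow₀ hA'1 (hw0 J J.2))
          _ = _ := (mul_pow _ _ _).symm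
      have h6 := homNorm_le_of_abs_le hw0 (by positivity) h5
      have h7 : 0 ≤ (N / δ₁ + 1) * δ := by positivity
      linarith
  -- Dividing by the constant isolates the infimum and covers the case of an infinite distance.
  have hC0 : ENNReal.ofReal (N * A' + N / δ₁ + 1) ≠ 0 := by
    rw [Ne, ENNReal.ofReal_eq_zero, not_le]; exact hCpos
  rw [mul_comm, ← ENNReal.div_le_iff hC0 ENNReal.ofReal_ne_top]
  refine le_sInf ?_
  rintro _ ⟨δ, hδ, ⟨φ, hφ⟩, rfl⟩
  rw [ENNReal.div_le_iff hC0 ENNReal.ofReal_ne_top, mul_comm, ← ENNReal.ofReal_mul hCpos.le]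
  exact ENNReal.ofReal_le_ofReal (hreal δ hδ φ hφ)

end LowerBound

end WeightedFields

/-! ### The proposition. -/

theorem mainTheorem4 (n p r : ℕ) (hr : 2 ≤ r) (α : ℝ) (hα₀ : 0 < α) (hα₁ : α ≤ 1)
    (Ω : Set (EuclideanSpace ℝ (Fin p)))
    (hΩ_open : IsOpen Ω) (hΩ_conn : IsConnected Ω) (hΩ_bdd : Bornology.IsBounded Ω)
    (X : Fin (n + 1) → EuclideanSpace ℝ (Fin p) → EuclideanSpace ℝ (Fin p))
    (hX_reg : ∀ i, IsHolderClass (r - fieldWeight i) α Ω (X i))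
    (hX_span : ∀ x ∈ Ω,
      Submodule.span ℝ ((fun I => bracket X I x) '' (multiindices n r : Set _)) = ⊤)
    (hX_free : ∀ x ∈ Ω, FreeUpToWeightAt X r x)
    (x₀ : EuclideanSpace ℝ (Fin p)) (hx₀ : x₀ ∈ Ω)
    (B : Finset (List (Fin (n + 1)))) (hB : B ⊆ multiindices n r)
    (hB_indep : LinearIndependent ℝ (fun I : B => bracket X I x₀))
    (hB_span : Submodule.span ℝ (Set.range (fun I : B => bracket X I x₀)) = ⊤) :
    (∃ (U : Set (B → ℝ)) (W : Set (EuclideanSpace ℝ (Fin p)))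
      (Θ : EuclideanSpace ℝ (Fin p) →
        OpenPartialHomeomorph (EuclideanSpace ℝ (Fin p)) (B → ℝ)),
      W ∈ 𝓝 x₀ ∧ W ⊆ Ω ∧ IsThetaMap X r B U W Θ) ∧
    ∀ (U : Set (B → ℝ)) (W₀ : Set (EuclideanSpace ℝ (Fin p)))
      (Θ : EuclideanSpace ℝ (Fin p) →
        OpenPartialHomeomorph (EuclideanSpace ℝ (Fin p)) (B → ℝ)),
      W₀ ∈ 𝓝 x₀ → W₀ ⊆ Ω → IsThetaMap X r B U W₀ Θ →
      ∃ W ∈ 𝓝 x₀, W ⊆ W₀ ∧ ∃ C₁ C₂ : ℝ, 0 < C₁ ∧ 0 < C₂ ∧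
        ∀ x ∈ W, ∀ y ∈ W,
          ENNReal.ofReal C₁ * controlDist X r Ω x y ≤ ENNReal.ofReal (quasiDist Θ x y) ∧
          ENNReal.ofReal (quasiDist Θ x y) ≤ ENNReal.ofReal C₂ * controlDist X r Ω x y := by
  have hX : ∀ i, ContDiffOn ℝ (r - fieldWeight i : ℕ) (X i) Ω := fun i => (hX_reg i).1
  have hXb : ∀ i, ∀ k ≤ r - fieldWeight i, ∃ C : ℝ, ∀ z ∈ Ω, ‖iteratedFDeriv ℝ k (X i) z‖ ≤ C :=
    fun i => (hX_reg i).2.1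
  have hΩ₀ : Ω ∈ 𝓝 x₀ := hΩ_open.mem_nhds hx₀
  have hXx : ∀ i, ContDiffAt ℝ (r - fieldWeight i : ℕ) (X i) x₀ := fun i =>
    (hX i).contDiffAt hΩ₀
  obtain ⟨ε, K, e, f, h⟩ := exists_isCanonicalChart hXx hB hB_indep hB_span
  refine ⟨⟨Metric.ball 0 ε, h.exists_thetaMap hXx hΩ₀⟩, fun U W₀ Θ hW₀ _ hΘ => ?_⟩
  obtain ⟨C, hC, η, hη, hupper⟩ :=
    h.controlDist_le hΩ_open hx₀ hX hXb hB hB_indep hB_span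
  obtain ⟨C', hC', η', hη', hlower⟩ :=
    h.homNorm_le hΩ_open hx₀ hX hXb (hX_free x₀ hx₀) hB hB_span
  -- On `W` the given `Θ` agrees with the canonical chart, and its values are small enough for both
  -- estimates: smaller than `η` for one, than `1` for the other.
  obtain ⟨W, hW, hWe⟩ := eventually_prod_self_iff'.1
    (h.eventually_theta_eq hXx hW₀ hΘ (lt_min hη one_pos))
  refine ⟨W ∩ W₀ ∩ (Metric.ball x₀ η ∩ Metric.ball x₀ η'), inter_mem (inter_mem hW hW₀)
    (inter_mem (Metric.ball_mem_nhds x₀ hη) (Metric.ball_mem_nhds x₀ hη')),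
    fun x hx => hx.1.2, C⁻¹, C', inv_pos.2 hC, hC', fun x hx y hy => ?_⟩
  obtain ⟨hj, huε, huη, he⟩ := hWe x hx.1.1 y hy.1.1
  constructor
  · calc _ ≤ ENNReal.ofReal C⁻¹ * ENNReal.ofReal (C * homNorm (Θ y x)) := by
          gcongr
          exact hupper x y hy.2.1 _ (Metric.ball_subset_ball (min_le_left _ _) huη) hj huε he
      _ = _ := by
        rw [← ENNReal.ofReal_mul (inv_nonneg.2 hC.le), inv_mul_cancel_left₀ hC.ne']
        rfl
  · exact hlower x y hy.2.2 _ (Metric.ball_subset_ball (min_le_right _ _) huη) hj huε he
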